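/- **Setting.** Fix integers $d\ge 2$ and $1\le k\le d$, a set $\mathcal J\subset\{1,\dots,k\}$ with $1\in\mathcal J$, and $\alpha\in(0,1)$. For $n=1,2,\dots$ let $A_n\in\mathbb R^{n\times d}$ be deterministic with rows $a_1,\dots,a_n$, let $t_n,B_n$ be positive integers with $t_n\to\infty$ and $B_n\to\infty$, and let $S_n\in\mathbb R^{t_n\times n}$ be a random matrix with i.i.d. rows. Either every $S_n$ is a *Gaussian random projection* (its rows are $N(0,\frac1{t_n}I_n)$), or every $S_n$ is a *row-sampling matrix* (for some probabilities $p_1,\dots,p_n>0$ with $\sum_l p_l=1$, which may depend on $n$, each row equals $\frac1{\sqrt{t_np_l}}e_l$ with probability $p_l$, where $e_l$ is the $l$-th standard basis vector). *Assumption RP.* There is a positive definite $\mathsf G_\infty\in\mathbb R^{d\times d}$, all of whose eigenvalues have multiplicity 1, with $\frac1nA_n^\top A_n\to\mathsf G_\infty$. *Assumption RS.* Assumption RP holds. With $\tilde r_n\in\mathbb R^d$ the first row of $\frac{\sqrt{t_n}}{\sqrt n}S_nA_n$, for every $C\in\mathbb R^{d\times d}$ the sequence $\operatorname{var}(\tilde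 r_n^\top C\tilde r_n)$ converges to a finite limit $\ell(C)$; moreover $\ell(\mathsf v_1\mathsf v_1^\top)>0$ and $\ell(\mathsf v_1\mathsf v_2^\top)>0$, where $\mathsf v_1,\mathsf v_2$ are unit eigenvectors of $\mathsf G_\infty$ for its largest and second largest eigenvalue; and $\max_{1\le l\le n}\|\frac1{\sqrt{np_l}}a_l\|_2=o(t_n^{1/8})$. **Sketching errors.** Let $\rho(w,w')=\sqrt{1-(w^\top w')^2}$. Normalizing a vector means dividing it by its Euclidean norm, with $0$ normalized to $0$. Singular values are in decreasing order, and singular vectors may be chosen arbitrarily where they are not unique. Let $(u_j,\sigma_j,v_j)$, $j\le k$, be the top $k$ singular triples of $A_n$ (for $n\ge d$), let $\tilde A=S_nA_n$, let $\tilde\sigma_j,\tilde v_j$ be the top $k$ singular values and right singular vectors of $\tilde A$, and let $\tilde u_j$ be the normalization of $A_n\tilde v_j$. **Bootstrap.** For $b=1,\dots,B_n$, independently given $S_n$, let $\tilde A^*$ consist of $t_n$ rows drawn uniformly with replacement from the rows of $\tilde A$, with top $k$ singular values $\tilde\sigma_j^*$ and right singular vectors $\tilde v_j^*$. Let $\breve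 u_j,\breve u_j^*$ be the normalizations of $\tilde A\tilde v_j,\tilde A\tilde v_j^*$, and put $$\tilde\epsilon^*_{U,b}=\max_{j\in\mathcal J}\rho(\breve u_j^*,\breve u_j),\quad \tilde\epsilon^*_{\Sigma,b}=\max_{j\in\mathcal J}|\tilde\sigma_j^*-\tilde\sigma_j|,\quad \tilde\epsilon^*_{V,b}=\max_{j\in\mathcal J}\rho(\tilde v_j^*,\tilde v_j).$$ Let $\hat q_U,\hat q_\Sigma,\hat q_V$ be the empirical $(1-\alpha)$-quantiles of these three lists, where the empirical quantile of $x_1,\dots,x_B$ is $\inf\{q\in\mathbb R:\frac1B\#\{b:x_b\le q\}\ge1-\alpha\}$. **Theorem.** Suppose that Assumption RP holds in the case of Gaussian random projections, or that Assumption RS holds in the case of row-sampling matrices. Then, as $n\to\infty$, with $\mathbb P$ accounting for both the sketching and the bootstrap randomness, $$\mathbb P\Big(\max_{j\in\mathcal J}\rho(\tilde u_j,u_j)\le\hat q_U\Big)\to1-\alpha,\qquad \mathbb P\Big(\max_{j\in\mathcal J}|\tilde\sigma_j-\sigma_j|\le\hat q_\Sigma\Big)\to1-\alpha,\qquad \mathbb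 P\Big(\max_{j\in\mathcal J}\rho(\tilde v_j,v_j)\le\hat q_V\Big)\to1-\alpha.$$ -/

import Mathlib

open MeasureTheory ProbabilityTheory Filter Topology Matrix

noncomputable section

namespace SketchedSVD

/-! ### Singular values and singular vectors -/

/-- The matrix `M` acting on Euclidean vectors: `x ↦ M x`. -/
abbrev act {m d : ℕ} (M : Matrix (Fin m) (Fin d) ℝ) (x : EuclideanSpace ℝ (Fin d)) :
    EuclideanSpace ℝ (Fin m) :=
  WithLp.toLp 2 (M *ᵥ x.ofLp)

/-- The singular values of `M` in decreasing order, counted with multiplicity.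
The index starts at `0`, so `sval M 0` is the largest one. -/
def sval {m d : ℕ} (M : Matrix (Fin m) (Fin d) ℝ) (j : ℕ) : ℝ :=
  (Matrix.toEuclideanLin M).singularValues j

/-- `v 0, …, v (k-1)` are right singular vectors of `M` for its top `k` singular values:
orthonormal eigenvectors of `Mᵀ M` for the `k` largest eigenvalues, in decreasing order. -/
structure IsTopRightSingular {m d k : ℕ} (M : Matrix (Fin m) (Fin d) ℝ)
    (v : Fin k → EuclideanSpace ℝ (Fin d)) : Prop where
  orthonormal : Orthonormal ℝ v
  eigen : ∀ j : Fin k, act (Mᵀ * M) (v j) = (sval M j) ^ 2 • v j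

/-- `(u j, σ_j(M), v j)`, `j < k`, are the top `k` singular triples of `M`. -/
structure IsTopSVD {m d k : ℕ} (M : Matrix (Fin m) (Fin d) ℝ)
    (u : Fin k → EuclideanSpace ℝ (Fin m)) (v : Fin k → EuclideanSpace ℝ (Fin d)) : Prop where
  left_orthonormal : Orthonormal ℝ u
  right_orthonormal : Orthonormal ℝ v
  map_right : ∀ j : Fin k, act M (v j) = sval M j • u j
  map_left : ∀ j : Fin k, act Mᵀ (u j) = sval M j • v j

/-- The sine distance `√(1 - (wᵀ w')²)`. -/
def sinDist {m : ℕ} (w w' : EuclideanSpace ℝ (Fin m)) : ℝ :=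
  √(1 - (inner ℝ w w') ^ 2)

/-! ### Random sketching matrices -/

/-- The rows of the random matrix `S` are i.i.d. with law `ν`. -/
structure HasIIDRows {Ω : Type*} [MeasurableSpace Ω] (P : Measure Ω) {t n : ℕ}
    (S : Ω → Matrix (Fin t) (Fin n) ℝ) (ν : Measure (Fin n → ℝ)) : Prop where
  indep : iIndepFun (fun (i : Fin t) (ω : Ω) (j : Fin n) => S ω i j) P
  law : ∀ i : Fin t, HasLaw (fun (ω : Ω) (j : Fin n) => S ω i j) ν P

/-- The Gaussian distribution `N(0, (1/t) I_n)` on `ℝⁿ`. -/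
def gaussianRowLaw (t n : ℕ) : Measure (Fin n → ℝ) :=
  Measure.pi fun _ => gaussianReal 0 (1 / (t : NNReal))

/-- The distribution on `ℝⁿ` that puts mass `p l` on `(1 / √(t p_l)) e_l`. -/
def samplingRowLaw (t : ℕ) {n : ℕ} (p : Fin n → ℝ) : Measure (Fin n → ℝ) :=
  ∑ l, ENNReal.ofReal (p l) • Measure.dirac (Pi.single l (1 / √((t : ℝ) * p l)))

/-- `S` is a `t × n` Gaussian random projection. -/
def IsGaussianProjection {Ω : Type*} [MeasurableSpace Ω] (P : Measure Ω) {t n : ℕ}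
    (S : Ω → Matrix (Fin t) (Fin n) ℝ) : Prop :=
  HasIIDRows P S (gaussianRowLaw t n)

/-- `S` is a `t × n` row-sampling matrix with sampling probabilities `p`. -/
structure IsRowSampling {Ω : Type*} [MeasurableSpace Ω] (P : Measure Ω) {t n : ℕ}
    (S : Ω → Matrix (Fin t) (Fin n) ℝ) (p : Fin n → ℝ) : Prop where
  prob_pos : ∀ l, 0 < p l
  prob_sum : ∑ l, p l = 1
  rows : HasIIDRows P S (samplingRowLaw t p)

/-! ### The assumptions -/

/-- `n⁻¹ A_nᵀ A_n → G`, where `G` is positive definite with eigenvalues of multiplicity one. -/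
structure AssumptionRP {d : ℕ} (A : ∀ n : ℕ, Matrix (Fin n) (Fin d) ℝ)
    (G : Matrix (Fin d) (Fin d) ℝ) : Prop where
  posDef : G.PosDef
  gram_tendsto : Tendsto (fun n : ℕ => (1 / (n : ℝ)) • ((A n)ᵀ * A n)) atTop (𝓝 G)
  simple : ∀ μ : ℝ,
    Module.finrank ℝ (Module.End.eigenspace (Matrix.toLin' G) μ) ≤ 1

/-- For `G` symmetric with simple eigenvalues: `v₁`, `v₂` are unit eigenvectors for the largest
and for the second largest eigenvalue of `G`. -/
def IsTopTwoEigenvectors {d : ℕ} (G : Matrix (Fin d) (Fin d) ℝ)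
    (v₁ v₂ : EuclideanSpace ℝ (Fin d)) : Prop :=
  ‖v₁‖ = 1 ∧ ‖v₂‖ = 1 ∧ ∃ l₁ l₂ : ℝ, l₂ < l₁ ∧ act G v₁ = l₁ • v₁ ∧ act G v₂ = l₂ • v₂ ∧
    ∀ μ : ℝ, Module.End.HasEigenvalue (Matrix.toLin' G) μ → μ = l₁ ∨ μ ≤ l₂

/-- The first row of the re-scaled sketch `(√t / √n) S A`. -/
def firstRow {t n d : ℕ} [NeZero t] (S : Matrix (Fin t) (Fin n) ℝ)
    (A : Matrix (Fin n) (Fin d) ℝ) : Fin d → ℝ :=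
  ((√(t : ℝ) / √(n : ℝ)) • (S * A)) 0

/-- The additional assumptions for row sampling. -/
structure AssumptionRS {Ω : ℕ → Type*} [∀ n, MeasurableSpace (Ω n)] (P : ∀ n, Measure (Ω n))
    {d : ℕ} (t : ℕ → ℕ) [∀ n, NeZero (t n)] (A : ∀ n : ℕ, Matrix (Fin n) (Fin d) ℝ)
    (S : ∀ n, Ω n → Matrix (Fin (t n)) (Fin n) ℝ) (p : ∀ n : ℕ, Fin n → ℝ)
    (G : Matrix (Fin d) (Fin d) ℝ) : Prop extends AssumptionRP A G where
  var_tendsto : ∃ ℓ : Matrix (Fin d) (Fin d) ℝ → ℝ,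
    (∀ C : Matrix (Fin d) (Fin d) ℝ,
      Tendsto (fun n : ℕ => variance
        (fun ω => firstRow (S n ω) (A n) ⬝ᵥ (C *ᵥ firstRow (S n ω) (A n))) (P n))
        atTop (𝓝 (ℓ C))) ∧
    ∃ v₁ v₂ : EuclideanSpace ℝ (Fin d), IsTopTwoEigenvectors G v₁ v₂ ∧
      0 < ℓ (Matrix.vecMulVec v₁.ofLp v₁.ofLp) ∧ 0 < ℓ (Matrix.vecMulVec v₁.ofLp v₂.ofLp)
  growth : (fun n : ℕ => ⨆ l : Fin n,
      ‖(1 / √((n : ℝ) * p n l)) • (WithLp.toLp 2 (A n l) : EuclideanSpace ℝ (Fin d))‖)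
    =o[atTop] (fun n : ℕ => (t n : ℝ) ^ (1 / 8 : ℝ))

/-! ### Sketching errors and their bootstrap versions

In what follows `A` is the data matrix and `At = S A` its sketch; `u`, `v` are exact singular
vectors, `vt` are right singular vectors of `At`, and `vs` are right singular vectors of the
resampled sketch `As`. Maxima are over the nonempty index set `J`.  The function
`NormedSpace.normalize` sends `x ≠ 0` to `x / ‖x‖` and `0` to `0`. -/

/-- `max_{j ∈ J} ρ(ũ_j, u_j)` with `ũ_j = A ṽ_j / ‖A ṽ_j‖`. -/
def errU {n d k : ℕ} (J : Finset (Fin k)) (hJ : J.Nonempty) (A : Matrix (Fin n) (Fin d) ℝ)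
    (vt : Fin k → EuclideanSpace ℝ (Fin d)) (u : Fin k → EuclideanSpace ℝ (Fin n)) : ℝ :=
  J.sup' hJ fun j => sinDist (NormedSpace.normalize (act A (vt j))) (u j)

/-- `max_{j ∈ J} |σ_j(M) - σ_j(A)|`. -/
def errSigma {m n d k : ℕ} (J : Finset (Fin k)) (hJ : J.Nonempty)
    (M : Matrix (Fin m) (Fin d) ℝ) (A : Matrix (Fin n) (Fin d) ℝ) : ℝ :=
  J.sup' hJ fun j => |sval M j - sval A j|

/-- `max_{j ∈ J} ρ(w_j, v_j)`. -/
def errV {d k : ℕ} (J : Finset (Fin k)) (hJ : J.Nonempty)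
    (w v : Fin k → EuclideanSpace ℝ (Fin d)) : ℝ :=
  J.sup' hJ fun j => sinDist (w j) (v j)

/-- The bootstrap sample `max_{j ∈ J} ρ(At v*_j / ‖At v*_j‖, At ṽ_j / ‖At ṽ_j‖)`. -/
def bootErrU {t d k : ℕ} (J : Finset (Fin k)) (hJ : J.Nonempty) (At : Matrix (Fin t) (Fin d) ℝ)
    (vs vt : Fin k → EuclideanSpace ℝ (Fin d)) : ℝ :=
  J.sup' hJ fun j => sinDist (NormedSpace.normalize (act At (vs j)))
    (NormedSpace.normalize (act At (vt j)))

/-- The matrix whose `i`th row is row `I i` of `At`. -/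
def resample {t d : ℕ} (At : Matrix (Fin t) (Fin d) ℝ) (I : Fin t → Fin t) :
    Matrix (Fin t) (Fin d) ℝ :=
  At.submatrix I id

/-- The index `I b i` is the row drawn in position `i` of the `b`th bootstrap sample: all these
draws are independent and uniform on the rows, and they are independent of the sketch `S`. -/
structure IsBootstrapSampling {Ω : Type*} [MeasurableSpace Ω] (P : Measure Ω) {t n B : ℕ}
    (S : Ω → Matrix (Fin t) (Fin n) ℝ) (I : Ω → Fin B → Fin t → Fin t) : Prop where
  indep : iIndepFun (fun (bi : Fin B × Fin t) (ω : Ω) => I ω bi.1 bi.2) P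
  law : ∀ b i, HasLaw (fun ω => I ω b i) (uniformOn (Set.univ : Set (Fin t))) P
  indep_sketch : IndepFun (fun ω (i : Fin t) (j : Fin n) => S ω i j) I P

/-- The empirical distribution function `F_B(q) = (1/B) #{b | x b ≤ q}`. -/
def empCDF {B : ℕ} (x : Fin B → ℝ) (q : ℝ) : ℝ :=
  (1 / (B : ℝ)) * ∑ b, Set.indicator {y : ℝ | y ≤ q} (fun _ => (1 : ℝ)) (x b)

/-- The empirical quantile `inf {q | F_B(q) ≥ a}`. -/
def quantile {B : ℕ} (x : Fin B → ℝ) (a : ℝ) : ℝ :=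
  sInf {q : ℝ | a ≤ empCDF x q}

end SketchedSVD

end

/-! All three errors are functions of two Gram matrices divided by `n` (`nGram`): that of a base
matrix and that of its sketch. This includes the left singular vectors, since the angle between `A
w` and `A v` is the angle between `w` and `v` for the form of `AᵀA` (`sinDist_normalize_act`). Let
`H` be `√t` times the difference of the two Gram matrices. The limit `G` has simple positive
eigenvalues, so first order perturbation theory shows that the rescaled errors are, up to `o(1)`,
fixed continuous homogeneous functions of `H`. By `exists_error_radius` this is uniform over bounded
`H` and over base points near `G`. The uniformity matters because a bootstrap error has the same
structure, with the random base matrix `S A` in place of `A` and with a direction `H*` in place of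
`H`.

It remains to compare the laws of `H` and `H*`. Both are normalized sums of i.i.d. matrices `r rᵀ`:
for `H` the vector `r` has the law of a row of the rescaled sketch, and for `H*`, given the sketch,
the empirical law of these rows. `exists_clt_radius` is a central limit theorem uniform over all
laws with nearly prescribed moments. It applies to the true law and, by laws of large numbers
(`tendsto_measureReal_not_good`), with high probability to the empirical law, and the Gaussian limit
is the same. Since the number of replicates tends to infinity, their frequencies follow the
conditional probabilities (`measureReal_bootProb_add_le_freq`).

Coverage (`tendsto_coverage`) then needs a limiting error without atoms. Positive levels of a
homogeneous function are null by scaling. Level zero is null because the error with the leading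
index vanishes only where a linear form of positive variance does: `g₀ᵀ H g₀` for singular values,
`g₀ᵀ H g₁` for singular vectors (`multivariateGaussian_level_eq_zero`). The moment conditions,
collected in `SampleModel`, are checked separately for the two kinds of sketches. -/

noncomputable section

namespace SketchedSVD

/-! ### Bilinear forms and sorted eigenbases -/

/-- Square matrices of size `d`, as a Euclidean space. -/
abbrev MatSpace (d : ℕ) := EuclideanSpace ℝ (Fin d × Fin d)

/-- The bilinear form `xᵀ H y`. -/
def bil {d : ℕ} (H : MatSpace d) (x y : EuclideanSpace ℝ (Fin d)) : ℝ :=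
  ∑ q, H q * (x q.1 * y q.2)

section Bil

variable {d : ℕ} (H K : MatSpace d) (x y z : EuclideanSpace ℝ (Fin d)) (c : ℝ)

lemma bil_add : bil (H + K) x y = bil H x y + bil K x y := by
  simp [bil, add_mul, Finset.sum_add_distrib]

lemma bil_smul : bil (c • H) x y = c * bil H x y := by
  simp [bil, Finset.mul_sum, mul_assoc]

lemma bil_smul_left : bil H (c • x) y = c * bil H x y := by
  simp only [bil, Finset.mul_sum, PiLp.smul_apply, smul_eq_mul]
  exact Finset.sum_congr rfl fun _ _ => by ring

lemma bil_smul_right : bil H x (c • y) = c * bil H x y := by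
  simp only [bil, Finset.mul_sum, PiLp.smul_apply, smul_eq_mul]
  exact Finset.sum_congr rfl fun _ _ => by ring

lemma continuous_bil :
    Continuous fun q : MatSpace d × EuclideanSpace ℝ (Fin d) × EuclideanSpace ℝ (Fin d) =>
      bil q.1 q.2.1 q.2.2 := by
  unfold bil
  fun_prop

lemma tendsto_bil {ι : Type*} {l : Filter ι} {H : ι → MatSpace d} {H₀ : MatSpace d}
    {x y : ι → EuclideanSpace ℝ (Fin d)} {x₀ y₀ : EuclideanSpace ℝ (Fin d)}
    (hH : Tendsto H l (𝓝 H₀)) (hx : Tendsto x l (𝓝 x₀)) (hy : Tendsto y l (𝓝 y₀)) :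
    Tendsto (fun i => bil (H i) (x i) (y i)) l (𝓝 (bil H₀ x₀ y₀)) :=
  (continuous_bil.tendsto (H₀, x₀, y₀)).comp (hH.prodMk_nhds (hx.prodMk_nhds hy))

lemma continuous_bil_left : Continuous fun H : MatSpace d => bil H x y := by
  unfold bil
  fun_prop

end Bil

/-- `b` is an orthonormal basis of eigenvectors of the symmetric matrix `M`, for the eigenvalues
`μ` in decreasing order. -/
structure SortedEig {d : ℕ} (M : MatSpace d) (b : Fin d → EuclideanSpace ℝ (Fin d))
    (μ : Fin d → ℝ) : Prop where
  orthonormal : Orthonormal ℝ b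
  symm : ∀ x y, bil M x y = bil M y x
  eigen : ∀ l y, bil M y (b l) = μ l * inner ℝ y (b l)
  anti : Antitone μ

namespace SortedEig

variable {d : ℕ} {M : MatSpace d} {b : Fin d → EuclideanSpace ℝ (Fin d)} {μ : Fin d → ℝ}

lemma sum_inner_sq (h : SortedEig M b μ) (x : EuclideanSpace ℝ (Fin d)) :
    ∑ l, (inner ℝ x (b l)) ^ 2 = ‖x‖ ^ 2 := by
  have hs : ⊤ ≤ Submodule.span ℝ (Set.range b) := by
    have := h.orthonormal.linearIndependent.span_eq_top_of_card_eq_finrank' (by simp)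
    exact this.ge
  have := (OrthonormalBasis.mk h.orthonormal hs).sum_sq_norm_inner_left x
  simpa using this

lemma norm_eq_one (h : SortedEig M b μ) (l : Fin d) : ‖b l‖ = 1 := h.orthonormal.1 l

lemma eigen' (h : SortedEig M b μ) (l : Fin d) (y) : bil M (b l) y = μ l * inner ℝ (b l) y := by
  rw [h.symm, h.eigen, real_inner_comm]

lemma bil_self (h : SortedEig M b μ) (l : Fin d) : bil M (b l) (b l) = μ l := by
  rw [h.eigen, real_inner_self_eq_norm_sq, h.norm_eq_one]; simp

/-- A unit eigenvector for a simple eigenvalue is unique up to its sign. -/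
lemma eq_or_eq_neg (h : SortedEig M b μ) {x : EuclideanSpace ℝ (Fin d)} (hx : ‖x‖ = 1)
    {c : ℝ} (hc : ∀ y, bil M y x = c * inner ℝ y x) {j : Fin d} (hj : ∀ l, l ≠ j → μ l ≠ c) :
    x = b j ∨ x = -b j := by
  have h0 : ∀ l, l ≠ j → inner ℝ x (b l) = 0 := by
    intro l hl
    have h1 := hc (b l)
    rw [h.eigen'] at h1
    have h2 : (μ l - c) * inner ℝ (b l) x = 0 := by linarith
    rw [real_inner_comm]
    exact (mul_eq_zero.1 h2).resolve_left (sub_ne_zero.2 (hj l hl))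
  have h1 := h.sum_inner_sq x
  rw [Finset.sum_eq_single j (fun l _ hl => by rw [h0 l hl]; simp) (by simp), hx] at h1
  have h2 : (inner ℝ x (b j) - 1) * (inner ℝ x (b j) + 1) = 0 := by nlinarith
  rcases mul_eq_zero.1 h2 with h3 | h3
  · left
    exact (inner_eq_one_iff_of_norm_eq_one (𝕜 := ℝ) hx (h.norm_eq_one j)).1 (by linarith)
  · right
    rw [← inner_eq_one_iff_of_norm_eq_one (𝕜 := ℝ) hx (by rw [norm_neg, h.norm_eq_one j]),
      inner_neg_right]
    linarith

/-- For simple eigenvalues, the sorted eigenbasis is unique up to signs. -/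
lemma unique (h : SortedEig M b μ) {b' : Fin d → EuclideanSpace ℝ (Fin d)} {μ' : Fin d → ℝ}
    (h' : SortedEig M b' μ') (hμ : StrictAnti μ) :
    μ' = μ ∧ ∀ l, b' l = b l ∨ b' l = -b l := by
  -- A nonzero coefficient of `b' l` on `b (σ l)` identifies its eigenvalue as `μ (σ l)`.
  -- Orthonormality makes `σ` injective, the sorting makes it monotone, and a strictly monotone
  -- bijection of `Fin d` is the identity.
  have hex : ∀ l, ∃ i, inner ℝ (b' l) (b i) ≠ 0 := by
    intro l
    by_contra! h0
    have := h.sum_inner_sq (b' l)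
    simp [h0, h'.norm_eq_one] at this
  choose σ hσ using hex
  have hval : ∀ l, μ' l = μ (σ l) := by
    intro l
    have h1 := h'.eigen l (b (σ l))
    rw [h.eigen', real_inner_comm] at h1
    exact (mul_right_cancel₀ (hσ l) h1).symm
  have hvec : ∀ l, b' l = b (σ l) ∨ b' l = -b (σ l) := fun l =>
    h.eq_or_eq_neg (h'.norm_eq_one l) (h'.eigen l)
      (fun i hi => by rw [hval]; exact fun e => hi (hμ.injective e))
  have hinj : Function.Injective σ := by
    intro i j hij
    by_contra hne
    have h0 := h'.orthonormal.2 hne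
    have h1 := hvec i
    rw [hij] at h1
    have h2 := h.norm_eq_one (σ j)
    rcases h1 with h1 | h1 <;> rcases hvec j with h3 | h3 <;>
      · simp only [h1, h3, inner_neg_left, inner_neg_right, real_inner_self_eq_norm_sq, h2] at h0
        norm_num at h0
  have hmono : StrictMono σ := by
    refine Monotone.strictMono_of_injective (fun i j hij => ?_) hinj
    have := h'.anti hij
    rw [hval, hval] at this
    exact hμ.le_iff_ge.1 this
  have hid : σ = id := by
    have hsurj := Finite.surjective_of_injective hinj
    exact (hmono.range_inj strictMono_id).1 (by simp [hsurj.range_eq])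
  subst hid
  exact ⟨funext hval, hvec⟩

end SortedEig

/-! ### Limits of rescaled perturbations of singular values and vectors -/

/-- Limit of the rescaled error of the `j`th singular value in the direction `H`. -/
def limSigma {d : ℕ} (g : Fin d → EuclideanSpace ℝ (Fin d)) (lam : Fin d → ℝ) (j : Fin d)
    (H : MatSpace d) : ℝ :=
  |bil H (g j) (g j)| / (2 * √(lam j))

/-- Limit of the rescaled error of the `j`th right singular vector in the direction `H`. -/
def limV {d : ℕ} (g : Fin d → EuclideanSpace ℝ (Fin d)) (lam : Fin d → ℝ) (j : Fin d)
    (H : MatSpace d) : ℝ :=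
  √(∑ l ∈ Finset.univ.erase j, (bil H (g j) (g l) / (lam j - lam l)) ^ 2)

/-- Limit of the rescaled error of the `j`th left singular vector in the direction `H`. -/
def limU {d : ℕ} (g : Fin d → EuclideanSpace ℝ (Fin d)) (lam : Fin d → ℝ) (j : Fin d)
    (H : MatSpace d) : ℝ :=
  √((∑ l ∈ Finset.univ.erase j, lam l * (bil H (g j) (g l) / (lam j - lam l)) ^ 2) / lam j)

/-- The sine of the angle between `x` and `y` for the bilinear form of `M`. -/
def sinForm {d : ℕ} (M : MatSpace d) (x y : EuclideanSpace ℝ (Fin d)) : ℝ :=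
  √(1 - (bil M x y) ^ 2 / (bil M x x * bil M y y))

/-- Unit eigenvectors are determined only up to sign. This lemma and the next ones allow one choice
to be exchanged for another in every quantity that occurs. -/
lemma sq_bil_of_sign {d : ℕ} (H : MatSpace d) {x x' y y' : EuclideanSpace ℝ (Fin d)}
    (hx : x' = x ∨ x' = -x) (hy : y' = y ∨ y' = -y) :
    (bil H x' y') ^ 2 = (bil H x y) ^ 2 := by
  have hl : ∀ z w, bil H (-z) w = -bil H z w := fun z w => by simpa using bil_smul_left H z w (-1)
  have hr : ∀ z w, bil H z (-w) = -bil H z w := fun z w => by simpa using bil_smul_right H z w (-1)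
  rcases hx with rfl | rfl <;> rcases hy with rfl | rfl <;> simp [hl, hr]

lemma sq_inner_of_sign {d : ℕ} {x x' y y' : EuclideanSpace ℝ (Fin d)}
    (hx : x' = x ∨ x' = -x) (hy : y' = y ∨ y' = -y) :
    (inner ℝ x' y') ^ 2 = (inner ℝ x y) ^ 2 := by
  rcases hx with rfl | rfl <;> rcases hy with rfl | rfl <;> simp

lemma bil_self_of_sign {d : ℕ} (H : MatSpace d) {x x' : EuclideanSpace ℝ (Fin d)}
    (hx : x' = x ∨ x' = -x) : bil H x' x' = bil H x x := by
  have hl : ∀ z w, bil H (-z) w = -bil H z w := fun z w => by simpa using bil_smul_left H z w (-1)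
  have hr : ∀ z w, bil H z (-w) = -bil H z w := fun z w => by simpa using bil_smul_right H z w (-1)
  rcases hx with rfl | rfl <;> simp [hl, hr]

lemma sinDist_of_sign {d : ℕ} {x x' y y' : EuclideanSpace ℝ (Fin d)}
    (hx : x' = x ∨ x' = -x) (hy : y' = y ∨ y' = -y) : sinDist x' y' = sinDist x y := by
  rw [sinDist, sinDist, sq_inner_of_sign hx hy]

lemma sinForm_of_sign {d : ℕ} (M : MatSpace d) {x x' y y' : EuclideanSpace ℝ (Fin d)}
    (hx : x' = x ∨ x' = -x) (hy : y' = y ∨ y' = -y) : sinForm M x' y' = sinForm M x y := by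
  rw [sinForm, sinForm, sq_bil_of_sign M hx hy, bil_self_of_sign M hx, bil_self_of_sign M hy]

/-! ### Exact identities for eigenvectors of a perturbed matrix -/

section Exact

variable {d : ℕ} {M H : MatSpace d} {s : ℝ} {b b' : Fin d → EuclideanSpace ℝ (Fin d)}
  {μ μ' : Fin d → ℝ}

/-- Pair the perturbed eigenvector equation with an unperturbed eigenvector. The identity has no
remainder term, so the limits below need only continuity and no expansion. -/
lemma SortedEig.sub_mul_inner (h : SortedEig M b μ) (h' : SortedEig (M + s • H) b' μ')
    (j l : Fin d) : (μ' j - μ l) * inner ℝ (b' j) (b l) = s * bil H (b' j) (b l) := by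
  have h1 := h'.eigen' j (b l)
  rw [bil_add, bil_smul, h.eigen] at h1
  linarith

/-- By Parseval, the squared sine is the sum of the squared coefficients of `b' j` off `b j`, and
`sub_mul_inner` gives each of these. -/
lemma SortedEig.sinDist_eq (h : SortedEig M b μ) (h' : SortedEig (M + s • H) b' μ')
    (hs : 0 < s) (j : Fin d) (hne : ∀ l, l ≠ j → μ' j ≠ μ l) :
    sinDist (b' j) (b j) =
      s * √(∑ l ∈ Finset.univ.erase j, (bil H (b' j) (b l) / (μ' j - μ l)) ^ 2) := by
  have h1 := h.sum_inner_sq (b' j)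
  rw [h'.norm_eq_one, ← Finset.add_sum_erase _ _ (Finset.mem_univ j)] at h1
  have h2 : ∑ l ∈ Finset.univ.erase j, (inner ℝ (b' j) (b l)) ^ 2
      = s ^ 2 * ∑ l ∈ Finset.univ.erase j, (bil H (b' j) (b l) / (μ' j - μ l)) ^ 2 := by
    rw [Finset.mul_sum]
    refine Finset.sum_congr rfl fun l hl => ?_
    have h3 : μ' j - μ l ≠ 0 := sub_ne_zero.2 (hne l (Finset.ne_of_mem_erase hl))
    have h4 : inner ℝ (b' j) (b l) = s * bil H (b' j) (b l) / (μ' j - μ l) := by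
      rw [eq_div_iff h3, ← h.sub_mul_inner h' j l, mul_comm]
    rw [h4]; ring
  rw [h2] at h1
  rw [sinDist, show 1 - (inner ℝ (b' j) (b j)) ^ 2 = s ^ 2 *
    ∑ l ∈ Finset.univ.erase j, (bil H (b' j) (b l) / (μ' j - μ l)) ^ 2 by linarith, Real.sqrt_mul (sq_nonneg s), Real.sqrt_sq hs.le]

lemma SortedEig.bil_self_eq_sum (h : SortedEig M b μ) (x : EuclideanSpace ℝ (Fin d)) :
    bil M x x = ∑ l, μ l * (inner ℝ x (b l)) ^ 2 := by
  have hs : ⊤ ≤ Submodule.span ℝ (Set.range b) := by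
    have := h.orthonormal.linearIndependent.span_eq_top_of_card_eq_finrank' (by simp)
    exact this.ge
  have hx := (OrthonormalBasis.mk h.orthonormal hs).sum_repr' x
  simp only [OrthonormalBasis.coe_mk] at hx
  have hlin : ∀ (c : Fin d → ℝ), bil M x (∑ l, c l • b l) = ∑ l, c l * bil M x (b l) := by
    intro c
    simp only [bil, WithLp.ofLp_sum, Finset.sum_apply, PiLp.smul_apply, smul_eq_mul,
      Finset.mul_sum]
    rw [Finset.sum_comm]
    exact Finset.sum_congr rfl fun _ _ => Finset.sum_congr rfl fun _ _ => by ring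
  conv_lhs => rw [← hx]
  rw [hx, show bil M x x = bil M x (∑ i, inner ℝ (b i) x • b i) by rw [hx], hlin]
  refine Finset.sum_congr rfl fun l _ => ?_
  rw [h.eigen, real_inner_comm]; ring

/-- The argument of `sinDist_eq` for the form of `M`: the coefficients now carry the weights `μ l`,
and the normalization is `bil M (b' j) (b' j)` instead of `1`. -/
lemma SortedEig.sinForm_eq (h : SortedEig M b μ) (h' : SortedEig (M + s • H) b' μ')
    (hs : 0 < s) (j : Fin d) (hne : ∀ l, l ≠ j → μ' j ≠ μ l) (hpos : 0 < μ j)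
    (hpos' : 0 < bil M (b' j) (b' j)) :
    sinForm M (b' j) (b j) =
      s * √((∑ l ∈ Finset.univ.erase j, μ l * (bil H (b' j) (b l) / (μ' j - μ l)) ^ 2) /
        bil M (b' j) (b' j)) := by
  have hpos0 := hpos.ne'
  have h1 := h.bil_self_eq_sum (b' j)
  rw [← Finset.add_sum_erase _ _ (Finset.mem_univ j)] at h1
  have h2 : ∑ l ∈ Finset.univ.erase j, μ l * (inner ℝ (b' j) (b l)) ^ 2
      = s ^ 2 * ∑ l ∈ Finset.univ.erase j, μ l * (bil H (b' j) (b l) / (μ' j - μ l)) ^ 2 := by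
    rw [Finset.mul_sum]
    refine Finset.sum_congr rfl fun l hl => ?_
    have h3 : μ' j - μ l ≠ 0 := sub_ne_zero.2 (hne l (Finset.ne_of_mem_erase hl))
    have h4 : inner ℝ (b' j) (b l) = s * bil H (b' j) (b l) / (μ' j - μ l) := by
      rw [eq_div_iff h3, ← h.sub_mul_inner h' j l, mul_comm]
    rw [h4]; ring
  have h5 : 1 - (bil M (b' j) (b j)) ^ 2 / (bil M (b' j) (b' j) * bil M (b j) (b j)) =
      s ^ 2 * ((∑ l ∈ Finset.univ.erase j, μ l * (bil H (b' j) (b l) / (μ' j - μ l)) ^ 2) /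
        bil M (b' j) (b' j)) := by
    rw [h.bil_self, h.eigen, ← mul_div_assoc, ← h2]
    field_simp
    linarith
  rw [sinForm, h5, Real.sqrt_mul (sq_nonneg s), Real.sqrt_sq hs.le]

end Exact

lemma continuous_limSigma {d : ℕ} (g : Fin d → EuclideanSpace ℝ (Fin d)) (lam : Fin d → ℝ)
    (j : Fin d) : Continuous (limSigma g lam j) := by
  unfold limSigma
  exact (continuous_bil_left _ _).abs.div_const _

lemma continuous_limV {d : ℕ} (g : Fin d → EuclideanSpace ℝ (Fin d)) (lam : Fin d → ℝ)
    (j : Fin d) : Continuous (limV g lam j) := by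
  unfold limV
  exact (continuous_finsetSum _ fun l _ => ((continuous_bil_left _ _).div_const _).pow 2).sqrt

lemma continuous_limU {d : ℕ} (g : Fin d → EuclideanSpace ℝ (Fin d)) (lam : Fin d → ℝ)
    (j : Fin d) : Continuous (limU g lam j) := by
  unfold limU
  exact ((continuous_finsetSum _ fun l _ =>
    (((continuous_bil_left _ _).div_const _).pow 2).const_mul _).div_const _).sqrt

lemma SortedEig.tendsto_eigenvalue {d : ℕ} {M : ℕ → MatSpace d} {m : MatSpace d}
    {b : ℕ → Fin d → EuclideanSpace ℝ (Fin d)} {b₀ : Fin d → EuclideanSpace ℝ (Fin d)}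
    {μ : ℕ → Fin d → ℝ} (h : ∀ n, SortedEig (M n) (b n) (μ n))
    (hM : Tendsto M atTop (𝓝 m)) (hb : Tendsto b atTop (𝓝 b₀)) (l : Fin d) :
    Tendsto (fun n => μ n l) atTop (𝓝 (bil m (b₀ l) (b₀ l))) := by
  have hbl : Tendsto (fun n => b n l) atTop (𝓝 (b₀ l)) := (tendsto_pi_nhds.1 hb) l
  exact (tendsto_bil hM hbl hbl).congr fun n => (h n).bil_self l

/-- Every condition in `SortedEig` is closed. The eigenvalues need no separate assumption, being the
values `bil M (b l) (b l)`. -/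
lemma SortedEig.of_tendsto {d : ℕ} {M : ℕ → MatSpace d} {m : MatSpace d}
    {b : ℕ → Fin d → EuclideanSpace ℝ (Fin d)} {b₀ : Fin d → EuclideanSpace ℝ (Fin d)}
    {μ : ℕ → Fin d → ℝ} (h : ∀ n, SortedEig (M n) (b n) (μ n))
    (hM : Tendsto M atTop (𝓝 m)) (hb : Tendsto b atTop (𝓝 b₀)) :
    SortedEig m b₀ (fun l => bil m (b₀ l) (b₀ l)) := by
  have hbl : ∀ l, Tendsto (fun n => b n l) atTop (𝓝 (b₀ l)) := tendsto_pi_nhds.1 hb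
  have hμ := SortedEig.tendsto_eigenvalue h hM hb
  refine ⟨⟨fun l => ?_, fun i l hil => ?_⟩, fun x y => ?_, fun l y => ?_, fun i l hil => ?_⟩
  · exact tendsto_nhds_unique ((hbl l).norm) (tendsto_const_nhds.congr
      fun n => ((h n).norm_eq_one l).symm)
  · exact tendsto_nhds_unique ((hbl i).inner (hbl l)) (tendsto_const_nhds.congr
      fun n => ((h n).orthonormal.2 hil).symm)
  · exact tendsto_nhds_unique (tendsto_bil hM tendsto_const_nhds tendsto_const_nhds)
      ((tendsto_bil hM tendsto_const_nhds tendsto_const_nhds).congr fun n => (h n).symm y x)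
  · exact tendsto_nhds_unique (tendsto_bil hM tendsto_const_nhds (hbl l))
      (((hμ l).mul (tendsto_const_nhds.inner (hbl l))).congr fun n => ((h n).eigen l y).symm)
  · exact le_of_tendsto_of_tendsto' (hμ l) (hμ i) fun n => (h n).anti hil

/-! ### Perturbation limits by compactness -/

section Sequence

variable {d : ℕ} {m : MatSpace d} {g : Fin d → EuclideanSpace ℝ (Fin d)} {lam : Fin d → ℝ}

/-- First order perturbation of simple eigenvalues and eigenvectors along a sequence. -/
lemma tendsto_perturbation (hg : SortedEig m g lam) (hlam : StrictAnti lam)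
    (hpos : ∀ l, 0 < lam l) {M H : ℕ → MatSpace d} {h : MatSpace d} {s : ℕ → ℝ}
    {b b' : ℕ → Fin d → EuclideanSpace ℝ (Fin d)} {b₀ b₀' : Fin d → EuclideanSpace ℝ (Fin d)}
    {μ μ' : ℕ → Fin d → ℝ} {v w : ℕ → EuclideanSpace ℝ (Fin d)}
    (hM : Tendsto M atTop (𝓝 m)) (hH : Tendsto H atTop (𝓝 h)) (hs : Tendsto s atTop (𝓝 0))
    (hs0 : ∀ n, 0 < s n) (hb : Tendsto b atTop (𝓝 b₀)) (hb' : Tendsto b' atTop (𝓝 b₀'))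
    (hS : ∀ n, SortedEig (M n) (b n) (μ n)) (hS' : ∀ n, SortedEig (M n + s n • H n) (b' n) (μ' n))
    (j : Fin d) (hv : ∀ n, ‖v n‖ = 1) (hve : ∀ n y, bil (M n) y (v n) = μ n j * inner ℝ y (v n))
    (hw : ∀ n, ‖w n‖ = 1)
    (hwe : ∀ n y, bil (M n + s n • H n) y (w n) = μ' n j * inner ℝ y (w n)) :
    Tendsto (fun n => sinForm (M n) (w n) (v n) / s n) atTop (𝓝 (limU g lam j h)) ∧
    Tendsto (fun n => |√(μ' n j) - √(μ n j)| / s n) atTop (𝓝 (limSigma g lam j h)) ∧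
    Tendsto (fun n => sinDist (w n) (v n) / s n) atTop (𝓝 (limV g lam j h)) ∧
    Tendsto (fun n => μ n j) atTop (𝓝 (lam j)) := by
  have hM' : Tendsto (fun n => M n + s n • H n) atTop (𝓝 m) := by
    simpa using hM.add (hs.smul hH)
  -- Both limit bases are sorted eigenbases of the same `m`, hence agree with `g` up to signs, and
  -- both families of eigenvalues tend to `lam`.
  obtain ⟨he, hsg⟩ := hg.unique (SortedEig.of_tendsto hS hM hb) hlam
  obtain ⟨he', hsg'⟩ := hg.unique (SortedEig.of_tendsto hS' hM' hb') hlam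
  have hbl : ∀ l, Tendsto (fun n => b n l) atTop (𝓝 (b₀ l)) := tendsto_pi_nhds.1 hb
  have hbl' : ∀ l, Tendsto (fun n => b' n l) atTop (𝓝 (b₀' l)) := tendsto_pi_nhds.1 hb'
  have hμ : ∀ l, Tendsto (fun n => μ n l) atTop (𝓝 (lam l)) := fun l => by
    have := SortedEig.tendsto_eigenvalue hS hM hb l
    rwa [congrFun he l] at this
  have hμ' : ∀ l, Tendsto (fun n => μ' n l) atTop (𝓝 (lam l)) := fun l => by
    have := SortedEig.tendsto_eigenvalue hS' hM' hb' l
    rwa [congrFun he' l] at this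
  have hev : ∀ᶠ n in atTop, ∀ l, l ≠ j → μ n l ≠ μ n j ∧ μ' n l ≠ μ' n j ∧ μ' n j ≠ μ n l := by
    rw [eventually_all]
    intro l
    by_cases hl : l = j
    · simp [hl]
    have hne : lam l - lam j ≠ 0 := sub_ne_zero.2 (fun e => hl (hlam.injective e))
    filter_upwards [((hμ l).sub (hμ j)).eventually_ne hne,
      ((hμ' l).sub (hμ' j)).eventually_ne hne, ((hμ l).sub (hμ' j)).eventually_ne hne]
      with n h1 h2 h3 _
    exact ⟨sub_ne_zero.1 h1, sub_ne_zero.1 h2, (sub_ne_zero.1 h3).symm⟩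
  have hevpos : ∀ᶠ n in atTop, 0 < μ n j ∧ 0 < bil (M n) (b' n j) (b' n j) := by
    have h1 := tendsto_bil hM (hbl' j) (hbl' j)
    rw [congrFun he' j] at h1
    exact ((hμ j).eventually_const_lt (hpos j)).and (h1.eventually_const_lt (hpos j))
  -- The `j`th eigenvalue is eventually simple, so the arbitrary choices `v` and `w` can be replaced
  -- by members of the two eigenbases.
  have hsignv : ∀ᶠ n in atTop, v n = b n j ∨ v n = -b n j := by
    filter_upwards [hev] with n hn
    exact (hS n).eq_or_eq_neg (hv n) (hve n) fun l hl => (hn l hl).1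
  have hsignw : ∀ᶠ n in atTop, w n = b' n j ∨ w n = -b' n j := by
    filter_upwards [hev] with n hn
    exact (hS' n).eq_or_eq_neg (hw n) (hwe n) fun l hl => (hn l hl).2.1
  have hterm : ∀ l ∈ Finset.univ.erase j,
      Tendsto (fun n => (bil (H n) (b' n j) (b n l) / (μ' n j - μ n l)) ^ 2) atTop
        (𝓝 ((bil h (g j) (g l) / (lam j - lam l)) ^ 2)) := by
    intro l hl
    have hne : lam j - lam l ≠ 0 :=
      sub_ne_zero.2 (fun e => Finset.ne_of_mem_erase hl (hlam.injective e).symm)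
    have h1 := ((tendsto_bil hH (hbl' j) (hbl l)).div ((hμ' j).sub (hμ l)) hne).pow 2
    rwa [div_pow, sq_bil_of_sign h (hsg' j) (hsg l), ← div_pow] at h1
  refine ⟨?_, ?_, ?_, hμ j⟩
  · have h1 : Tendsto (fun n => √((∑ l ∈ Finset.univ.erase j,
        μ n l * (bil (H n) (b' n j) (b n l) / (μ' n j - μ n l)) ^ 2) /
          bil (M n) (b' n j) (b' n j))) atTop (𝓝 (limU g lam j h)) := by
      have h2 := tendsto_bil hM (hbl' j) (hbl' j)
      rw [congrFun he' j] at h2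
      exact ((tendsto_finsetSum _ fun l hl => (hμ l).mul (hterm l hl)).div h2 (hpos j).ne').sqrt
    refine h1.congr' ?_
    filter_upwards [hev, hevpos, hsignv, hsignw] with n h2 h3 h4 h5
    rw [sinForm_of_sign (M n) h5 h4, (hS n).sinForm_eq (hS' n) (hs0 n) j
      (fun l hl => (h2 l hl).2.2) h3.1 h3.2, mul_div_cancel_left₀ _ (hs0 n).ne']
  -- `sub_mul_inner` with `l = j` expresses the shift of the eigenvalue through an inner product
  -- that tends to `±1`. Dividing by the sum of the square roots gives the shift of the square root.
  · have hin : Tendsto (fun n => inner ℝ (b' n j) (b n j)) atTop (𝓝 (inner ℝ (b₀' j) (b₀ j))) :=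
      (hbl' j).inner (hbl j)
    have hin2 : (inner ℝ (b₀' j) (b₀ j)) ^ 2 = 1 := by
      rw [sq_inner_of_sign (hsg' j) (hsg j), real_inner_self_eq_norm_sq, hg.norm_eq_one]
      norm_num
    have hin0 : inner ℝ (b₀' j) (b₀ j) ≠ 0 := fun e => by simp [e] at hin2
    have hden : Tendsto (fun n => √(μ' n j) + √(μ n j)) atTop (𝓝 (2 * √(lam j))) := by
      rw [two_mul]
      exact (hμ' j).sqrt.add (hμ j).sqrt
    have hsq : 0 < √(lam j) := Real.sqrt_pos.2 (hpos j)
    have h1 : Tendsto (fun n => |bil (H n) (b' n j) (b n j) / inner ℝ (b' n j) (b n j)| /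
        (√(μ' n j) + √(μ n j))) atTop (𝓝 (limSigma g lam j h)) := by
      have h2 := (((tendsto_bil hH (hbl' j) (hbl j)).div hin hin0).abs).div hden (by positivity)
      have h3 : |bil h (b₀' j) (b₀ j) / inner ℝ (b₀' j) (b₀ j)| = |bil h (g j) (g j)| := by
        rw [← sq_eq_sq₀ (abs_nonneg _) (abs_nonneg _), sq_abs, sq_abs, div_pow, hin2, div_one,
          sq_bil_of_sign h (hsg' j) (hsg j)]
      rwa [h3] at h2
    refine h1.congr' ?_
    filter_upwards [(hμ j).eventually_const_lt (hpos j), (hμ' j).eventually_const_lt (hpos j),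
      hin.eventually_ne hin0] with n h2 h3 h4
    have h5 := (hS n).sub_mul_inner (hS' n) j j
    have h6 : bil (H n) (b' n j) (b n j) / inner ℝ (b' n j) (b n j) = (μ' n j - μ n j) / s n := by
      rw [div_eq_div_iff h4 (hs0 n).ne']
      linarith
    have h7 : 0 < √(μ' n j) + √(μ n j) :=
      add_pos (Real.sqrt_pos.2 h3) (Real.sqrt_pos.2 h2)
    have h8 : μ' n j - μ n j = (√(μ' n j) - √(μ n j)) * (√(μ' n j) + √(μ n j)) := by
      nlinarith [Real.sq_sqrt h2.le, Real.sq_sqrt h3.le]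
    rw [h6, h8, abs_div, abs_mul, abs_of_pos h7, abs_of_pos (hs0 n)]
    field_simp
  · have h1 : Tendsto (fun n => √(∑ l ∈ Finset.univ.erase j,
        (bil (H n) (b' n j) (b n l) / (μ' n j - μ n l)) ^ 2)) atTop (𝓝 (limV g lam j h)) :=
      (tendsto_finsetSum _ hterm).sqrt
    refine h1.congr' ?_
    filter_upwards [hev, hsignv, hsignw] with n h2 h4 h5
    rw [sinDist_of_sign h5 h4, (hS n).sinDist_eq (hS' n) (hs0 n) j (fun l hl => (h2 l hl).2.2),
      mul_div_cancel_left₀ _ (hs0 n).ne']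

/-- Compactness turns sequential limits into a uniform estimate. Counterexamples for `δ = 1 / (n +
1)` have bases and directions in compact sets; along a convergent subsequence they contradict
`tendsto_perturbation`. -/
lemma exists_perturbation_radius_aux (hg : SortedEig m g lam) (hlam : StrictAnti lam)
    (hpos : ∀ l, 0 < lam l) (R : ℝ) {ε : ℝ} (hε : 0 < ε) (j : Fin d) :
    ∃ δ > 0, ∀ (M H : MatSpace d) (s : ℝ) (b b' : Fin d → EuclideanSpace ℝ (Fin d))
      (μ μ' : Fin d → ℝ) (v w : EuclideanSpace ℝ (Fin d)),
      ‖M - m‖ ≤ δ → ‖H‖ ≤ R → 0 < s → s ≤ δ → SortedEig M b μ → SortedEig (M + s • H) b' μ' →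
      ‖v‖ = 1 → (∀ y, bil M y v = μ j * inner ℝ y v) →
      ‖w‖ = 1 → (∀ y, bil (M + s • H) y w = μ' j * inner ℝ y w) →
      |sinForm M w v / s - limU g lam j H| ≤ ε ∧
      |(|√(μ' j) - √(μ j)| / s - limSigma g lam j H)| ≤ ε ∧
      |sinDist w v / s - limV g lam j H| ≤ ε ∧ 0 < μ j := by
  by_contra hcon
  have hcon' : ∀ n : ℕ, ∃ (M H : MatSpace d) (s : ℝ) (b b' : Fin d → EuclideanSpace ℝ (Fin d))
      (μ μ' : Fin d → ℝ) (v w : EuclideanSpace ℝ (Fin d)),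
      ‖M - m‖ ≤ 1 / ((n : ℝ) + 1) ∧ ‖H‖ ≤ R ∧ 0 < s ∧ s ≤ 1 / ((n : ℝ) + 1) ∧ SortedEig M b μ ∧
      SortedEig (M + s • H) b' μ' ∧ ‖v‖ = 1 ∧ (∀ y, bil M y v = μ j * inner ℝ y v) ∧
      ‖w‖ = 1 ∧ (∀ y, bil (M + s • H) y w = μ' j * inner ℝ y w) ∧
      ¬ (|sinForm M w v / s - limU g lam j H| ≤ ε ∧
      |(|√(μ' j) - √(μ j)| / s - limSigma g lam j H)| ≤ ε ∧
      |sinDist w v / s - limV g lam j H| ≤ ε ∧ 0 < μ j) := by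
    intro n
    by_contra hn
    refine hcon ⟨1 / ((n : ℝ) + 1), by positivity, ?_⟩
    intro M H s b b' μ μ' v w h1 h2 h3 h4 h5 h6 h7 h8 h9 h10
    by_contra h11
    exact hn ⟨M, H, s, b, b', μ, μ', v, w, h1, h2, h3, h4, h5, h6, h7, h8, h9, h10, h11⟩
  choose M H s b b' μ μ' v w hM hH hs0 hs hS hS' hv hve hw hwe hbad using hcon'
  have hbd : ∀ {N : MatSpace d} {c : Fin d → EuclideanSpace ℝ (Fin d)} {ν : Fin d → ℝ},
      SortedEig N c ν → c ∈ Metric.closedBall 0 1 := by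
    intro N c ν h
    rw [mem_closedBall_zero_iff, pi_norm_le_iff_of_nonneg zero_le_one]
    exact fun l => (h.norm_eq_one l).le
  have hK : IsCompact (Metric.closedBall (0 : Fin d → EuclideanSpace ℝ (Fin d)) 1 ×ˢ
      (Metric.closedBall (0 : Fin d → EuclideanSpace ℝ (Fin d)) 1 ×ˢ
        Metric.closedBall (0 : MatSpace d) R)) :=
    (isCompact_closedBall _ _).prod ((isCompact_closedBall _ _).prod (isCompact_closedBall _ _))
  obtain ⟨⟨b₀, b₀', h₀⟩, -, φ, hφ, hlim⟩ := hK.tendsto_subseq (x := fun n => (b n, b' n, H n))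
    (fun n => ⟨hbd (hS n), hbd (hS' n), mem_closedBall_zero_iff.2 (hH n)⟩)
  have hlim1 : Tendsto (b ∘ φ) atTop (𝓝 b₀) := (continuous_fst.tendsto _).comp hlim
  have hlim2 : Tendsto (b' ∘ φ) atTop (𝓝 b₀') :=
    ((continuous_fst.comp continuous_snd).tendsto (b₀, b₀', h₀)).comp hlim
  have hlim3 : Tendsto (H ∘ φ) atTop (𝓝 h₀) :=
    ((continuous_snd.comp continuous_snd).tendsto (b₀, b₀', h₀)).comp hlim
  have hone := tendsto_one_div_add_atTop_nhds_zero_nat (𝕜 := ℝ)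
  have hMt : Tendsto M atTop (𝓝 m) :=
    tendsto_iff_norm_sub_tendsto_zero.2 (squeeze_zero (fun _ => norm_nonneg _) hM hone)
  have hst : Tendsto s atTop (𝓝 0) := squeeze_zero (fun n => (hs0 n).le) hs hone
  obtain ⟨hU, hSi, hV, hμ⟩ := tendsto_perturbation hg hlam hpos (hMt.comp hφ.tendsto_atTop) hlim3
    (hst.comp hφ.tendsto_atTop) (fun n => hs0 (φ n)) hlim1 hlim2 (fun n => hS (φ n))
    (fun n => hS' (φ n)) j (fun n => hv (φ n)) (fun n => hve (φ n)) (fun n => hw (φ n))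
    (fun n => hwe (φ n))
  -- The estimate compares with `L` at the moving direction `H (φ n)`, not at its limit `h₀`;
  -- continuity of `L` accounts for the difference.
  have key : ∀ {f : ℕ → ℝ} {L : MatSpace d → ℝ}, Continuous L →
      Tendsto f atTop (𝓝 (L h₀)) → ∀ᶠ n in atTop, |f n - L (H (φ n))| ≤ ε := by
    intro f L hL hf
    have h1 := (hf.sub ((hL.tendsto h₀).comp hlim3)).abs
    rw [sub_self, abs_zero] at h1
    exact (h1.eventually_lt_const hε).mono fun n hn => hn.le
  obtain ⟨n, h1, h2, h3, h4⟩ := ((key (continuous_limU g lam j) hU).and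
    ((key (continuous_limSigma g lam j) hSi).and ((key (continuous_limV g lam j) hV).and
      (hμ.eventually_const_lt (hpos j))))).exists
  exact hbad (φ n) ⟨h1, h2, h3, h4⟩

/-- First order perturbation of simple eigenvalues and eigenvectors, uniformly over bounded
directions and over base points near `m`. -/
lemma exists_perturbation_radius (hg : SortedEig m g lam) (hlam : StrictAnti lam)
    (hpos : ∀ l, 0 < lam l) (R : ℝ) {ε : ℝ} (hε : 0 < ε) :
    ∃ δ > 0, ∀ (M H : MatSpace d) (s : ℝ) (b b' : Fin d → EuclideanSpace ℝ (Fin d))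
      (μ μ' : Fin d → ℝ), ‖M - m‖ ≤ δ → ‖H‖ ≤ R → 0 < s → s ≤ δ → SortedEig M b μ →
      SortedEig (M + s • H) b' μ' → ∀ (j : Fin d) (v w : EuclideanSpace ℝ (Fin d)),
      ‖v‖ = 1 → (∀ y, bil M y v = μ j * inner ℝ y v) →
      ‖w‖ = 1 → (∀ y, bil (M + s • H) y w = μ' j * inner ℝ y w) →
      |sinForm M w v / s - limU g lam j H| ≤ ε ∧
      |(|√(μ' j) - √(μ j)| / s - limSigma g lam j H)| ≤ ε ∧
      |sinDist w v / s - limV g lam j H| ≤ ε ∧ 0 < μ j := by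
  choose δ hδ hP using exists_perturbation_radius_aux hg hlam hpos R hε
  have hev : ∀ᶠ r in 𝓝[>] (0 : ℝ), ∀ j, r ≤ δ j :=
    eventually_all.2 fun j => (eventually_le_nhds (hδ j)).filter_mono nhdsWithin_le_nhds
  obtain ⟨r, hr, hr0⟩ := (hev.and self_mem_nhdsWithin).exists
  refine ⟨r, hr0, fun M H s b b' μ μ' h1 h2 h3 h4 h5 h6 j v w h7 h8 h9 h10 => ?_⟩
  exact hP j M H s b b' μ μ' v w (h1.trans (hr j)) h2 h3 (h4.trans (hr j)) h5 h6 h7 h8 h9 h10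

end Sequence

/-! ### A central limit theorem for triangular arrays -/

/-- A second order Taylor bound valid for all real `x`. For `|x| > 1` each term is at most a
multiple of `|x| ^ 3`, with total `7/2`, whence the constant `4`. -/
lemma norm_cexp_mul_I_sub_le (x : ℝ) :
    ‖Complex.exp (x * Complex.I) - (1 + x * Complex.I - x ^ 2 / 2)‖ ≤ 4 * |x| ^ 3 := by
  have hn : ‖(x : ℂ) * Complex.I‖ = |x| := by simp
  by_cases hx : |x| ≤ 1
  · have h := Complex.exp_bound (x := x * Complex.I) (by rwa [hn]) (n := 3) (by norm_num)
    rw [hn] at h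
    have h2 : ∑ m ∈ Finset.range 3, ((x : ℂ) * Complex.I) ^ m / (m.factorial : ℂ) =
        1 + x * Complex.I - x ^ 2 / 2 := by
      simp only [Finset.sum_range_succ, Finset.sum_range_zero, mul_pow, Complex.I_sq]
      norm_num [Nat.factorial]
      ring
    rw [h2] at h
    refine h.trans ?_
    rw [mul_comm]
    gcongr
    norm_num [Nat.factorial]
  · push Not at hx
    have h1 : ‖Complex.exp (x * Complex.I)‖ = 1 := Complex.norm_exp_ofReal_mul_I x
    have h2 : ‖(1 + x * Complex.I - x ^ 2 / 2 : ℂ)‖ ≤ 1 + |x| + |x| ^ 2 / 2 := by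
      refine (norm_sub_le _ _).trans (add_le_add ((norm_add_le _ _).trans ?_) ?_)
      · rw [hn]; simp
      · simp
    refine (norm_sub_le _ _).trans ?_
    rw [h1]
    have h3 : |x| ≤ |x| ^ 2 := by nlinarith
    have h4 : |x| ^ 2 ≤ |x| ^ 3 := by nlinarith [sq_nonneg |x|]
    nlinarith

/-- Integrate the Taylor bound; the linear term drops out since `ξ` is centered. -/
lemma norm_integral_cexp_sub_le {Ω : Type*} [MeasurableSpace Ω] {ν : Measure Ω}
    [IsProbabilityMeasure ν] {ξ : Ω → ℝ} (hξ : MemLp ξ 3 ν) (h0 : ∫ ω, ξ ω ∂ν = 0) (c : ℝ) :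
    ‖∫ ω, Complex.exp ((c * ξ ω : ℝ) * Complex.I) ∂ν -
      (1 - (c ^ 2 * ∫ ω, ξ ω ^ 2 ∂ν : ℝ) / 2)‖ ≤ 4 * |c| ^ 3 * ∫ ω, |ξ ω| ^ 3 ∂ν := by
  have h1 : Integrable ξ ν := hξ.integrable (by norm_num)
  have h2 : Integrable (fun ω => ξ ω ^ 2) ν := (hξ.mono_exponent (by norm_num)).integrable_sq
  have h3 : Integrable (fun ω => |ξ ω| ^ 3) ν := by
    simpa using hξ.integrable_norm_pow (by norm_num)
  have hm : AEMeasurable ξ ν := h1.aemeasurable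
  have hexp : Integrable (fun ω => Complex.exp ((c * ξ ω : ℝ) * Complex.I)) ν := by
    refine (integrable_const (1 : ℝ)).mono' ?_ (ae_of_all _ fun ω => ?_)
    · exact (Complex.measurable_exp.comp_aemeasurable
        ((Complex.measurable_ofReal.comp_aemeasurable (hm.const_mul c)).mul_const _)
          ).aestronglyMeasurable
    · rw [Complex.norm_exp_ofReal_mul_I]
  have i1 : Integrable (fun ω => (((c * ξ ω : ℝ) : ℂ)) * Complex.I) ν :=
    (h1.const_mul c).ofReal.mul_const _
  have i2 : Integrable (fun ω => ((((c * ξ ω) ^ 2 : ℝ) : ℂ)) / 2) ν := by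
    have h4 : Integrable (fun ω => (c * ξ ω) ^ 2) ν := by
      simp_rw [mul_pow]
      exact h2.const_mul (c ^ 2)
    exact h4.ofReal.div_const _
  have i3 : Integrable (fun ω => 1 + (((c * ξ ω : ℝ) : ℂ)) * Complex.I) ν :=
    (integrable_const _).add i1
  have i4 : Integrable (fun ω => 1 + (((c * ξ ω : ℝ) : ℂ)) * Complex.I -
      ((((c * ξ ω) ^ 2 : ℝ) : ℂ)) / 2) ν := i3.sub i2
  have hpoly : ∫ ω, (1 + ((c * ξ ω : ℝ) : ℂ) * Complex.I - (((c * ξ ω) ^ 2 : ℝ) : ℂ) / 2) ∂ν =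
      1 - (c ^ 2 * ∫ ω, ξ ω ^ 2 ∂ν : ℝ) / 2 := by
    rw [integral_sub i3 i2, integral_add (integrable_const _) i1,
      integral_mul_const, integral_complex_ofReal, integral_const_mul, h0, integral_div,
      integral_complex_ofReal]
    simp [mul_pow, integral_const_mul]
  rw [← hpoly, ← integral_sub hexp i4, ← integral_const_mul]
  refine norm_integral_le_of_norm_le (h3.const_mul _) (ae_of_all _ fun ω => ?_)
  have := norm_cexp_mul_I_sub_le (c * ξ ω)
  rw [abs_mul, mul_pow, ← mul_assoc] at this
  push_cast at this ⊢
  exact this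

/-- Since `g → 0`, `t (log (1 + g) - g)` is of order `t |g| ^ 2`, that is, bounded times `o(1)`. -/
lemma tendsto_one_add_pow_exp {t : ℕ → ℕ} (ht : Tendsto t atTop atTop) {g : ℕ → ℂ} {c : ℂ}
    (hg : Tendsto (fun n => (t n : ℂ) * g n) atTop (𝓝 c)) :
    Tendsto (fun n => (1 + g n) ^ t n) atTop (𝓝 (Complex.exp c)) := by
  have htc : Tendsto (fun n => ((t n : ℂ))⁻¹) atTop (𝓝 0) := by
    have := (tendsto_inv_atTop_zero.comp
      (tendsto_natCast_atTop_atTop (R := ℝ))).comp ht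
    have h2 := (Complex.continuous_ofReal.tendsto 0).comp this
    simpa [Function.comp_def] using h2
  have hev : ∀ᶠ n in atTop, t n ≠ 0 := ht.eventually_ne_atTop 0
  have hg0 : Tendsto g atTop (𝓝 0) := by
    have h1 := htc.mul hg
    rw [zero_mul] at h1
    refine h1.congr' ?_
    filter_upwards [hev] with n hn
    rw [inv_mul_cancel_left₀ (Nat.cast_ne_zero.2 hn)]
  have hlt : ∀ᶠ n in atTop, ‖g n‖ < 1 / 2 := by
    have := hg0.norm
    rw [norm_zero] at this
    exact this.eventually_lt_const (by norm_num)
  have herr : Tendsto (fun n => (t n : ℂ) * (Complex.log (1 + g n) - g n)) atTop (𝓝 0) := by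
    rw [tendsto_zero_iff_norm_tendsto_zero]
    have hb : Tendsto (fun n => ‖(t n : ℂ) * g n‖ * ‖g n‖) atTop (𝓝 0) := by
      simpa using hg.norm.mul hg0.norm
    refine squeeze_zero' (Eventually.of_forall fun _ => norm_nonneg _) ?_ hb
    filter_upwards [hlt] with n hn
    rw [norm_mul, norm_mul, mul_assoc]
    gcongr
    refine (Complex.norm_log_one_add_sub_self_le (hn.trans (by norm_num))).trans ?_
    have h1 : (1 - ‖g n‖)⁻¹ ≤ 2 := by
      rw [inv_le_comm₀ (by linarith) (by norm_num)]
      linarith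
    nlinarith [sq_nonneg ‖g n‖]
  have hlog : Tendsto (fun n => (t n : ℂ) * Complex.log (1 + g n)) atTop (𝓝 c) := by
    have := herr.add hg
    rw [zero_add] at this
    refine this.congr fun n => by ring
  refine ((Complex.continuous_exp.tendsto c).comp hlog).congr' ?_
  filter_upwards [hlt] with n hn
  have hne : 1 + g n ≠ 0 := by
    intro h
    have : g n = -1 := by linear_combination h
    rw [this] at hn
    norm_num at hn
  simp only [Function.comp_apply]
  rw [Complex.exp_nat_mul, Complex.exp_log hne]

section CLT

variable {ι : Type*} [Fintype ι]

/-- The vector of the means of the coordinates. -/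
def meanVec (μ : Measure (EuclideanSpace ℝ ι)) : EuclideanSpace ℝ ι :=
  WithLp.toLp 2 fun a => ∫ y, y a ∂μ

/-- The sum of the `x i - m` divided by the square root of their number. -/
def normSum (t : ℕ) (m : EuclideanSpace ℝ ι) (x : Fin t → EuclideanSpace ℝ ι) :
    EuclideanSpace ℝ ι :=
  (√(t : ℝ))⁻¹ • ∑ i, (x i - m)

lemma measurable_normSum (t : ℕ) (m : EuclideanSpace ℝ ι) : Measurable (normSum t m) := by
  unfold normSum
  fun_prop

lemma memLp_coord {μ : Measure (EuclideanSpace ℝ ι)} {q : ENNReal}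
    (h : MemLp (fun y : EuclideanSpace ℝ ι => y) q μ) (a : ι) :
    MemLp (fun y : EuclideanSpace ℝ ι => y a) q μ :=
  h.of_le (by fun_prop) (ae_of_all _ fun y => PiLp.norm_apply_le y a)

variable {μ : Measure (EuclideanSpace ℝ ι)} [IsProbabilityMeasure μ]

lemma charFun_map_normSum (t : ℕ) (m x : EuclideanSpace ℝ ι) :
    charFun ((Measure.pi fun _ : Fin t => μ).map (normSum t m)) x =
      (∫ y, Complex.exp (((√(t : ℝ))⁻¹ * inner ℝ (y - m) x : ℝ) * Complex.I) ∂μ) ^ t := by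
  have hf : AEStronglyMeasurable (fun y => Complex.exp ((inner ℝ y x : ℝ) * Complex.I))
      ((Measure.pi fun _ : Fin t => μ).map (normSum t m)) := by
    apply Continuous.aestronglyMeasurable
    fun_prop
  rw [charFun_apply, integral_map (measurable_normSum t m).aemeasurable hf]
  have h1 := integral_fintype_prod_eq_pow (ι := Fin t) (μ := μ)
    (fun y => Complex.exp (((√(t : ℝ))⁻¹ * inner ℝ (y - m) x : ℝ) * Complex.I))
  rw [Fintype.card_fin] at h1
  rw [← h1]
  congr 1
  funext z
  rw [← Complex.exp_sum, normSum, inner_smul_left, sum_inner, ← Finset.sum_mul]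
  congr 2
  simp [Finset.mul_sum]

lemma integral_inner_eq (h : MemLp (fun y : EuclideanSpace ℝ ι => y) 3 μ)
    (x : EuclideanSpace ℝ ι) :
    ∫ y, inner ℝ y x ∂μ = inner ℝ (meanVec μ) x := by
  simp only [PiLp.inner_apply, meanVec, RCLike.inner_apply, conj_trivial]
  rw [integral_finsetSum]
  · simp_rw [integral_const_mul]
  · exact fun a _ => ((memLp_coord h a).integrable (by norm_num)).const_mul _

lemma integral_inner_sub_sq (h : MemLp (fun y : EuclideanSpace ℝ ι => y) 3 μ)
    (x : EuclideanSpace ℝ ι) :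
    ∫ y, (inner ℝ (y - meanVec μ) x) ^ 2 ∂μ =
      ∑ a, ∑ b, x a * x b * (∫ y, y a * y b ∂μ - (∫ y, y a ∂μ) * ∫ y, y b ∂μ) := by
  have hi : MemLp (fun y => inner ℝ y x) 3 μ := h.inner_const x
  have hi1 : Integrable (fun y => inner ℝ y x) μ := hi.integrable (by norm_num)
  have hi2 : Integrable (fun y => (inner ℝ y x) ^ 2) μ :=
    (hi.mono_exponent (by norm_num)).integrable_sq
  have h1 : ∫ y, (inner ℝ (y - meanVec μ) x) ^ 2 ∂μ =
      ∫ y, (inner ℝ y x) ^ 2 ∂μ - (inner ℝ (meanVec μ) x) ^ 2 := by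
    have : ∀ y, (inner ℝ (y - meanVec μ) x) ^ 2 = (inner ℝ y x) ^ 2 -
        2 * inner ℝ (meanVec μ) x * inner ℝ y x + (inner ℝ (meanVec μ) x) ^ 2 := by
      intro y; rw [inner_sub_left]; ring
    simp_rw [this]
    have hi3 : Integrable (fun y => (inner ℝ y x) ^ 2 -
      2 * inner ℝ (meanVec μ) x * inner ℝ y x) μ := hi2.sub (hi1.const_mul _)
    rw [integral_add hi3 (integrable_const _),
      integral_sub hi2 (hi1.const_mul _), integral_const_mul, integral_inner_eq h]
    simp; ring
  have hab : ∀ a b, Integrable (fun y : EuclideanSpace ℝ ι => y a * y b) μ := fun a b =>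
    ((memLp_coord h a).mono_exponent (by norm_num : (2 : ENNReal) ≤ 3)).integrable_mul
      ((memLp_coord h b).mono_exponent (by norm_num : (2 : ENNReal) ≤ 3))
  have h2 : ∫ y, (inner ℝ y x) ^ 2 ∂μ = ∑ a, ∑ b, x a * x b * ∫ y, y a * y b ∂μ := by
    have : ∀ y : EuclideanSpace ℝ ι, (inner ℝ y x) ^ 2 = ∑ a, ∑ b, x a * x b * (y a * y b) := by
      intro y
      simp only [PiLp.inner_apply, RCLike.inner_apply, conj_trivial]
      rw [sq, Finset.sum_mul_sum]
      exact Finset.sum_congr rfl fun _ _ => Finset.sum_congr rfl fun _ _ => by ring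
    simp_rw [this]
    rw [integral_finsetSum _ fun a _ => integrable_finsetSum _ fun b _ => (hab a b).const_mul _]
    refine Finset.sum_congr rfl fun a _ => ?_
    rw [integral_finsetSum _ fun b _ => (hab a b).const_mul _]
    simp_rw [integral_const_mul]
  have h3 : (inner ℝ (meanVec μ) x) ^ 2 =
      ∑ a, ∑ b, x a * x b * ((∫ y, y a ∂μ) * ∫ y, y b ∂μ) := by
    simp only [PiLp.inner_apply, meanVec, RCLike.inner_apply, conj_trivial]
    rw [sq, Finset.sum_mul_sum]
    exact Finset.sum_congr rfl fun _ _ => Finset.sum_congr rfl fun _ _ => by ring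
  rw [h1, h2, h3, ← Finset.sum_sub_distrib]
  refine Finset.sum_congr rfl fun a _ => ?_
  rw [← Finset.sum_sub_distrib]
  exact Finset.sum_congr rfl fun b _ => by ring

lemma integral_abs_inner_sub_cube_le (h : MemLp (fun y : EuclideanSpace ℝ ι => y) 3 μ)
    (m x : EuclideanSpace ℝ ι) :
    ∫ y, |inner ℝ (y - m) x| ^ 3 ∂μ ≤ 4 * ‖x‖ ^ 3 * (∫ y, ‖y‖ ^ 3 ∂μ + ‖m‖ ^ 3) := by
  have h3 : Integrable (fun y : EuclideanSpace ℝ ι => ‖y‖ ^ 3) μ :=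
    h.integrable_norm_pow (by norm_num)
  have hr : 4 * ‖x‖ ^ 3 * (∫ y, ‖y‖ ^ 3 ∂μ + ‖m‖ ^ 3) =
      ∫ y, 4 * ‖x‖ ^ 3 * (‖y‖ ^ 3 + ‖m‖ ^ 3) ∂μ := by
    rw [integral_const_mul, integral_add h3 (integrable_const _)]
    simp
  rw [hr]
  refine integral_mono_of_nonneg (ae_of_all _ fun y => by positivity)
    ((h3.add (integrable_const _)).const_mul _) (ae_of_all _ fun y => ?_)
  have h1 : |inner ℝ (y - m) x| ≤ (‖y‖ + ‖m‖) * ‖x‖ :=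
    (abs_real_inner_le_norm _ _).trans (by gcongr; exact norm_sub_le _ _)
  calc |inner ℝ (y - m) x| ^ 3 ≤ ((‖y‖ + ‖m‖) * ‖x‖) ^ 3 := by gcongr
    _ = (‖y‖ + ‖m‖) ^ 3 * ‖x‖ ^ 3 := by ring
    _ ≤ (4 * (‖y‖ ^ 3 + ‖m‖ ^ 3)) * ‖x‖ ^ 3 := by
        gcongr
        -- With `a = ‖y‖` and `b = ‖m‖`, the difference of the two sides is `3 (a + b) (a - b) ^ 2`.
        nlinarith [mul_nonneg (add_nonneg (norm_nonneg y) (norm_nonneg m))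
          (sq_nonneg (‖y‖ - ‖m‖))]
    _ = _ := by ring

/-- Lyapunov's argument for triangular arrays: the law `μ n` may vary with `n`, and third moments of
order `o(√t)` make the Taylor remainder negligible. -/
lemma tendsto_charFun_normSum {t : ℕ → ℕ} (ht : Tendsto t atTop atTop)
    {μ : ℕ → Measure (EuclideanSpace ℝ ι)} [∀ n, IsProbabilityMeasure (μ n)]
    (hμ : ∀ n, MemLp (fun y : EuclideanSpace ℝ ι => y) 3 (μ n)) {m : ι → ℝ} {Q : ι → ι → ℝ}
    (h1 : ∀ a, Tendsto (fun n => ∫ y, y a ∂(μ n)) atTop (𝓝 (m a)))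
    (h2 : ∀ a b, Tendsto (fun n => ∫ y, y a * y b ∂(μ n)) atTop (𝓝 (Q a b)))
    (h3 : Tendsto (fun n => (∫ y, ‖y‖ ^ 3 ∂(μ n)) / √(t n)) atTop (𝓝 0))
    (x : EuclideanSpace ℝ ι) :
    Tendsto (fun n => charFun ((Measure.pi fun _ : Fin (t n) => μ n).map
      (normSum (t n) (meanVec (μ n)))) x) atTop
      (𝓝 (Complex.exp (-(x ⬝ᵥ (Matrix.of fun a b => Q a b - m a * m b) *ᵥ x) / 2))) := by
  simp_rw [charFun_map_normSum]
  set f : ℕ → ℂ := fun n => ∫ y, Complex.exp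
    (((√(t n : ℝ))⁻¹ * inner ℝ (y - meanVec (μ n)) x : ℝ) * Complex.I) ∂(μ n) with hf
  have hfg : (fun n => f n ^ t n) = fun n => (1 + (f n - 1)) ^ t n := by
    funext n; congr 1; ring
  change Tendsto (fun n => f n ^ t n) _ _
  rw [hfg]
  apply tendsto_one_add_pow_exp ht
  set V : ℕ → ℝ := fun n => ∫ y, (inner ℝ (y - meanVec (μ n)) x) ^ 2 ∂(μ n) with hV
  have hVlim : Tendsto V atTop (𝓝 (x ⬝ᵥ (Matrix.of fun a b => Q a b - m a * m b) *ᵥ x)) := by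
    have : (x ⬝ᵥ (Matrix.of fun a b => Q a b - m a * m b) *ᵥ x) =
        ∑ a, ∑ b, x a * x b * (Q a b - m a * m b) := by
      simp only [dotProduct, Matrix.mulVec, Finset.mul_sum, Matrix.of_apply]
      exact Finset.sum_congr rfl fun _ _ => Finset.sum_congr rfl fun _ _ => by ring
    rw [this]
    simp only [hV, fun n => integral_inner_sub_sq (hμ n) x]
    exact tendsto_finsetSum _ fun a _ => tendsto_finsetSum _ fun b _ =>
      ((h2 a b).sub ((h1 a).mul (h1 b))).const_mul _
  have hmean : Tendsto (fun n => meanVec (μ n)) atTop (𝓝 (WithLp.toLp 2 m)) :=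
    ((PiLp.continuous_toLp 2 _).tendsto m).comp (tendsto_pi_nhds.2 h1)
  have hsq : Tendsto (fun n => √(t n : ℝ)) atTop atTop :=
    Real.tendsto_sqrt_atTop.comp (tendsto_natCast_atTop_atTop.comp ht)
  have hbound : Tendsto (fun n => 16 * ‖x‖ ^ 3 * ((∫ y, ‖y‖ ^ 3 ∂(μ n)) / √(t n) +
      ‖meanVec (μ n)‖ ^ 3 / √(t n))) atTop (𝓝 0) := by
    have h4 := ((hmean.norm.pow 3).div_atTop hsq)
    simpa using (h3.add h4).const_mul (16 * ‖x‖ ^ 3)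
  -- The argument of the exponential carries the factor `1 / √t`, so the quadratic term contributes
  -- exactly `-V / 2` and the cubic remainder `t * t ^ (-3/2)` times a third absolute moment.
  have herr : Tendsto (fun n => (t n : ℂ) * (f n - 1) + (V n : ℂ) / 2) atTop (𝓝 0) := by
    rw [tendsto_zero_iff_norm_tendsto_zero]
    refine squeeze_zero' (Eventually.of_forall fun _ => norm_nonneg _) ?_ hbound
    filter_upwards [ht.eventually_gt_atTop 0] with n hn
    have hpos : (0 : ℝ) < t n := Nat.cast_pos.2 hn
    have hs : 0 < √(t n : ℝ) := Real.sqrt_pos.2 hpos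
    have hss : √(t n : ℝ) ^ 2 = t n := Real.sq_sqrt hpos.le
    have hξ : MemLp (fun y => inner ℝ (y - meanVec (μ n)) x) 3 (μ n) :=
      MemLp.inner_const ((hμ n).sub (memLp_const (meanVec (μ n)))) x
    have h0 : ∫ y, inner ℝ (y - meanVec (μ n)) x ∂(μ n) = 0 := by
      simp_rw [inner_sub_left]
      rw [integral_sub (((hμ n).inner_const x).integrable (by norm_num)) (integrable_const _),
        integral_inner_eq (hμ n)]
      simp
    have key := norm_integral_cexp_sub_le hξ h0 (√(t n : ℝ))⁻¹
    have key2 := integral_abs_inner_sub_cube_le (hμ n) (meanVec (μ n)) x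
    have e1 : (t n : ℂ) * (f n - 1) + (V n : ℂ) / 2 =
        (t n : ℂ) * (f n - (1 - (((√(t n : ℝ))⁻¹ ^ 2 * V n : ℝ) : ℂ) / 2)) := by
      have : (((√(t n : ℝ))⁻¹ ^ 2 : ℝ) : ℂ) * (t n : ℂ) = 1 := by
        rw [inv_pow, hss]
        push_cast
        exact inv_mul_cancel₀ (Nat.cast_ne_zero.2 hn.ne')
      push_cast at this ⊢
      linear_combination (V n : ℂ) / 2 * (-this)
    rw [e1, norm_mul, Complex.norm_natCast]
    calc (t n : ℝ) * ‖f n - (1 - (((√(t n : ℝ))⁻¹ ^ 2 * V n : ℝ) : ℂ) / 2)‖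
        ≤ t n * (4 * |(√(t n : ℝ))⁻¹| ^ 3 *
          (4 * ‖x‖ ^ 3 * (∫ y, ‖y‖ ^ 3 ∂(μ n) + ‖meanVec (μ n)‖ ^ 3))) := by
          gcongr
          exact key.trans (by gcongr)
      _ = _ := by
          rw [abs_of_pos (inv_pos.2 hs)]
          have : (t n : ℝ) * (√(t n : ℝ))⁻¹ ^ 3 = (√(t n : ℝ))⁻¹ := by
            conv_lhs => rw [← hss, Real.sqrt_sq hs.le]
            field_simp
          calc _ = (t n : ℝ) * (√(t n : ℝ))⁻¹ ^ 3 * (16 * ‖x‖ ^ 3 *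
                (∫ y, ‖y‖ ^ 3 ∂(μ n) + ‖meanVec (μ n)‖ ^ 3)) := by ring
            _ = _ := by rw [this]; ring
  have := herr.sub ((Complex.continuous_ofReal.tendsto _).comp hVlim |>.div_const 2)
  refine (this.congr fun n => ?_).trans (by rw [zero_sub, neg_div])
  simp

variable [DecidableEq ι]

/-- The central limit theorem as an upper bound for the probabilities of a closed set, uniformly
over the laws with approximately given first and second moments and a small third moment. -/
lemma exists_clt_radius {m : ι → ℝ} {Q : ι → ι → ℝ}
    (hpsd : (Matrix.of fun a b => Q a b - m a * m b).PosSemidef) {D : Set (EuclideanSpace ℝ ι)}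
    (hD : IsClosed D) {ε : ℝ} (hε : 0 < ε) :
    ∃ δ : ℝ, 0 < δ ∧ ∀ (t : ℕ) (μ : Measure (EuclideanSpace ℝ ι)) [IsProbabilityMeasure μ],
      δ⁻¹ ≤ t → MemLp (fun y : EuclideanSpace ℝ ι => y) 3 μ →
      (∀ a, |∫ y, y a ∂μ - m a| ≤ δ) → (∀ a b, |∫ y, y a * y b ∂μ - Q a b| ≤ δ) →
      ∫ y, ‖y‖ ^ 3 ∂μ ≤ δ * √t →
      (Measure.pi fun _ : Fin t => μ).real {x | normSum t (meanVec μ) x ∈ D} ≤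
        (multivariateGaussian 0 (Matrix.of fun a b => Q a b - m a * m b)).real D + ε := by
  -- Failure for every `δ = 1 / (n + 1)` yields a sequence of laws that satisfies the central limit
  -- theorem, and the portmanteau inequality for the closed set `D` contradicts the failure.
  by_contra hcon
  have hcon' : ∀ n : ℕ, ∃ (t : ℕ) (μ : Measure (EuclideanSpace ℝ ι)),
      IsProbabilityMeasure μ ∧ (1 / ((n : ℝ) + 1))⁻¹ ≤ t ∧
      MemLp (fun y : EuclideanSpace ℝ ι => y) 3 μ ∧
      (∀ a, |∫ y, y a ∂μ - m a| ≤ 1 / ((n : ℝ) + 1)) ∧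
      (∀ a b, |∫ y, y a * y b ∂μ - Q a b| ≤ 1 / ((n : ℝ) + 1)) ∧
      ∫ y, ‖y‖ ^ 3 ∂μ ≤ 1 / ((n : ℝ) + 1) * √t ∧
      (multivariateGaussian 0 (Matrix.of fun a b => Q a b - m a * m b)).real D + ε <
      (Measure.pi fun _ : Fin t => μ).real {x | normSum t (meanVec μ) x ∈ D} := by
    intro n
    by_contra hn
    refine hcon ⟨1 / ((n : ℝ) + 1), by positivity, fun t μ hμ h1 h2 h3 h4 h5 => ?_⟩
    by_contra h6
    exact hn ⟨t, μ, hμ, h1, h2, h3, h4, h5, not_le.1 h6⟩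
  choose t μ hprob h1 h2 h3 h4 h5 h6 using hcon'
  have hone := tendsto_one_div_add_atTop_nhds_zero_nat (𝕜 := ℝ)
  have ht : Tendsto t atTop atTop := by
    refine tendsto_atTop_mono (fun n => ?_) tendsto_id
    have h := h1 n
    rw [one_div, inv_inv] at h
    exact_mod_cast (by linarith : (n : ℝ) ≤ t n)
  have hlim : ∀ {f : ℕ → ℝ} {c : ℝ}, (∀ n : ℕ, |f n - c| ≤ 1 / ((n : ℝ) + 1)) →
      Tendsto f atTop (𝓝 c) := fun h =>
    tendsto_iff_norm_sub_tendsto_zero.2 (squeeze_zero (fun _ => norm_nonneg _) h hone)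
  have h7 : Tendsto (fun n => (∫ y, ‖y‖ ^ 3 ∂(μ n)) / √(t n)) atTop (𝓝 0) := by
    refine squeeze_zero' (Eventually.of_forall fun n => ?_) ?_ hone
    · exact div_nonneg (integral_nonneg fun y => by positivity) (Real.sqrt_nonneg _)
    · filter_upwards [ht.eventually_gt_atTop 0] with n hn
      rw [div_le_iff₀ (Real.sqrt_pos.2 (Nat.cast_pos.2 hn))]
      exact h5 n
  set γ := multivariateGaussian 0 (Matrix.of fun a b => Q a b - m a * m b) with hγ
  have hmeas : ∀ n, Measurable (normSum (t n) (meanVec (μ n))) := fun n => measurable_normSum _ _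
  let ν : ℕ → ProbabilityMeasure (EuclideanSpace ℝ ι) := fun n =>
    ⟨(Measure.pi fun _ : Fin (t n) => μ n).map (normSum (t n) (meanVec (μ n))),
      Measure.isProbabilityMeasure_map (hmeas n).aemeasurable⟩
  let ν₀ : ProbabilityMeasure (EuclideanSpace ℝ ι) := ⟨γ, by rw [hγ]; infer_instance⟩
  have hconv : Tendsto ν atTop (𝓝 ν₀) := by
    refine ProbabilityMeasure.tendsto_of_tendsto_charFun fun x => ?_
    have h8 := tendsto_charFun_normSum ht h2 (fun a => hlim fun n => h3 n a)
      (fun a b => hlim fun n => h4 n a b) h7 x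
    have h9 : charFun (ν₀ : Measure (EuclideanSpace ℝ ι)) x = Complex.exp
        (-(x ⬝ᵥ (Matrix.of fun a b => Q a b - m a * m b) *ᵥ x) / 2) := by
      change charFun γ x = _
      rw [hγ, charFun_multivariateGaussian hpsd]
      congr 1
      simp [neg_div]
    rw [h9]
    exact h8
  have hsup := ProbabilityMeasure.limsup_measure_closed_le_of_tendsto hconv hD
  have hlt : (ν₀ : Measure (EuclideanSpace ℝ ι)) D < ENNReal.ofReal (γ.real D + ε) := by
    change γ D < _
    rw [ENNReal.lt_ofReal_iff_toReal_lt (measure_ne_top _ _)]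
    exact lt_add_of_pos_right _ hε
  obtain ⟨n, hn⟩ := (eventually_lt_of_limsup_lt (hsup.trans_lt hlt)).exists
  have h8 : (ν n : Measure (EuclideanSpace ℝ ι)) D =
      (Measure.pi fun _ : Fin (t n) => μ n) {x | normSum (t n) (meanVec (μ n)) x ∈ D} :=
    Measure.map_apply (hmeas n) hD.measurableSet
  rw [h8, ENNReal.lt_ofReal_iff_toReal_lt (measure_ne_top _ _)] at hn
  exact lt_asymm hn (h6 n)

end CLT

/-! ### Level sets of homogeneous functions under Gaussian measures -/

lemma pi_absolutelyContinuous {n : ℕ} {μ ν : Measure ℝ} [SigmaFinite μ] [SigmaFinite ν]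
    (h : μ ≪ ν) : (Measure.pi fun _ : Fin n => μ) ≪ Measure.pi fun _ : Fin n => ν := by
  induction n with
  | zero =>
    rw [Measure.pi_of_empty, Measure.pi_of_empty]
  | succ n ih =>
    have h1 := (measurePreserving_piFinSuccAbove (fun _ : Fin (n + 1) => μ) 0).symm
    have h2 := (measurePreserving_piFinSuccAbove (fun _ : Fin (n + 1) => ν) 0).symm
    rw [← h1.map_eq, ← h2.map_eq]
    exact (h.prod ih).map (MeasurableEquiv.measurable _)

open scoped Pointwise in
-- By homogeneity the positive level sets are dilates of each other. If one had positive volume, all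
-- would, but only countably many of these disjoint sets can.
lemma volume_level_eq_zero {n : ℕ} {h : (Fin n → ℝ) → ℝ} (hm : Measurable h)
    (hh : ∀ c : ℝ, 0 < c → ∀ z, h (c • z) = c * h z) {x : ℝ} (hx : 0 < x) :
    volume {z | h z = x} = 0 := by
  by_contra hne
  have hsub : Set.Ioi (0 : ℝ) ⊆ {y : ℝ | 0 < volume {z | h z = y}} := by
    intro y hy
    have hc : 0 < y / x := div_pos hy hx
    have hset : {z | h z = y} = (y / x) • {z | h z = x} := by
      ext z
      rw [Set.mem_smul_set_iff_inv_smul_mem₀ hc.ne', Set.mem_ofPred_eq, Set.mem_ofPred_eq,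
        hh _ (inv_pos.2 hc)]
      have : y ≠ 0 := ne_of_gt hy
      rw [inv_div]
      constructor
      · intro e; rw [e]; field_simp
      · intro e; field_simp at e; linarith
    rw [Set.mem_ofPred_eq, hset, Measure.addHaar_smul]
    refine ENNReal.mul_pos ?_ hne
    rw [ne_eq, ENNReal.ofReal_eq_zero, not_le]
    positivity
  have hcount := (Measure.countable_meas_level_set_pos (μ := volume) hm).mono hsub
  have h0 := hcount.measure_zero volume
  rw [Real.volume_Ioi] at h0
  exact ENNReal.top_ne_zero h0

open scoped MatrixOrder in
/-- A nonnegative homogeneous function has no atoms under a centered Gaussian measure if it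
vanishes only on the kernel of a nondegenerate linear form. -/
lemma multivariateGaussian_level_eq_zero {ι : Type*} [Fintype ι] [DecidableEq ι]
    {S : Matrix ι ι ℝ} (hS : S.PosSemidef) {g : EuclideanSpace ℝ ι → ℝ} (hg : Continuous g)
    (hhom : ∀ c : ℝ, 0 < c → ∀ z, g (c • z) = c * g z) (hnn : ∀ z, 0 ≤ g z)
    {C : EuclideanSpace ℝ ι} (hC : 0 < C.ofLp ⬝ᵥ S *ᵥ C.ofLp)
    (hzero : ∀ z, g z = 0 → inner ℝ C z = 0) (x : ℝ) :
    multivariateGaussian 0 S {z | g z = x} = 0 := by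
  rcases lt_trichotomy x 0 with hx | rfl | hx
  · convert measure_empty (μ := multivariateGaussian 0 S)
    ext z
    simp only [Set.mem_ofPred_eq, Set.mem_empty_iff_false, iff_false]
    exact fun e => absurd (hnn z) (by rw [e]; exact not_le.2 hx)
  -- Level zero lies in the kernel of `inner ℝ C`, whose law is a nondegenerate real Gaussian.
  · have hvar : Var[innerSL ℝ C; multivariateGaussian 0 S] = C.ofLp ⬝ᵥ S *ᵥ C.ofLp := by
      rw [← covarianceBilin_multivariateGaussian (μ := 0) hS, covarianceBilin_self]
      · rfl
      · exact IsGaussian.memLp_two_id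
    have hmap := IsGaussian.map_eq_gaussianReal (μ := multivariateGaussian 0 S) (innerSL ℝ C)
    rw [hvar] at hmap
    have : NullSingletonClass (gaussianReal (multivariateGaussian 0 S)[innerSL ℝ C]
        (C.ofLp ⬝ᵥ S *ᵥ C.ofLp).toNNReal) := by
      apply nullSingletonClass_gaussianReal
      simpa using hC
    have h0 : multivariateGaussian 0 S (innerSL ℝ C ⁻¹' {0}) = 0 := by
      rw [← Measure.map_apply (by fun_prop) (measurableSet_singleton _), hmap]
      exact measure_singleton 0
    exact measure_mono_null (fun z hz => by simpa using hzero z hz) h0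
  -- `S` may be singular, so the Gaussian need not have a density. Pulled back along `√S` to a
  -- standard Gaussian, which has one, the function is still homogeneous.
  · have hmeas : MeasurableSet {z | g z = x} := (isClosed_eq hg continuous_const).measurableSet
    have hT : Measurable fun z : Fin (Module.finrank ℝ (EuclideanSpace ℝ ι)) → ℝ =>
        ∑ i, z i • stdOrthonormalBasis ℝ (EuclideanSpace ℝ ι) i := by fun_prop
    have hA : Measurable fun z : EuclideanSpace ℝ ι =>
        (0 : EuclideanSpace ℝ ι) + (toEuclideanCLM (𝕜 := ℝ) (CFC.sqrt S)) z := by fun_prop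
    rw [multivariateGaussian, stdGaussian, Measure.map_map hA hT,
      Measure.map_apply (hA.comp hT) hmeas]
    have hac := pi_absolutelyContinuous (n := Module.finrank ℝ (EuclideanSpace ℝ ι))
      (gaussianReal_absolutelyContinuous 0 one_ne_zero)
    refine hac ?_
    rw [← volume_pi]
    refine volume_level_eq_zero (h := fun z => g (0 + toEuclideanCLM (𝕜 := ℝ) (CFC.sqrt S)
      (∑ i, z i • stdOrthonormalBasis ℝ (EuclideanSpace ℝ ι) i)))
      (hg.measurable.comp (hA.comp hT)) (fun c hc z => ?_) hx
    simp only [zero_add]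
    rw [← hhom c hc, ← map_smul, Finset.smul_sum]
    simp [smul_smul]

/-! ### Laws of large numbers for independent samples -/

/-- Chebyshev's inequality for the mean of pairwise independent random variables. -/
lemma measureReal_mean_sub_ge_le {Ω κ : Type*} [MeasurableSpace Ω] {P : Measure Ω}
    [IsProbabilityMeasure P] [Fintype κ] [Nonempty κ] {X : κ → Ω → ℝ}
    (hX : ∀ i, MemLp (X i) 2 P) (hind : Pairwise fun i j => IndepFun (X i) (X j) P)
    {e v : ℝ} (he : ∀ i, ∫ ω, X i ω ∂P = e) (hv : ∀ i, ∫ ω, X i ω ^ 2 ∂P ≤ v)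
    {c : ℝ} (hc : 0 < c) :
    P.real {ω | c ≤ |(Fintype.card κ : ℝ)⁻¹ * ∑ i, X i ω - e|} ≤ v / (Fintype.card κ * c ^ 2) := by
  have hN : (0 : ℝ) < Fintype.card κ := Nat.cast_pos.2 Fintype.card_pos
  have hsum : MemLp (∑ i, X i) 2 P := memLp_finsetSum' _ fun i _ => hX i
  have hvar : Var[∑ i, X i; P] ≤ Fintype.card κ * v := by
    rw [IndepFun.variance_sum (fun i _ => hX i) (fun i _ j _ hij => hind hij)]
    calc ∑ i, Var[X i; P] ≤ ∑ _i : κ, v := by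
          refine Finset.sum_le_sum fun i _ => ?_
          exact (variance_le_expectation_sq (hX i).1).trans (hv i)
      _ = _ := by simp
  have hmean : P[∑ i, X i] = Fintype.card κ * e := by
    simp only [Finset.sum_apply]
    rw [integral_finsetSum _ fun i _ => (hX i).integrable (by norm_num)]
    simp [he]
  have hch := meas_ge_le_variance_div_sq hsum (mul_pos hN hc)
  rw [hmean] at hch
  have hset : {ω | c ≤ |(Fintype.card κ : ℝ)⁻¹ * ∑ i, X i ω - e|} =
      {ω | Fintype.card κ * c ≤ |(∑ i, X i) ω - Fintype.card κ * e|} := by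
    ext ω
    simp only [Set.mem_ofPred_eq, Finset.sum_apply]
    have : ∑ i, X i ω - Fintype.card κ * e =
        Fintype.card κ * ((Fintype.card κ : ℝ)⁻¹ * ∑ i, X i ω - e) := by
      field_simp
    rw [this, abs_mul, abs_of_pos hN, mul_le_mul_iff_right₀ hN]
  rw [hset]
  have hv0 : 0 ≤ v := (integral_nonneg fun ω => sq_nonneg _).trans (hv (Classical.arbitrary κ))
  refine (ENNReal.toReal_mono ENNReal.ofReal_ne_top hch).trans ?_
  rw [ENNReal.toReal_ofReal (div_nonneg (variance_nonneg _ _) (by positivity))]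
  calc Var[∑ i, X i; P] / (Fintype.card κ * c) ^ 2
      ≤ (Fintype.card κ * v) / (Fintype.card κ * c) ^ 2 := by gcongr
    _ = _ := by field_simp

/-! ### Empirical quantiles -/

lemma empCDF_mono {B : ℕ} (x : Fin B → ℝ) : Monotone (empCDF x) := by
  intro q r hqr
  unfold empCDF
  gcongr with b

lemma one_le_empCDF {B : ℕ} (hB : 0 < B) (x : Fin B → ℝ) {q : ℝ} (hq : ∀ b, x b ≤ q) :
    1 ≤ empCDF x q := by
  have : ∀ b, Set.indicator {y : ℝ | y ≤ q} (fun _ => (1 : ℝ)) (x b) = 1 := fun b =>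
    Set.indicator_of_mem (show x b ∈ {y : ℝ | y ≤ q} from hq b) _
  have hB' : (B : ℝ) ≠ 0 := Nat.cast_ne_zero.2 hB.ne'
  simp only [empCDF, this]
  simp [hB']

lemma empCDF_eq_zero {B : ℕ} (x : Fin B → ℝ) {q : ℝ} (hq : ∀ b, q < x b) : empCDF x q = 0 := by
  have : ∀ b, Set.indicator {y : ℝ | y ≤ q} (fun _ => (1 : ℝ)) (x b) = 0 := fun b =>
    Set.indicator_of_notMem (show x b ∉ {y : ℝ | y ≤ q} from not_le.2 (hq b)) _
  simp [empCDF, this]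

lemma bddBelow_quantile {B : ℕ} (x : Fin B → ℝ) {a : ℝ} (ha : 0 < a) :
    BddBelow {q : ℝ | a ≤ empCDF x q} := by
  obtain ⟨m, hm⟩ := (Set.finite_range x).bddBelow
  refine ⟨m, fun q hq => ?_⟩
  by_contra hlt
  have := empCDF_eq_zero x (q := q) fun b => (not_le.1 hlt).trans_le (hm ⟨b, rfl⟩)
  rw [Set.mem_ofPred_eq, this] at hq
  linarith

lemma empCDF_lt_of_lt_quantile {B : ℕ} (x : Fin B → ℝ) {a y : ℝ} (ha : 0 < a)
    (hy : y < quantile x a) : empCDF x y < a := by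
  by_contra h
  exact absurd (csInf_le (bddBelow_quantile x ha) (not_lt.1 h)) (not_le.2 hy)

lemma le_empCDF_of_quantile_lt {B : ℕ} (hB : 0 < B) (x : Fin B → ℝ) {a y : ℝ} (ha : a ≤ 1)
    (hy : quantile x a < y) : a ≤ empCDF x y := by
  have hne : {q : ℝ | a ≤ empCDF x q}.Nonempty := by
    obtain ⟨m, hm⟩ := (Set.finite_range x).bddAbove
    exact ⟨m, ha.trans (one_le_empCDF hB x fun b => hm ⟨b, rfl⟩)⟩
  obtain ⟨q, hq, hqy⟩ := exists_lt_of_csInf_lt hne hy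
  exact le_trans hq (empCDF_mono x hqy.le)

/-- The proportion of the `x b` that lie in `A`. -/
def freq {E : Type*} {B : ℕ} (A : Set E) (x : Fin B → E) : ℝ :=
  (1 / (B : ℝ)) * ∑ b, Set.indicator A (fun _ => (1 : ℝ)) (x b)

lemma freq_le_freq {E F : Type*} {B : ℕ} {A : Set E} {A' : Set F} {x : Fin B → E} {x' : Fin B → F}
    (h : ∀ b, x b ∈ A → x' b ∈ A') : freq A x ≤ freq A' x' := by
  unfold freq
  gcongr with b
  by_cases hb : x b ∈ A
  · rw [Set.indicator_of_mem hb, Set.indicator_of_mem (h b hb)]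
  · rw [Set.indicator_of_notMem hb]
    exact Set.indicator_nonneg (fun _ _ => zero_le_one) _

lemma empCDF_div {B : ℕ} (x : Fin B → ℝ) {c : ℝ} (hc : 0 < c) (y : ℝ) :
    empCDF x (y / c) = freq (Set.Iic y) fun b => c * x b := by
  unfold empCDF freq
  congr 1
  refine Finset.sum_congr rfl fun b _ => ?_
  simp only [Set.indicator_apply, Set.mem_ofPred_eq, Set.mem_Iic, le_div_iff₀ hc, mul_comm]

/-- The limit theorems supply only upper bounds for closed sets. Lower bounds on the distribution
function are obtained through the closed half-line `Ici y`. -/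
lemma one_sub_empCDF_div_le {B : ℕ} (hB : 0 < B) (x : Fin B → ℝ) {c : ℝ} (hc : 0 < c) (y : ℝ) :
    1 - empCDF x (y / c) ≤ freq (Set.Ici y) fun b => c * x b := by
  have hB' : (B : ℝ) ≠ 0 := Nat.cast_ne_zero.2 hB.ne'
  have h1 : (1 : ℝ) = (1 / (B : ℝ)) * ∑ _b : Fin B, (1 : ℝ) := by simp [hB']
  rw [empCDF_div x hc]
  unfold freq
  calc 1 - 1 / (B : ℝ) * ∑ b, (Set.Iic y).indicator (fun _ => (1 : ℝ)) (c * x b)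
      = 1 / (B : ℝ) * ∑ b, (1 - (Set.Iic y).indicator (fun _ => (1 : ℝ)) (c * x b)) := by
        rw [Finset.sum_sub_distrib, mul_sub, ← h1]
    _ ≤ _ := ?_
  gcongr with b
  rw [tsub_le_iff_right]
  by_cases hb : c * x b ∈ Set.Iic y
  · rw [Set.indicator_of_mem hb]
    exact le_add_of_nonneg_left (Set.indicator_nonneg (fun _ _ => zero_le_one) _)
  · rw [Set.indicator_of_notMem hb, Set.indicator_of_mem (Set.mem_Ici.2
      (not_le.1 (show ¬ c * x b ≤ y from hb)).le), add_zero]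

/-! ### Coverage of bootstrap quantiles -/

section Coverage

variable {E : Type*} [NormedAddCommGroup E] [MeasurableSpace E] [BorelSpace E]
  {γ : Measure E} [IsProbabilityMeasure γ] {g : E → ℝ}

lemma exists_tail_le {ε : ℝ} (hε : 0 < ε) : ∃ R : ℝ, γ.real {x | R ≤ ‖x‖} ≤ ε := by
  have h := tendsto_cdf_atTop (γ.map fun x => ‖x‖)
  have : IsProbabilityMeasure (γ.map fun x : E => ‖x‖) :=
    Measure.isProbabilityMeasure_map measurable_norm.aemeasurable
  obtain ⟨R, hR⟩ := (h.eventually_const_lt (show 1 - ε < 1 by linarith)).exists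
  refine ⟨R + 1, ?_⟩
  rw [cdf_eq_real, map_measureReal_apply measurable_norm measurableSet_Iic] at hR
  have h2 : γ.real {x | R + 1 ≤ ‖x‖} ≤ γ.real ((fun x : E => ‖x‖) ⁻¹' Set.Iic R)ᶜ :=
    measureReal_mono (fun x hx => by
      simp only [Set.mem_compl_iff, Set.mem_preimage, Set.mem_Iic, not_le]
      exact lt_of_lt_of_le (by linarith) (show R + 1 ≤ ‖x‖ from hx))
  rw [probReal_compl_eq_one_sub (measurable_norm measurableSet_Iic)] at h2
  linarith

/-- A closed set of `E` that contains all points whose image under `g`, up to a small error, is in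
a given closed set of real numbers. -/
lemma exists_closed_cover (hg : Continuous g) {A : Set ℝ} (hA : IsClosed A) {ε : ℝ} (hε : 0 < ε) :
    ∃ (D : Set E) (η R : ℝ), IsClosed D ∧ 0 < η ∧ γ.real D ≤ γ.real (g ⁻¹' A) + ε ∧
      ∀ (x : E) (y : ℝ), y ∈ A → (‖x‖ ≤ R → |y - g x| ≤ η) → x ∈ D := by
  obtain ⟨R, hR⟩ := exists_tail_le (γ := γ) (half_pos hε)
  have hprob : IsProbabilityMeasure (γ.map g) :=
    Measure.isProbabilityMeasure_map hg.measurable.aemeasurable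
  have hth := tendsto_measure_cthickening_of_isClosed (μ := γ.map g)
    ⟨1, one_pos, measure_ne_top _ _⟩ hA
  have hth' : Tendsto (fun r => (γ.map g).real (Metric.cthickening r A)) (𝓝 0)
      (𝓝 ((γ.map g).real A)) := (ENNReal.tendsto_toReal (measure_ne_top _ _)).comp hth
  have hev := hth'.eventually_lt_const (lt_add_of_pos_right ((γ.map g).real A) (half_pos hε))
  obtain ⟨η, hη, hη0⟩ := ((hev.filter_mono nhdsWithin_le_nhds).and
    (self_mem_nhdsWithin (s := Set.Ioi (0 : ℝ)))).exists
  -- The thickening absorbs the approximation error of size `η`; outside the ball of radius `R`,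
  -- where no approximation is available, all points are included at the cost of a small tail.
  refine ⟨g ⁻¹' Metric.cthickening η A ∪ {x | R ≤ ‖x‖}, η, R, ?_, hη0, ?_, fun x y hy hxy => ?_⟩
  · exact (Metric.isClosed_cthickening.preimage hg).union
      (isClosed_le continuous_const continuous_norm)
  · rw [map_measureReal_apply hg.measurable Metric.isClosed_cthickening.measurableSet,
      map_measureReal_apply hg.measurable hA.measurableSet] at hη
    have := measureReal_union_le (μ := γ) (g ⁻¹' Metric.cthickening η A) {x | R ≤ ‖x‖}
    linarith
  · rcases le_total ‖x‖ R with h | h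
    · left
      refine Metric.mem_cthickening_of_dist_le (g x) y η A hy ?_
      rw [dist_comm, Real.dist_eq]
      exact hxy h
    · exact Or.inr h

lemma continuous_cdf_map (hg : Continuous g) (hatom : ∀ x, γ {z | g z = x} = 0) :
    Continuous (cdf (γ.map g)) := by
  have hprob : IsProbabilityMeasure (γ.map g) :=
    Measure.isProbabilityMeasure_map hg.measurable.aemeasurable
  rw [continuous_iff_continuousAt]
  intro x
  have h1 : (cdf (γ.map g)).measure {x} = 0 := by
    rw [measure_cdf, Measure.map_apply hg.measurable (measurableSet_singleton x)]
    exact hatom x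
  rw [StieltjesFunction.measure_singleton, ENNReal.ofReal_eq_zero] at h1
  have hmono := (cdf (γ.map g)).mono
  have h2 : Function.leftLim (cdf (γ.map g)) x = cdf (γ.map g) x :=
    le_antisymm (hmono.leftLim_le le_rfl) (by linarith)
  rw [continuousAt_iff_continuous_left'_right']
  refine ⟨(hmono.continuousWithinAt_Iio_iff_leftLim_eq).2 h2, ?_⟩
  exact ((cdf (γ.map g)).right_continuous x).mono Set.Ioi_subset_Ici_self

/-- If an error and its bootstrap replicates are close to the same function of two variables with
asymptotically the same law, the quantiles of the replicates have the right coverage. -/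
theorem tendsto_coverage {Ω : ℕ → Type*} [∀ n, MeasurableSpace (Ω n)] {P : ∀ n, Measure (Ω n)}
    [∀ n, IsProbabilityMeasure (P n)] {B : ℕ → ℕ} (hB : Tendsto B atTop atTop) {α : ℝ}
    (hα : α ∈ Set.Ioo (0 : ℝ) 1) (hg : Continuous g) (hatom : ∀ x, γ {z | g z = x} = 0)
    {T : ∀ n, Ω n → ℝ} {Ts : ∀ n, Ω n → Fin (B n) → ℝ} {c : ℕ → ℝ} (hc : ∀ᶠ n in atTop, 0 < c n)
    {X : ∀ n, Ω n → E} {Xs : ∀ n, Ω n → Fin (B n) → E}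
    (hT : ∀ ε > 0, ∀ R : ℝ, ∀ᶠ n in atTop, ∀ ω, ‖X n ω‖ ≤ R → |c n * T n ω - g (X n ω)| ≤ ε)
    (hTs : ∀ ε > 0, ∀ R : ℝ, ∃ bad : ∀ n, Set (Ω n),
      Tendsto (fun n => (P n).real (bad n)) atTop (𝓝 0) ∧
      ∀ᶠ n in atTop, ∀ ω, ω ∉ bad n → ∀ b, ‖Xs n ω b‖ ≤ R →
        |c n * Ts n ω b - g (Xs n ω b)| ≤ ε)
    (hX : ∀ D : Set E, IsClosed D → ∀ ε > 0,
      ∀ᶠ n in atTop, (P n).real {ω | X n ω ∈ D} ≤ γ.real D + ε)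
    (hXs : ∀ D : Set E, IsClosed D → ∀ ε > 0,
      Tendsto (fun n => (P n).real {ω | γ.real D + ε ≤ freq D (Xs n ω)}) atTop (𝓝 0)) :
    Tendsto (fun n => (P n).real {ω | T n ω ≤ quantile (Ts n ω) (1 - α)}) atTop (𝓝 (1 - α)) := by
  have hprob : IsProbabilityMeasure (γ.map g) :=
    Measure.isProbabilityMeasure_map hg.measurable.aemeasurable
  -- Through the closed cover, the upper bounds for closed subsets of `E` become upper bounds for
  -- the rescaled errors on the line; `claims` does the same for the replicates.
  have claim : ∀ A : Set ℝ, IsClosed A → ∀ ε > 0,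
      ∀ᶠ n in atTop, (P n).real {ω | c n * T n ω ∈ A} ≤ γ.real (g ⁻¹' A) + ε := by
    intro A hA ε hε
    obtain ⟨D, η, R, hD, hη, hγ, hcov⟩ := exists_closed_cover (γ := γ) hg hA (half_pos hε)
    filter_upwards [hT η hη R, hX D hD (ε / 2) (half_pos hε)] with n h1 h2
    have h3 : (P n).real {ω | c n * T n ω ∈ A} ≤ (P n).real {ω | X n ω ∈ D} :=
      measureReal_mono (fun ω hω => hcov _ _ hω (h1 ω))
    linarith
  have claims : ∀ A : Set ℝ, IsClosed A → ∀ ε > 0, Tendsto (fun n => (P n).real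
      {ω | γ.real (g ⁻¹' A) + ε ≤ freq A fun b => c n * Ts n ω b}) atTop (𝓝 0) := by
    intro A hA ε hε
    obtain ⟨D, η, R, hD, hη, hγ, hcov⟩ := exists_closed_cover (γ := γ) hg hA (half_pos hε)
    obtain ⟨bad, hbad, hgood⟩ := hTs η hη R
    have hsum := hbad.add (hXs D hD (ε / 2) (half_pos hε))
    rw [add_zero] at hsum
    refine squeeze_zero' (Eventually.of_forall fun _ => measureReal_nonneg) ?_ hsum
    filter_upwards [hgood] with n h1
    refine (measureReal_mono fun ω hω => ?_).trans (measureReal_union_le _ _)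
    by_cases hb : ω ∈ bad n
    · exact Or.inl hb
    · right
      have h2 : freq A (fun b => c n * Ts n ω b) ≤ freq D (Xs n ω) :=
        freq_le_freq fun b hbA => hcov _ _ hbA (h1 ω hb b)
      have h3 : γ.real (g ⁻¹' A) + ε ≤ freq A fun b => c n * Ts n ω b := hω
      exact (by linarith : γ.real D + ε / 2 ≤ freq D (Xs n ω))
  have hF : Continuous (cdf (γ.map g)) := continuous_cdf_map hg hatom
  have hIic : ∀ x, γ.real (g ⁻¹' Set.Iic x) = cdf (γ.map g) x := fun x => by
    rw [cdf_eq_real, map_measureReal_apply hg.measurable measurableSet_Iic]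
  have hIci : ∀ x, γ.real (g ⁻¹' Set.Ici x) = 1 - cdf (γ.map g) x := fun x => by
    rw [← hIic, ← probReal_compl_eq_one_sub (hg.measurable measurableSet_Iic)]
    have h1 : g ⁻¹' Set.Ici x ⊆ (g ⁻¹' Set.Iic x)ᶜ ∪ {z | g z = x} := by
      intro z hz
      rcases eq_or_lt_of_le (show x ≤ g z from hz) with h | h
      · exact Or.inr h.symm
      · exact Or.inl (not_le.2 h)
    have h2 : (g ⁻¹' Set.Iic x)ᶜ ⊆ g ⁻¹' Set.Ici x := fun z hz => (not_le.1 (show ¬ g z ≤ x from hz)).le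
    refine le_antisymm ?_ (measureReal_mono h2)
    refine (measureReal_mono h1).trans ((measureReal_union_le _ _).trans ?_)
    rw [measureReal_def (s := {z | g z = x}), hatom]
    simp
  have hex : ∀ y ∈ Set.Ioo (0 : ℝ) 1, ∃ x, cdf (γ.map g) x = y := by
    intro y hy
    obtain ⟨a, ha⟩ := ((tendsto_cdf_atBot (γ.map g)).eventually_lt_const hy.1).exists
    obtain ⟨b, hb⟩ := ((tendsto_cdf_atTop (γ.map g)).eventually_const_lt hy.2).exists
    exact mem_range_of_exists_le_of_exists_ge hF ⟨a, ha.le⟩ ⟨b, hb.le⟩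
  obtain ⟨hα0, hα1⟩ := hα
  have hBpos : ∀ᶠ n in atTop, 0 < B n := hB.eventually_gt_atTop 0
  rw [Metric.tendsto_nhds]
  intro ε₀ hε₀
  obtain ⟨ε, hε, hε1, hε2, hε3⟩ : ∃ ε > 0, 4 * ε < ε₀ ∧ ε < α ∧ ε < 1 - α := by
    refine ⟨min (ε₀ / 8) (min (α / 2) ((1 - α) / 2)), ?_, ?_, ?_, ?_⟩
    · refine lt_min (by linarith) (lt_min (by linarith) (by linarith))
    · linarith [min_le_left (ε₀ / 8) (min (α / 2) ((1 - α) / 2))]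
    · linarith [(min_le_right (ε₀ / 8) _).trans (min_le_left (α / 2) ((1 - α) / 2))]
    · linarith [(min_le_right (ε₀ / 8) _).trans (min_le_right (α / 2) ((1 - α) / 2))]
  -- By continuity the limit law takes the levels `1 - α ± ε` exactly. The bootstrap quantile,
  -- rescaled, leaves `[xl, xu]` only if an empirical frequency is off by `ε`. Either side of the
  -- coverage then loses at most `3 ε`.
  obtain ⟨xu, hxu⟩ := hex (1 - α + ε) ⟨by linarith, by linarith⟩
  obtain ⟨xl, hxl⟩ := hex (1 - α - ε) ⟨by linarith, by linarith⟩
  filter_upwards [hc, hBpos, claim (Set.Iic xu) isClosed_Iic ε hε,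
    claim (Set.Ici xl) isClosed_Ici ε hε,
    (claims (Set.Ici xu) isClosed_Ici ε hε).eventually_lt_const hε,
    (claims (Set.Iic xl) isClosed_Iic ε hε).eventually_lt_const hε] with n h1 h2 h3 h4 h5 h6
  rw [hIic, hxu] at h3
  rw [hIci, hxl] at h4
  rw [hIci, hxu] at h5
  rw [hIic, hxl] at h6
  have hup : (P n).real {ω | T n ω ≤ quantile (Ts n ω) (1 - α)} ≤
      (P n).real {ω | c n * T n ω ∈ Set.Iic xu} +
      (P n).real {ω | 1 - (1 - α + ε) + ε ≤ freq (Set.Ici xu) fun b => c n * Ts n ω b} := by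
    refine (measureReal_mono fun ω hω => ?_).trans (measureReal_union_le _ _)
    by_cases hle : c n * T n ω ≤ xu
    · exact Or.inl hle
    · right
      have h7 : xu / c n < quantile (Ts n ω) (1 - α) := by
        refine lt_of_lt_of_le ?_ (show T n ω ≤ _ from hω)
        rw [div_lt_iff₀ h1, mul_comm]
        exact not_le.1 hle
      have h8 := empCDF_lt_of_lt_quantile (Ts n ω) (by linarith) h7
      have h9 := one_sub_empCDF_div_le h2 (Ts n ω) h1 xu
      exact (by linarith : 1 - (1 - α + ε) + ε ≤ freq (Set.Ici xu) fun b => c n * Ts n ω b)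
  have hlow : 1 ≤ (P n).real {ω | T n ω ≤ quantile (Ts n ω) (1 - α)} +
      ((P n).real {ω | c n * T n ω ∈ Set.Ici xl} +
      (P n).real {ω | 1 - α - ε + ε ≤ freq (Set.Iic xl) fun b => c n * Ts n ω b}) := by
    refine le_trans ?_ (add_le_add le_rfl (measureReal_union_le _ _))
    refine probReal_univ.symm.le.trans
      ((measureReal_mono fun ω _ => ?_).trans (measureReal_union_le _ _))
    by_cases hq : T n ω ≤ quantile (Ts n ω) (1 - α)
    · exact Or.inl hq
    · right
      by_cases hle : xl ≤ c n * T n ω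
      · exact Or.inl hle
      · right
        have h7 : quantile (Ts n ω) (1 - α) < xl / c n := by
          refine lt_trans (not_le.1 hq) ?_
          rw [lt_div_iff₀ h1, mul_comm]
          exact not_le.1 hle
        have h8 := le_empCDF_of_quantile_lt h2 (Ts n ω) (by linarith) h7
        rw [empCDF_div _ h1] at h8
        exact (by linarith : 1 - α - ε + ε ≤ freq (Set.Iic xl) fun b => c n * Ts n ω b)
  rw [Real.dist_eq, abs_lt]
  constructor <;> linarith

end Coverage

/-! ### The empirical law and the law of the bootstrap indices -/

section Empirical

variable {ι : Type*} [Fintype ι]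

/-- The uniform distribution on `Fin t`. -/
abbrev unif (t : ℕ) : Measure (Fin t) := uniformOn (Set.univ : Set (Fin t))

/-- The empirical distribution of a sample. -/
def empLaw {t : ℕ} (y : Fin t → EuclideanSpace ℝ ι) : Measure (EuclideanSpace ℝ ι) :=
  (unif t).map y

lemma integral_unif {t : ℕ} [NeZero t] (f : Fin t → ℝ) :
    ∫ i, f i ∂(unif t) = (t : ℝ)⁻¹ * ∑ i, f i := by
  rw [integral_fintype Integrable.of_finite, Finset.mul_sum]
  refine Finset.sum_congr rfl fun i _ => ?_
  rw [measureReal_def, uniformOn_univ]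
  simp

instance isProbabilityMeasure_empLaw {t : ℕ} [NeZero t] (y : Fin t → EuclideanSpace ℝ ι) :
    IsProbabilityMeasure (empLaw y) :=
  Measure.isProbabilityMeasure_map (measurable_of_finite y).aemeasurable

lemma integral_empLaw {t : ℕ} [NeZero t] (y : Fin t → EuclideanSpace ℝ ι)
    {f : EuclideanSpace ℝ ι → ℝ} (hf : Continuous f) :
    ∫ x, f x ∂(empLaw y) = (t : ℝ)⁻¹ * ∑ i, f (y i) := by
  rw [empLaw, integral_map (measurable_of_finite y).aemeasurable hf.aestronglyMeasurable,
    integral_unif]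

lemma memLp_empLaw {t : ℕ} [NeZero t] (y : Fin t → EuclideanSpace ℝ ι) (q : ENNReal) :
    MemLp (fun x : EuclideanSpace ℝ ι => x) q (empLaw y) := by
  rw [empLaw, memLp_map_measure_iff (by fun_prop) (measurable_of_finite y).aemeasurable]
  obtain ⟨c, hc⟩ := (Set.finite_range fun i => ‖y i‖).bddAbove
  exact MemLp.of_bound (measurable_of_finite _).aestronglyMeasurable c
    (ae_of_all _ fun i => hc ⟨i, rfl⟩)

/-- Uniform resampling of the `y i` is i.i.d. sampling from their empirical law, so the central
limit theorem can be used conditionally on the sample. -/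
lemma pi_empLaw {t : ℕ} [NeZero t] (y : Fin t → EuclideanSpace ℝ ι)
    {D : Set (Fin t → EuclideanSpace ℝ ι)} (hD : MeasurableSet D) :
    (Measure.pi fun _ : Fin t => empLaw y).real D =
      (Measure.pi fun _ : Fin t => unif t).real {J | (fun i => y (J i)) ∈ D} := by
  have h := Measure.pi_map_pi (μ := fun _ : Fin t => unif t) (f := fun _ : Fin t => y)
    (fun _ => (measurable_of_finite y).aemeasurable)
  unfold empLaw
  rw [← h, map_measureReal_apply (measurable_of_finite _) hD]
  rfl

lemma map_bootstrap_eq {Ω : Type*} [MeasurableSpace Ω] {P : Measure Ω} [IsProbabilityMeasure P]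
    {t B : ℕ} [NeZero t] {I : Ω → Fin B → Fin t → Fin t}
    (hind : iIndepFun (fun (bi : Fin B × Fin t) (ω : Ω) => I ω bi.1 bi.2) P)
    (hlaw : ∀ b i, HasLaw (fun ω => I ω b i) (unif t) P) :
    AEMeasurable I P ∧
      P.map I = Measure.pi fun _ : Fin B => Measure.pi fun _ : Fin t => unif t := by
  have hI : AEMeasurable I P :=
    aemeasurable_pi_iff.2 fun b => aemeasurable_pi_iff.2 fun i => (hlaw b i).aemeasurable
  refine ⟨hI, ?_⟩
  have h1 := hind.map_fun_eq_pi_map fun bi : Fin B × Fin t => (hlaw bi.1 bi.2).aemeasurable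
  have h2 : ∀ bi : Fin B × Fin t, P.map (fun ω => I ω bi.1 bi.2) = unif t := fun bi =>
    (hlaw bi.1 bi.2).map_eq
  simp_rw [h2] at h1
  -- The index space is finite, so comparing point masses suffices to pass from a product over pairs
  -- to an iterated product.
  refine Measure.ext_of_singleton fun J => ?_
  have h3 : P.map I {J} = P.map (fun ω (bi : Fin B × Fin t) => I ω bi.1 bi.2)
      {fun bi => J bi.1 bi.2} := by
    rw [Measure.map_apply_of_aemeasurable hI (measurableSet_singleton _),
      Measure.map_apply_of_aemeasurable (aemeasurable_pi_iff.2
        fun bi : Fin B × Fin t => (hlaw bi.1 bi.2).aemeasurable) (measurableSet_singleton _)]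
    congr 1
    ext ω
    simp only [Set.mem_preimage, Set.mem_singleton_iff, funext_iff, Prod.forall]
  rw [h3, h1, Measure.pi_singleton, Measure.pi_singleton, Fintype.prod_prod_type]
  simp_rw [Measure.pi_singleton]

/-- The frequency among the bootstrap samples is close to the conditional probability. -/
lemma measureReal_freq_ge_le {F : Type*} [MeasurableSpace F] [MeasurableSingletonClass F]
    [Finite F] (ν : Measure F) [IsProbabilityMeasure ν] {B : ℕ} (hB : 0 < B) (A : Set F)
    {ε : ℝ} (hε : 0 < ε) :
    (Measure.pi fun _ : Fin B => ν).real {J | ν.real A + ε ≤ freq A J} ≤ 1 / (B * ε ^ 2) := by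
  have hA : MeasurableSet A := A.toFinite.measurableSet
  have hne : Nonempty (Fin B) := ⟨⟨0, hB⟩⟩
  have hm : Measurable (A.indicator fun _ => (1 : ℝ)) := measurable_const.indicator hA
  have hb : ∀ x, ‖A.indicator (fun _ => (1 : ℝ)) x‖ ≤ 1 := fun x => by
    by_cases hx : x ∈ A <;> simp [hx]
  have heval : ∀ (f : F → ℝ), Measurable f → ∀ b : Fin B,
      ∫ J, f (J b) ∂(Measure.pi fun _ : Fin B => ν) = ∫ x, f x ∂ν := fun f hf b => by
    have h := (measurePreserving_eval (fun _ : Fin B => ν) b)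
    conv_rhs => rw [← h.map_eq]
    rw [integral_map h.measurable.aemeasurable hf.aestronglyMeasurable]
  have key := measureReal_mean_sub_ge_le (P := Measure.pi fun _ : Fin B => ν)
    (X := fun b J => A.indicator (fun _ => (1 : ℝ)) (J b))
    (fun b => MemLp.of_bound (hm.comp (measurable_pi_apply b)).aestronglyMeasurable 1
      (ae_of_all _ fun J => hb (J b)))
    (fun b b' hbb' => (iIndepFun_pi (μ := fun _ : Fin B => ν)
      (X := fun _ => A.indicator fun _ => (1 : ℝ)) fun _ => hm.aemeasurable).indepFun hbb')
    (e := ν.real A) (v := 1) (fun b => by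
      rw [heval _ hm, integral_indicator hA]; simp)
    (fun b => by
      rw [heval (fun x => (A.indicator (fun _ => (1 : ℝ)) x) ^ 2) (hm.pow_const 2)]
      have : ∫ x, (1 : ℝ) ∂ν = 1 := by simp
      rw [← this]
      refine integral_mono Integrable.of_finite Integrable.of_finite fun x => ?_
      by_cases hx : x ∈ A <;> simp [hx]) hε
  rw [Fintype.card_fin] at key
  refine (measureReal_mono fun J hJ => ?_).trans key
  have h1 : ν.real A + ε ≤ freq A J := hJ
  have h2 : freq A J = (B : ℝ)⁻¹ * ∑ b, A.indicator (fun _ => (1 : ℝ)) (J b) := by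
    rw [freq, one_div]
  rw [h2] at h1
  exact (by linarith : ε ≤ _).trans (le_abs_self _)

/-- The probability, given the sample `y`, that the rescaled bootstrap error lies in `D`. -/
def bootProb {t : ℕ} (D : Set (EuclideanSpace ℝ ι)) (y : Fin t → EuclideanSpace ℝ ι) : ℝ :=
  (Measure.pi fun _ : Fin t => unif t).real
    {J | normSum t (meanVec (empLaw y)) (fun i => y (J i)) ∈ D}

lemma meanVec_empLaw {t : ℕ} [NeZero t] (y : Fin t → EuclideanSpace ℝ ι) :
    meanVec (empLaw y) = (t : ℝ)⁻¹ • ∑ i, y i := by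
  ext a
  simp only [meanVec]
  rw [integral_empLaw y (f := fun x => x a) (by fun_prop)]
  simp

lemma bootProb_eq {t : ℕ} [NeZero t] {D : Set (EuclideanSpace ℝ ι)} (hD : MeasurableSet D)
    (y : Fin t → EuclideanSpace ℝ ι) :
    bootProb D y = (Measure.pi fun _ : Fin t => empLaw y).real
      {x | normSum t (meanVec (empLaw y)) x ∈ D} := by
  rw [pi_empLaw y (D := {x | normSum t (meanVec (empLaw y)) x ∈ D}) (measurable_normSum t _ hD)]
  rfl

/-- With high probability, the frequency of a set among the bootstrap replicates does not exceed
its conditional probability by much. -/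
lemma measureReal_bootProb_add_le_freq {Ω : Type*} [MeasurableSpace Ω] {P : Measure Ω}
    [IsProbabilityMeasure P] {t B : ℕ} [NeZero t] (hB : 0 < B)
    {Y : Ω → Fin t → EuclideanSpace ℝ ι} {I : Ω → Fin B → Fin t → Fin t}
    (hY : AEMeasurable Y P)
    (hind : iIndepFun (fun (bi : Fin B × Fin t) (ω : Ω) => I ω bi.1 bi.2) P)
    (hlaw : ∀ b i, HasLaw (fun ω => I ω b i) (unif t) P) (hYI : IndepFun Y I P)
    {D : Set (EuclideanSpace ℝ ι)} (hD : MeasurableSet D) {ε : ℝ} (hε : 0 < ε) :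
    P.real {ω | bootProb D (Y ω) + ε ≤ freq D fun b =>
      normSum t (meanVec (empLaw (Y ω))) (fun i => Y ω (I ω b i))} ≤ 1 / (B * ε ^ 2) := by
  obtain ⟨hI, hmap⟩ := map_bootstrap_eq hind hlaw
  set ν : Measure (Fin t → Fin t) := Measure.pi fun _ : Fin t => unif t with hν
  have hprod := (indepFun_iff_map_prod_eq_prod_map_map hY hI).1 hYI
  rw [hmap] at hprod
  let Z : (Fin t → EuclideanSpace ℝ ι) → (Fin t → Fin t) → EuclideanSpace ℝ ι := fun y J =>
    normSum t (meanVec (empLaw y)) (fun i => y (J i))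
  have hZ : ∀ J, Measurable fun y => Z y J := by
    intro J
    simp only [Z, meanVec_empLaw, normSum]
    fun_prop
  -- The second factor is finite, so joint measurability reduces to measurability for each fixed
  -- choice of indices.
  have hZ2 : Measurable fun q : (Fin t → EuclideanSpace ℝ ι) × (Fin t → Fin t) => Z q.1 q.2 :=
    measurable_from_prod_countable_left hZ
  have hp : Measurable fun y : Fin t → EuclideanSpace ℝ ι => bootProb D y := by
    have h := measurable_measure_prodMk_left (ν := ν) (hZ2 hD)
    exact h.ennreal_toReal
  have hfreq : Measurable fun q : (Fin t → EuclideanSpace ℝ ι) × (Fin B → Fin t → Fin t) =>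
      freq D fun b => Z q.1 (q.2 b) := by
    refine measurable_from_prod_countable_left fun J => ?_
    unfold freq
    refine (Finset.measurable_sum _ fun b _ => ?_).const_mul _
    exact (measurable_const.indicator hD).comp (hZ (J b))
  let W : Set ((Fin t → EuclideanSpace ℝ ι) × (Fin B → Fin t → Fin t)) :=
    {q | bootProb D q.1 + ε ≤ freq D fun b => Z q.1 (q.2 b)}
  have hW : MeasurableSet W := measurableSet_le ((hp.comp measurable_fst).add_const ε) hfreq
  have h1 : P {ω | bootProb D (Y ω) + ε ≤ freq D fun b => Z (Y ω) (I ω b)} =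
      ((P.map Y).prod (Measure.pi fun _ : Fin B => ν)) W := by
    rw [← hprod, Measure.map_apply_of_aemeasurable (hY.prodMk hI) hW]
    rfl
  have hYprob : IsProbabilityMeasure (P.map Y) := Measure.isProbabilityMeasure_map hY
  have h2 : ((P.map Y).prod (Measure.pi fun _ : Fin B => ν)) W ≤
      ENNReal.ofReal (1 / (B * ε ^ 2)) := by
    -- Sample and indices are independent: the sample is frozen, the bound for a fixed sample is
    -- applied, and the result is integrated over the law of the sample.
    rw [Measure.prod_apply hW]
    calc ∫⁻ y, (Measure.pi fun _ : Fin B => ν) (Prod.mk y ⁻¹' W) ∂(P.map Y)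
        ≤ ∫⁻ _y, ENNReal.ofReal (1 / (B * ε ^ 2)) ∂(P.map Y) := by
          refine lintegral_mono fun y => ?_
          have h3 := measureReal_freq_ge_le ν hB {J | Z y J ∈ D} hε
          rw [← ENNReal.ofReal_toReal (measure_ne_top _ (Prod.mk y ⁻¹' W))]
          exact ENNReal.ofReal_le_ofReal h3
      _ = _ := by simp
  change (P {ω | bootProb D (Y ω) + ε ≤ freq D fun b => Z (Y ω) (I ω b)}).toReal ≤ _
  rw [h1]
  exact ENNReal.toReal_le_of_le_ofReal (by positivity) h2

end Empirical

/-! ### Asymptotics for samples and their bootstrap versions -/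

/-- A sequence of i.i.d. samples of growing sizes, with converging first and second moments and
with third and fourth moments that do not grow too fast. -/
structure SampleModel {Ω : ℕ → Type*} [∀ n, MeasurableSpace (Ω n)] (P : ∀ n, Measure (Ω n))
    {ι : Type*} [Fintype ι] (t : ℕ → ℕ) (Y : ∀ n, Ω n → Fin (t n) → EuclideanSpace ℝ ι)
    (μ : ℕ → Measure (EuclideanSpace ℝ ι)) (m : ι → ℝ) (Q : ι → ι → ℝ) : Prop where
  indep : ∀ᶠ n in atTop, iIndepFun (fun i ω => Y n ω i) (P n)
  law : ∀ᶠ n in atTop, ∀ i, HasLaw (fun ω => Y n ω i) (μ n) (P n)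
  memLp : ∀ᶠ n in atTop, MemLp (fun y : EuclideanSpace ℝ ι => y) 4 (μ n)
  first : ∀ a, Tendsto (fun n => ∫ y, y a ∂(μ n)) atTop (𝓝 (m a))
  second : ∀ a b, Tendsto (fun n => ∫ y, y a * y b ∂(μ n)) atTop (𝓝 (Q a b))
  third : Tendsto (fun n => (∫ y, ‖y‖ ^ 3 ∂(μ n)) / √(t n)) atTop (𝓝 0)
  fourth : Tendsto (fun n => (∫ y, ‖y‖ ^ 4 ∂(μ n)) / t n) atTop (𝓝 0)

/-- Together with `sq_coord_mul_le`, this bounds by one fourth moment the second moments of all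
functions that enter the law of large numbers. -/
lemma sq_coord_le {ι : Type*} [Fintype ι] (y : EuclideanSpace ℝ ι) (a : ι) :
    y a ^ 2 ≤ 1 + ‖y‖ ^ 4 := by
  have h := PiLp.norm_apply_le y a
  rw [Real.norm_eq_abs] at h
  have h2 : y a ^ 2 ≤ ‖y‖ ^ 2 := sq_le_sq.2 (by rwa [abs_of_nonneg (norm_nonneg y)])
  nlinarith [sq_nonneg (‖y‖ ^ 2 - 1)]

lemma sq_coord_mul_le {ι : Type*} [Fintype ι] (y : EuclideanSpace ℝ ι) (a b : ι) :
    (y a * y b) ^ 2 ≤ 1 + ‖y‖ ^ 4 := by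
  have h1 := PiLp.norm_apply_le y a
  have h2 := PiLp.norm_apply_le y b
  rw [Real.norm_eq_abs] at h1 h2
  have h3 : |y a * y b| ≤ ‖y‖ ^ 2 := by
    rw [abs_mul, sq]
    gcongr
  have h4 : (y a * y b) ^ 2 ≤ (‖y‖ ^ 2) ^ 2 := sq_le_sq.2 (by rwa [abs_of_nonneg (sq_nonneg ‖y‖)])
  nlinarith

lemma norm_le_of_abs_coord_le {ι : Type*} [Fintype ι] (y : EuclideanSpace ℝ ι) {δ : ℝ}
    (h : ∀ a, |y a| ≤ δ) : ‖y‖ ≤ Fintype.card ι * δ := by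
  have h1 : y = ∑ a, y a • (EuclideanSpace.basisFun ι ℝ) a :=
    ((EuclideanSpace.basisFun ι ℝ).sum_repr y).symm
  calc ‖y‖ = ‖∑ a, y a • (EuclideanSpace.basisFun ι ℝ) a‖ := by rw [← h1]
    _ ≤ ∑ a, ‖y a • (EuclideanSpace.basisFun ι ℝ) a‖ := norm_sum_le _ _
    _ ≤ ∑ _a : ι, δ := by
        refine Finset.sum_le_sum fun a _ => ?_
        rw [norm_smul, OrthonormalBasis.norm_eq_one, mul_one]
        exact h a
    _ = _ := by simp

/-- The moments of the empirical distribution are close to prescribed values. -/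
structure GoodSample {ι : Type*} [Fintype ι] (m : ι → ℝ) (Q : ι → ι → ℝ) (δ : ℝ) {t : ℕ}
    (y : Fin t → EuclideanSpace ℝ ι) : Prop where
  first : ∀ a, |∫ x, x a ∂(empLaw y) - m a| ≤ δ
  second : ∀ a b, |∫ x, x a * x b ∂(empLaw y) - Q a b| ≤ δ
  third : ∫ x, ‖x‖ ^ 3 ∂(empLaw y) ≤ δ * √t

namespace SampleModel

variable {Ω : ℕ → Type*} [∀ n, MeasurableSpace (Ω n)] {P : ∀ n, Measure (Ω n)}
  [∀ n, IsProbabilityMeasure (P n)] {ι : Type*} [Fintype ι] {t : ℕ → ℕ} [∀ n, NeZero (t n)]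
  {Y : ∀ n, Ω n → Fin (t n) → EuclideanSpace ℝ ι} {μ : ℕ → Measure (EuclideanSpace ℝ ι)}
  {m : ι → ℝ} {Q : ι → ι → ℝ}

lemma eventually_prob (h : SampleModel P t Y μ m Q) :
    ∀ᶠ n in atTop, IsProbabilityMeasure (μ n) := by
  filter_upwards [h.law] with n hn
  exact (hn ⟨0, Nat.pos_of_ne_zero (NeZero.ne _)⟩).isProbabilityMeasure_iff.1 inferInstance

/-- This is `exists_clt_radius` for the true law, and concerns the sketching error itself. -/
lemma eventually_measureReal_normSum_le [DecidableEq ι] (h : SampleModel P t Y μ m Q)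
    (ht : Tendsto t atTop atTop)
    (hpsd : (Matrix.of fun a b => Q a b - m a * m b).PosSemidef)
    {D : Set (EuclideanSpace ℝ ι)} (hD : IsClosed D) {ε : ℝ} (hε : 0 < ε) :
    ∀ᶠ n in atTop, (P n).real {ω | normSum (t n) (meanVec (μ n)) (Y n ω) ∈ D} ≤
      (multivariateGaussian 0 (Matrix.of fun a b => Q a b - m a * m b)).real D + ε := by
  obtain ⟨δ, hδ, hclt⟩ := exists_clt_radius hpsd hD hε
  have hlim : ∀ {f : ℕ → ℝ} {c : ℝ}, Tendsto f atTop (𝓝 c) → ∀ᶠ n in atTop, |f n - c| ≤ δ := by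
    intro f c hf
    filter_upwards [hf.eventually (Metric.closedBall_mem_nhds c hδ)] with n hn
    simpa [Real.dist_eq] using hn
  have htδ : ∀ᶠ n in atTop, δ⁻¹ ≤ (t n : ℝ) :=
    (tendsto_natCast_atTop_atTop.comp ht).eventually_ge_atTop δ⁻¹
  filter_upwards [h.indep, h.law, h.memLp, h.eventually_prob, htδ,
    eventually_all.2 fun a => hlim (h.first a),
    eventually_all.2 fun a => eventually_all.2 fun b => hlim (h.second a b),
    hlim h.third] with n h1 h2 h3 h4 h5 h6 h7 h8
  have h9 : ∫ y, ‖y‖ ^ 3 ∂(μ n) ≤ δ * √(t n) := by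
    have hpos : 0 < √(t n : ℝ) :=
      Real.sqrt_pos.2 (Nat.cast_pos.2 (Nat.pos_of_ne_zero (NeZero.ne _)))
    rw [sub_zero] at h8
    exact (div_le_iff₀ hpos).1 ((le_abs_self _).trans h8)
  refine le_trans (le_of_eq ?_)
    (hclt (t n) (μ n) h5 (h3.mono_exponent (by norm_num)) h6 h7 h9)
  have hDm : MeasurableSet {x : Fin (t n) → EuclideanSpace ℝ ι |
      normSum (t n) (meanVec (μ n)) x ∈ D} := measurable_normSum _ _ hD.measurableSet
  have hmap := h1.map_fun_eq_pi_map fun i => (h2 i).aemeasurable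
  simp_rw [fun i => (h2 i).map_eq] at hmap
  rw [← hmap, map_measureReal_apply_of_aemeasurable
    (aemeasurable_pi_iff.2 fun i => (h2 i).aemeasurable) hDm]
  rfl

/-- A weak law of large numbers. -/
lemma tendsto_measureReal_mean (h : SampleModel P t Y μ m Q) (ht : Tendsto t atTop atTop)
    {f : EuclideanSpace ℝ ι → ℝ} (hf : Continuous f) (hbd : ∀ y, f y ^ 2 ≤ 1 + ‖y‖ ^ 4) {e : ℝ}
    (he : Tendsto (fun n => ∫ y, f y ∂(μ n)) atTop (𝓝 e)) {δ : ℝ} (hδ : 0 < δ) :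
    Tendsto (fun n => (P n).real {ω | ¬ |∫ x, f x ∂(empLaw (Y n ω)) - e| ≤ δ}) atTop (𝓝 0) := by
  have htR : Tendsto (fun n => (t n : ℝ)) atTop atTop := tendsto_natCast_atTop_atTop.comp ht
  have hup : Tendsto (fun n => ((1 / (t n : ℝ) + (∫ y, ‖y‖ ^ 4 ∂(μ n)) / t n)) / (δ / 2) ^ 2) atTop
      (𝓝 0) := by
    have h1 : Tendsto (fun n => 1 / (t n : ℝ)) atTop (𝓝 0) :=
      tendsto_const_nhds.div_atTop htR
    simpa using (h1.add h.fourth).div_const ((δ / 2) ^ 2)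
  refine squeeze_zero' (Eventually.of_forall fun _ => measureReal_nonneg) ?_ hup
  filter_upwards [h.indep, h.law, h.memLp, h.eventually_prob,
    he.eventually (Metric.ball_mem_nhds e (half_pos hδ))] with n h1 h2 h3 h4 h5
  have hpos : (0 : ℝ) < t n := Nat.cast_pos.2 (Nat.pos_of_ne_zero (NeZero.ne _))
  have hn4 : Integrable (fun y : EuclideanSpace ℝ ι => ‖y‖ ^ 4) (μ n) := by
    simpa using h3.integrable_norm_pow (by norm_num)
  have hsqi : Integrable (fun y => f y ^ 2) (μ n) :=
    ((integrable_const 1).add hn4).mono' (by fun_prop) (ae_of_all _ fun y => by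
      rw [Real.norm_eq_abs, abs_of_nonneg (sq_nonneg _)]; exact hbd y)
  have hf2 : MemLp f 2 (μ n) := (memLp_two_iff_integrable_sq hf.aestronglyMeasurable).2 hsqi
  have hcheb := measureReal_mean_sub_ge_le (P := P n) (X := fun i ω => f (Y n ω i))
    (fun i => by
      have := hf2
      rw [← (h2 i).map_eq] at this
      exact this.comp_of_map (h2 i).aemeasurable)
    (fun i j hij => (h1.indepFun hij).comp hf.measurable hf.measurable)
    (e := ∫ y, f y ∂(μ n)) (v := 1 + ∫ y, ‖y‖ ^ 4 ∂(μ n))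
    (fun i => by
      rw [← (h2 i).map_eq, integral_map (h2 i).aemeasurable hf.aestronglyMeasurable])
    (fun i => by
      have h6 : ∫ ω, f (Y n ω i) ^ 2 ∂(P n) = ∫ y, f y ^ 2 ∂(μ n) := by
        rw [← (h2 i).map_eq, integral_map (h2 i).aemeasurable (by fun_prop)]
      have h7 : (1 : ℝ) + ∫ y, ‖y‖ ^ 4 ∂(μ n) = ∫ y, (1 + ‖y‖ ^ 4) ∂(μ n) := by
        rw [integral_add (integrable_const _) hn4]; simp
      rw [h6, h7]
      exact integral_mono hsqi ((integrable_const 1).add hn4) hbd) (half_pos hδ)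
  rw [Fintype.card_fin] at hcheb
  refine (measureReal_mono fun ω hω => ?_).trans (hcheb.trans (le_of_eq (by field_simp)))
  have h6 : ¬ |∫ x, f x ∂(empLaw (Y n ω)) - e| ≤ δ := hω
  rw [integral_empLaw _ hf, not_le] at h6
  rw [Real.dist_eq] at h5
  have h7 := abs_sub_le ((t n : ℝ)⁻¹ * ∑ i, f (Y n ω i)) (∫ y, f y ∂(μ n)) e
  exact (by linarith : δ / 2 ≤ |(t n : ℝ)⁻¹ * ∑ i, f (Y n ω i) - ∫ y, f y ∂(μ n)|)

/-- The empirical third moment need not converge, only be `o(√t)`. Markov's inequality suffices for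
this and avoids sixth moments. -/
lemma tendsto_measureReal_third (h : SampleModel P t Y μ m Q) {δ : ℝ} (hδ : 0 < δ) :
    Tendsto (fun n => (P n).real {ω | ¬ ∫ x, ‖x‖ ^ 3 ∂(empLaw (Y n ω)) ≤ δ * √(t n)}) atTop
      (𝓝 0) := by
  have hup := h.third.div_const δ
  rw [zero_div] at hup
  refine squeeze_zero' (Eventually.of_forall fun _ => measureReal_nonneg) ?_ hup
  filter_upwards [h.law, h.memLp, h.eventually_prob] with n h2 h3 h4
  have hpos : (0 : ℝ) < t n := Nat.cast_pos.2 (Nat.pos_of_ne_zero (NeZero.ne _))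
  have hsq : 0 < √(t n : ℝ) := Real.sqrt_pos.2 hpos
  have hn3 : Integrable (fun y : EuclideanSpace ℝ ι => ‖y‖ ^ 3) (μ n) := by
    simpa using (h3.mono_exponent (q := 4) (p := 3) (by norm_num)).integrable_norm_pow (by norm_num)
  have hi : ∀ i, Integrable (fun ω => ‖Y n ω i‖ ^ 3) (P n) := fun i => by
    have := hn3
    rw [← (h2 i).map_eq] at this
    exact this.comp_aemeasurable (h2 i).aemeasurable
  have hint : ∫ ω, (t n : ℝ)⁻¹ * ∑ i, ‖Y n ω i‖ ^ 3 ∂(P n) = ∫ y, ‖y‖ ^ 3 ∂(μ n) := by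
    rw [integral_const_mul, integral_finsetSum _ fun i _ => hi i]
    have : ∀ i, ∫ ω, ‖Y n ω i‖ ^ 3 ∂(P n) = ∫ y, ‖y‖ ^ 3 ∂(μ n) := fun i => by
      rw [← (h2 i).map_eq, integral_map (h2 i).aemeasurable (by fun_prop)]
    simp [this, hpos.ne']
  have hmarkov := mul_meas_ge_le_integral_of_nonneg (μ := P n)
    (f := fun ω => (t n : ℝ)⁻¹ * ∑ i, ‖Y n ω i‖ ^ 3) (ae_of_all _ fun ω => by positivity)
    ((integrable_finsetSum _ fun i _ => hi i).const_mul _) (δ * √(t n))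
  rw [hint] at hmarkov
  have h5 : (P n).real {ω | ¬ ∫ x, ‖x‖ ^ 3 ∂(empLaw (Y n ω)) ≤ δ * √(t n)} ≤
      (P n).real {ω | δ * √(t n) ≤ (t n : ℝ)⁻¹ * ∑ i, ‖Y n ω i‖ ^ 3} := by
    refine measureReal_mono fun ω hω => ?_
    have h6 : ¬ ∫ x, ‖x‖ ^ 3 ∂(empLaw (Y n ω)) ≤ δ * √(t n) := hω
    rw [integral_empLaw _ (f := fun x => ‖x‖ ^ 3) (by fun_prop), not_le] at h6
    exact h6.le
  refine h5.trans ?_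
  rw [div_div, le_div_iff₀ (by positivity)]
  calc _ = δ * √(t n) * (P n).real {ω | δ * √(t n) ≤ (t n : ℝ)⁻¹ * ∑ i, ‖Y n ω i‖ ^ 3} := by ring
    _ ≤ _ := hmarkov

lemma tendsto_measureReal_not_good (h : SampleModel P t Y μ m Q) (ht : Tendsto t atTop atTop)
    {δ : ℝ} (hδ : 0 < δ) :
    Tendsto (fun n => (P n).real {ω | ¬ GoodSample m Q δ (Y n ω)}) atTop (𝓝 0) := by
  have h1 := fun a => h.tendsto_measureReal_mean ht (f := fun y => y a) (by fun_prop)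
    (fun y => sq_coord_le y a) (h.first a) hδ
  have h2 := fun a b => h.tendsto_measureReal_mean ht (f := fun y => y a * y b) (by fun_prop)
    (fun y => sq_coord_mul_le y a b) (h.second a b) hδ
  have h3 := h.tendsto_measureReal_third hδ
  have hsum := ((tendsto_finsetSum Finset.univ fun a _ => h1 a).add
    (tendsto_finsetSum Finset.univ fun a _ => tendsto_finsetSum Finset.univ fun b _ => h2 a b)).add
    h3
  simp only [Finset.sum_const_zero, add_zero] at hsum
  refine squeeze_zero (fun _ => measureReal_nonneg) (fun n => ?_) hsum
  have hsub : {ω | ¬ GoodSample m Q δ (Y n ω)} ⊆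
      ((⋃ a, {ω | ¬ |∫ x, x a ∂(empLaw (Y n ω)) - m a| ≤ δ}) ∪
      ⋃ a, ⋃ b, {ω | ¬ |∫ x, x a * x b ∂(empLaw (Y n ω)) - Q a b| ≤ δ}) ∪
      {ω | ¬ ∫ x, ‖x‖ ^ 3 ∂(empLaw (Y n ω)) ≤ δ * √(t n)} := by
    intro ω hω
    by_contra hcon
    simp only [Set.mem_union, Set.mem_iUnion, Set.mem_ofPred_eq, not_or, not_exists,
      not_not] at hcon
    exact hω ⟨hcon.1.1, hcon.1.2, hcon.2⟩
  refine (measureReal_mono hsub).trans ((measureReal_union_le _ _).trans ?_)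
  gcongr
  refine (measureReal_union_le _ _).trans ?_
  gcongr
  · exact measureReal_iUnion_fintype_le _
  · refine (measureReal_iUnion_fintype_le _).trans ?_
    gcongr
    exact measureReal_iUnion_fintype_le _

/-- The bootstrap replicates of the rescaled error asymptotically have the same law as the
rescaled error itself. -/
lemma tendsto_measureReal_le_freq [DecidableEq ι] (h : SampleModel P t Y μ m Q)
    (ht : Tendsto t atTop atTop)
    (hpsd : (Matrix.of fun a b => Q a b - m a * m b).PosSemidef)
    {B : ℕ → ℕ} (hB : Tendsto B atTop atTop) {I : ∀ n, Ω n → Fin (B n) → Fin (t n) → Fin (t n)}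
    (hind : ∀ n, iIndepFun (fun (bi : Fin (B n) × Fin (t n)) (ω : Ω n) => I n ω bi.1 bi.2) (P n))
    (hlaw : ∀ n b i, HasLaw (fun ω => I n ω b i) (unif (t n)) (P n))
    (hYI : ∀ᶠ n in atTop, IndepFun (Y n) (I n) (P n))
    {D : Set (EuclideanSpace ℝ ι)} (hD : IsClosed D) {ε : ℝ} (hε : 0 < ε) :
    Tendsto (fun n => (P n).real
      {ω | (multivariateGaussian 0 (Matrix.of fun a b => Q a b - m a * m b)).real D + ε ≤
        freq D fun b => normSum (t n) (meanVec (empLaw (Y n ω))) (fun i => Y n ω (I n ω b i))})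
      atTop (𝓝 0) := by
  obtain ⟨δ, hδ, hclt⟩ := exists_clt_radius hpsd hD (half_pos hε)
  have htδ : ∀ᶠ n in atTop, δ⁻¹ ≤ (t n : ℝ) :=
    (tendsto_natCast_atTop_atTop.comp ht).eventually_ge_atTop δ⁻¹
  have hBR : Tendsto (fun n => 1 / ((B n : ℝ) * (ε / 2) ^ 2)) atTop (𝓝 0) :=
    tendsto_const_nhds.div_atTop
      ((tendsto_natCast_atTop_atTop.comp hB).atTop_mul_const (by positivity))
  have hsum := (h.tendsto_measureReal_not_good ht hδ).add hBR
  rw [add_zero] at hsum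
  refine squeeze_zero' (Eventually.of_forall fun _ => measureReal_nonneg) ?_ hsum
  filter_upwards [h.law, hYI, htδ, hB.eventually_gt_atTop 0] with n h2 h3 h4 h5
  have hY : AEMeasurable (Y n) (P n) := aemeasurable_pi_iff.2 fun i => (h2 i).aemeasurable
  refine le_trans ?_ (add_le_add le_rfl
    (measureReal_bootProb_add_le_freq h5 hY (hind n) (hlaw n) h3 hD.measurableSet (half_pos hε)))
  refine (measureReal_mono fun ω hω => ?_).trans (measureReal_union_le _ _)
  -- On a good sample the empirical law meets the conditions of `exists_clt_radius`, so the
  -- conditional probability exceeds the Gaussian one by at most `ε / 2`. The frequency must then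
  -- deviate from it by the other `ε / 2`.
  by_cases hg : GoodSample m Q δ (Y n ω)
  · right
    have h6 := hclt (t n) (empLaw (Y n ω)) h4 (memLp_empLaw _ _) hg.first hg.second hg.third
    rw [← bootProb_eq hD.measurableSet] at h6
    exact le_trans (by linarith : bootProb D (Y n ω) + ε / 2 ≤
      (multivariateGaussian 0 (Matrix.of fun a b => Q a b - m a * m b)).real D + ε) hω
  · exact Or.inl hg

end SampleModel

/-! ### Gram matrices, singular values and singular vectors -/

/-- A square matrix as an element of the Euclidean space `MatSpace d`. -/
def vec {d : ℕ} (M : Matrix (Fin d) (Fin d) ℝ) : MatSpace d :=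
  WithLp.toLp 2 fun q => M q.1 q.2

/-- The matrix `AᵀA / n`. -/
def nGram {m d : ℕ} (n : ℕ) (A : Matrix (Fin m) (Fin d) ℝ) : MatSpace d :=
  vec ((1 / (n : ℝ)) • (Aᵀ * A))

section Gram

variable {m d : ℕ}

lemma bil_vec (M : Matrix (Fin d) (Fin d) ℝ) (x y : EuclideanSpace ℝ (Fin d)) :
    bil (vec M) x y = inner ℝ x (act M y) := by
  simp only [bil, vec, PiLp.inner_apply, act, RCLike.inner_apply, conj_trivial, Matrix.mulVec,
    dotProduct, Fintype.sum_prod_type, Finset.sum_mul]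
  exact Finset.sum_congr rfl fun _ _ => Finset.sum_congr rfl fun _ _ => by ring

lemma inner_act_act (A : Matrix (Fin m) (Fin d) ℝ) (x y : EuclideanSpace ℝ (Fin d)) :
    inner ℝ (act A x) (act A y) = inner ℝ x (act (Aᵀ * A) y) := by
  simp only [act, EuclideanSpace.inner_eq_star_dotProduct, star_trivial]
  rw [← Matrix.mulVec_mulVec, Matrix.mulVec_transpose, ← Matrix.dotProduct_mulVec]

lemma act_smul_matrix (c : ℝ) (M : Matrix (Fin m) (Fin d) ℝ) (x : EuclideanSpace ℝ (Fin d)) :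
    act (c • M) x = c • act M x := by
  simp [act, Matrix.smul_mulVec]

lemma bil_nGram (n : ℕ) (A : Matrix (Fin m) (Fin d) ℝ) (x y : EuclideanSpace ℝ (Fin d)) :
    bil (nGram n A) x y = (1 / (n : ℝ)) * inner ℝ (act A x) (act A y) := by
  rw [nGram, bil_vec, act_smul_matrix, inner_smul_right, inner_act_act]

lemma sval_nonneg (A : Matrix (Fin m) (Fin d) ℝ) (j : ℕ) : 0 ≤ sval A j :=
  LinearMap.singularValues_nonneg _ _

lemma exists_sortedEig_of_symmetric {M : Matrix (Fin d) (Fin d) ℝ} (hM : M.IsSymm) :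
    ∃ b μ, SortedEig (vec M) b μ := by
  have hs : (Matrix.toEuclideanLin M).IsSymmetric :=
    Matrix.isSymmetric_toEuclideanLin_iff.2 (by
      rw [Matrix.IsHermitian, Matrix.conjTranspose_eq_transpose_of_trivial]; exact hM)
  refine ⟨hs.eigenvectorBasis finrank_euclideanSpace_fin,
    hs.eigenvalues finrank_euclideanSpace_fin, (hs.eigenvectorBasis _).orthonormal,
    fun x y => ?_, fun l y => ?_, hs.eigenvalues_antitone _⟩
  · rw [bil_vec, bil_vec, real_inner_comm]
    exact hs y x
  · rw [bil_vec]
    have := hs.apply_eigenvectorBasis finrank_euclideanSpace_fin l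
    change inner ℝ y (Matrix.toEuclideanLin M _) = _
    rw [this, inner_smul_right]
    rfl

/-- The normalization `n` is independent of the number `m` of rows, because a sketch with `t` rows
is also divided by `n`. -/
lemma exists_sortedEig_nGram (n : ℕ) (A : Matrix (Fin m) (Fin d) ℝ) :
    ∃ b, SortedEig (nGram n A) b fun l => sval A l ^ 2 / n := by
  set T := Matrix.toEuclideanLin A with hT
  have hs := T.isSymmetric_adjoint_comp_self
  refine ⟨hs.eigenvectorBasis finrank_euclideanSpace_fin,
    (hs.eigenvectorBasis _).orthonormal, fun x y => ?_, fun l y => ?_, fun i j hij => ?_⟩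
  · rw [bil_nGram, bil_nGram, real_inner_comm]
  · rw [bil_nGram]
    have h1 := hs.apply_eigenvectorBasis finrank_euclideanSpace_fin l
    have h2 : inner ℝ (act A y) (act A (hs.eigenvectorBasis finrank_euclideanSpace_fin l)) =
        inner ℝ y ((LinearMap.adjoint T ∘ₗ T)
          (hs.eigenvectorBasis finrank_euclideanSpace_fin l)) := by
      rw [LinearMap.comp_apply, LinearMap.adjoint_inner_right]
      rfl
    rw [h2, h1, inner_smul_right, sval, ← hT,
      T.sq_singularValues_fin finrank_euclideanSpace_fin l]
    simp only [RCLike.ofReal_real_eq_id, id_eq]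
    ring
  · have h := T.singularValues_antitone (show (i : ℕ) ≤ j from hij)
    change sval A j ^ 2 / n ≤ sval A i ^ 2 / n
    have := sval_nonneg A j
    gcongr
    exact h

lemma bil_nGram_of_eigen (n : ℕ) (A : Matrix (Fin m) (Fin d) ℝ) {v : EuclideanSpace ℝ (Fin d)}
    {j : ℕ} (h : act (Aᵀ * A) v = sval A j ^ 2 • v) (y : EuclideanSpace ℝ (Fin d)) :
    bil (nGram n A) y v = sval A j ^ 2 / n * inner ℝ y v := by
  rw [bil_nGram, inner_act_act, h, inner_smul_right]
  ring

lemma IsTopSVD.eigen {k : ℕ} {A : Matrix (Fin m) (Fin d) ℝ}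
    {u : Fin k → EuclideanSpace ℝ (Fin m)} {v : Fin k → EuclideanSpace ℝ (Fin d)}
    (h : IsTopSVD A u v) (j : Fin k) : act (Aᵀ * A) (v j) = sval A j ^ 2 • v j := by
  have h1 := h.map_right j
  have h2 := h.map_left j
  have h3 : act (Aᵀ * A) (v j) = act Aᵀ (act A (v j)) := by
    simp [act, Matrix.mulVec_mulVec]
  rw [h3, h1]
  have h4 : act Aᵀ (sval A j • u j) = sval A j • act Aᵀ (u j) := by
    simp [act, Matrix.mulVec_smul]
  rw [h4, h2, smul_smul, sq]

/-- No vector has to be nonzero: if one vanishes, the conventions for `normalize` and for division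
by zero make both sides `1`. -/
lemma sinDist_normalize {E : ℕ} (x y : EuclideanSpace ℝ (Fin E)) :
    sinDist (NormedSpace.normalize x) (NormedSpace.normalize y) =
      √(1 - (inner ℝ x y) ^ 2 / (inner ℝ x x * inner ℝ y y)) := by
  rw [sinDist, NormedSpace.normalize, NormedSpace.normalize, real_inner_smul_left,
    real_inner_smul_right, real_inner_self_eq_norm_sq, real_inner_self_eq_norm_sq]
  congr 2
  simp only [mul_pow, inv_pow]
  rw [div_eq_mul_inv, mul_inv]
  ring

/-- This removes the growing space of left singular vectors: their error depends only on the `d × d`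
Gram matrix and on right singular vectors. -/
lemma sinDist_normalize_act {n : ℕ} (hn : 0 < n) (A : Matrix (Fin m) (Fin d) ℝ)
    (w v : EuclideanSpace ℝ (Fin d)) :
    sinDist (NormedSpace.normalize (act A w)) (NormedSpace.normalize (act A v)) =
      sinForm (nGram n A) w v := by
  have hn' : (n : ℝ) ≠ 0 := Nat.cast_ne_zero.2 hn.ne'
  rw [sinDist_normalize, sinForm, bil_nGram, bil_nGram, bil_nGram]
  congr 2
  rw [mul_pow, show 1 / (n : ℝ) * inner ℝ (act A w) (act A w) *
    (1 / (n : ℝ) * inner ℝ (act A v) (act A v)) = (1 / (n : ℝ)) ^ 2 *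
      (inner ℝ (act A w) (act A w) * inner ℝ (act A v) (act A v)) by ring,
    mul_div_mul_left _ _ (by positivity)]

lemma IsTopSVD.eq_normalize {k : ℕ} {A : Matrix (Fin m) (Fin d) ℝ}
    {u : Fin k → EuclideanSpace ℝ (Fin m)} {v : Fin k → EuclideanSpace ℝ (Fin d)}
    (h : IsTopSVD A u v) (j : Fin k) (hpos : 0 < sval A j) :
    u j = NormedSpace.normalize (act A (v j)) := by
  rw [h.map_right j, NormedSpace.normalize, norm_smul, h.left_orthonormal.1 j, mul_one,
    Real.norm_of_nonneg hpos.le, smul_smul]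
  simp [hpos.ne']

/-- Scaled differences of singular values in terms of the eigenvalues of the Gram matrices. -/
lemma abs_sval_sub {n : ℕ} {m' : ℕ} (A : Matrix (Fin m) (Fin d) ℝ)
    (A' : Matrix (Fin m') (Fin d) ℝ) (j : ℕ) :
    |√(sval A' j ^ 2 / n) - √(sval A j ^ 2 / n)| = |sval A' j - sval A j| / √n := by
  rw [Real.sqrt_div (sq_nonneg _), Real.sqrt_div (sq_nonneg _), Real.sqrt_sq (sval_nonneg _ _),
    Real.sqrt_sq (sval_nonneg _ _), ← sub_div, abs_div, abs_of_nonneg (Real.sqrt_nonneg _)]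

end Gram

/-! ### Properties of the limits -/

/-- The matrix `x yᵀ`. -/
def rankOne {d : ℕ} (x y : EuclideanSpace ℝ (Fin d)) : MatSpace d :=
  WithLp.toLp 2 fun q => x q.1 * y q.2

lemma inner_rankOne {d : ℕ} (x y : EuclideanSpace ℝ (Fin d)) (z : MatSpace d) :
    inner ℝ (rankOne x y) z = bil z x y := by
  simp [rankOne, bil, PiLp.inner_apply]

section Limits

variable {d : ℕ} {g : Fin d → EuclideanSpace ℝ (Fin d)} {lam : Fin d → ℝ} {j : Fin d}

lemma limSigma_smul {c : ℝ} (hc : 0 < c) (z : MatSpace d) :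
    limSigma g lam j (c • z) = c * limSigma g lam j z := by
  rw [limSigma, limSigma, bil_smul, abs_mul, abs_of_pos hc, mul_div_assoc]

lemma limV_smul {c : ℝ} (hc : 0 < c) (z : MatSpace d) :
    limV g lam j (c • z) = c * limV g lam j z := by
  have h : ∑ l ∈ Finset.univ.erase j, (bil (c • z) (g j) (g l) / (lam j - lam l)) ^ 2 =
      c ^ 2 * ∑ l ∈ Finset.univ.erase j, (bil z (g j) (g l) / (lam j - lam l)) ^ 2 := by
    rw [Finset.mul_sum]
    exact Finset.sum_congr rfl fun l _ => by rw [bil_smul]; ring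
  rw [limV, limV, h, Real.sqrt_mul (sq_nonneg c), Real.sqrt_sq hc.le]

lemma limU_smul {c : ℝ} (hc : 0 < c) (z : MatSpace d) :
    limU g lam j (c • z) = c * limU g lam j z := by
  have h : ∑ l ∈ Finset.univ.erase j, lam l * (bil (c • z) (g j) (g l) / (lam j - lam l)) ^ 2 =
      c ^ 2 * ∑ l ∈ Finset.univ.erase j, lam l * (bil z (g j) (g l) / (lam j - lam l)) ^ 2 := by
    rw [Finset.mul_sum]
    exact Finset.sum_congr rfl fun l _ => by rw [bil_smul]; ring
  rw [limU, limU, h, mul_div_assoc, Real.sqrt_mul (sq_nonneg c), Real.sqrt_sq hc.le]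

lemma limSigma_nonneg (z : MatSpace d) : 0 ≤ limSigma g lam j z := by
  unfold limSigma; positivity

/-- This and the next two lemmas put the zero set of each limit into the kernel of a linear form,
which excludes an atom at zero. -/
lemma bil_eq_zero_of_limSigma (hpos : 0 < lam j) {z : MatSpace d} (h : limSigma g lam j z = 0) :
    bil z (g j) (g j) = 0 := by
  have hs := Real.sqrt_pos.2 hpos
  rw [limSigma, div_eq_zero_iff] at h
  rcases h with h | h
  · exact abs_eq_zero.1 h
  · exact absurd h (by positivity)

lemma bil_eq_zero_of_limV {l : Fin d} (hl : l ≠ j) (hne : lam j ≠ lam l) {z : MatSpace d}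
    (h : limV g lam j z = 0) : bil z (g j) (g l) = 0 := by
  rw [limV, Real.sqrt_eq_zero (Finset.sum_nonneg fun _ _ => sq_nonneg _),
    Finset.sum_eq_zero_iff_of_nonneg fun _ _ => sq_nonneg _] at h
  have h1 := h l (Finset.mem_erase.2 ⟨hl, Finset.mem_univ _⟩)
  rw [sq_eq_zero_iff, div_eq_zero_iff] at h1
  exact h1.resolve_right (sub_ne_zero.2 hne)

lemma bil_eq_zero_of_limU (hpos : ∀ i, 0 < lam i) {l : Fin d} (hl : l ≠ j) (hne : lam j ≠ lam l)
    {z : MatSpace d} (h : limU g lam j z = 0) : bil z (g j) (g l) = 0 := by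
  have hnn : ∀ i ∈ Finset.univ.erase j,
      0 ≤ lam i * (bil z (g j) (g i) / (lam j - lam i)) ^ 2 :=
    fun i _ => mul_nonneg (hpos i).le (sq_nonneg _)
  rw [limU, Real.sqrt_eq_zero (div_nonneg (Finset.sum_nonneg hnn) (hpos j).le),
    div_eq_zero_iff, or_iff_left (hpos j).ne', Finset.sum_eq_zero_iff_of_nonneg hnn] at h
  have h1 := h l (Finset.mem_erase.2 ⟨hl, Finset.mem_univ _⟩)
  rw [mul_eq_zero, or_iff_right (hpos l).ne', sq_eq_zero_iff, div_eq_zero_iff] at h1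
  exact h1.resolve_right (sub_ne_zero.2 hne)

end Limits

/-! ### Maxima over an index set -/

lemma abs_mul_sup'_sub_sup'_le {κ : Type*} {J : Finset κ} (hJ : J.Nonempty) {f h : κ → ℝ}
    {c ε : ℝ} (hc : 0 ≤ c) (hfh : ∀ j ∈ J, |c * f j - h j| ≤ ε) :
    |c * J.sup' hJ f - J.sup' hJ h| ≤ ε := by
  rw [abs_sub_le_iff]
  constructor
  · obtain ⟨j, hj, e⟩ := Finset.exists_mem_eq_sup' hJ f
    have h1 := Finset.le_sup' h hj
    have h2 := (abs_sub_le_iff.1 (hfh j hj)).1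
    rw [e]
    linarith
  · obtain ⟨j, hj, e⟩ := Finset.exists_mem_eq_sup' hJ h
    have h1 := mul_le_mul_of_nonneg_left (Finset.le_sup' f hj) hc
    have h2 := (abs_sub_le_iff.1 (hfh j hj)).2
    rw [e]
    linarith

/-- A maximum of homogeneous functions has no atoms under a centered Gaussian measure. -/
lemma multivariateGaussian_sup'_level_eq_zero {ι : Type*} [Fintype ι] [DecidableEq ι]
    {S : Matrix ι ι ℝ} (hS : S.PosSemidef) {κ : Type*} {J : Finset κ} (hJ : J.Nonempty)
    {h : κ → EuclideanSpace ℝ ι → ℝ} (hcont : ∀ j, Continuous (h j))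
    (hhom : ∀ j, ∀ c : ℝ, 0 < c → ∀ z, h j (c • z) = c * h j z) (hnn : ∀ j z, 0 ≤ h j z)
    {C : EuclideanSpace ℝ ι} (hC : 0 < C.ofLp ⬝ᵥ S *ᵥ C.ofLp) {j₀ : κ} (hj₀ : j₀ ∈ J)
    (hzero : ∀ z, h j₀ z = 0 → inner ℝ C z = 0) (x : ℝ) :
    multivariateGaussian 0 S {z | J.sup' hJ (fun j => h j z) = x} = 0 := by
  refine multivariateGaussian_level_eq_zero hS
    (Continuous.finset_sup'_apply hJ fun j _ => hcont j) (fun c hc z => ?_) (fun z => ?_) hC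
    (fun z hz => hzero z (le_antisymm ?_ (hnn _ _))) x
  -- The case `ε = 0` of the estimate for maxima is the homogeneity of the maximum.
  · have := abs_mul_sup'_sub_sup'_le hJ (f := fun j => h j z) (h := fun j => h j (c • z)) (ε := 0)
      hc.le (fun j _ => by rw [hhom j c hc]; simp)
    linarith [abs_nonpos_iff.1 this]
  · exact (hnn j₀ z).trans (Finset.le_sup' (fun j => h j z) hj₀)
  · exact (Finset.le_sup' (fun j => h j z) hj₀).trans hz.le

/-! ### Rescaled errors of singular values and vectors -/

/-- Perturbation with step `s = 1 / √t` and direction `√t` times the difference of the Gram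
matrices. It serves for the pair data and sketch and for the pair sketch and resampled sketch.
Singular values carry the factor `√t / √n`, the eigenvalues being `σ ^ 2 / n`. -/
lemma exists_error_radius {d k : ℕ} (hkd : k ≤ d) {m : MatSpace d}
    {g : Fin d → EuclideanSpace ℝ (Fin d)} {lam : Fin d → ℝ} (hg : SortedEig m g lam)
    (hlam : StrictAnti lam) (hpos : ∀ l, 0 < lam l) (R : ℝ) {ε : ℝ} (hε : 0 < ε) :
    ∃ δ > 0, ∀ (n t p p' : ℕ) (A : Matrix (Fin p) (Fin d) ℝ) (A' : Matrix (Fin p') (Fin d) ℝ)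
      (v w : Fin k → EuclideanSpace ℝ (Fin d)), 0 < n → δ⁻¹ ≤ √t → ‖nGram n A - m‖ ≤ δ →
      ‖√(t : ℝ) • (nGram n A' - nGram n A)‖ ≤ R → IsTopRightSingular A v →
      IsTopRightSingular A' w → ∀ j : Fin k,
      |√t * sinForm (nGram n A) (w j) (v j) -
        limU g lam (Fin.castLE hkd j) (√(t : ℝ) • (nGram n A' - nGram n A))| ≤ ε ∧
      |√t / √n * |sval A' j - sval A j| -
        limSigma g lam (Fin.castLE hkd j) (√(t : ℝ) • (nGram n A' - nGram n A))| ≤ ε ∧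
      |√t * sinDist (w j) (v j) -
        limV g lam (Fin.castLE hkd j) (√(t : ℝ) • (nGram n A' - nGram n A))| ≤ ε ∧
      0 < sval A j := by
  obtain ⟨δ, hδ, hpert⟩ := exists_perturbation_radius hg hlam hpos R hε
  refine ⟨δ, hδ, fun n t p p' A A' v w hn ht hA hR hv hw j => ?_⟩
  have hs : 0 < √(t : ℝ) := (inv_pos.2 hδ).trans_le ht
  obtain ⟨b, hb⟩ := exists_sortedEig_nGram n A
  obtain ⟨b', hb'⟩ := exists_sortedEig_nGram n A'
  have hsum : nGram n A + (√(t : ℝ))⁻¹ • √(t : ℝ) • (nGram n A' - nGram n A) = nGram n A' := by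
    rw [inv_smul_smul₀ hs.ne']
    abel
  obtain ⟨h1, h2, h3, h4⟩ := hpert (nGram n A) (√(t : ℝ) • (nGram n A' - nGram n A)) (√(t : ℝ))⁻¹
    b b' _ _ hA hR (inv_pos.2 hs) (inv_le_of_inv_le₀ hδ ht) hb (by rwa [hsum])
    (Fin.castLE hkd j) (v j) (w j)
    (hv.orthonormal.1 j) (bil_nGram_of_eigen n A (hv.eigen j)) (hw.orthonormal.1 j)
    (by rw [hsum]; exact bil_nGram_of_eigen n A' (hw.eigen j))
  rw [div_inv_eq_mul, mul_comm] at h1 h3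
  refine ⟨h1, ?_, h3, ?_⟩
  · rw [abs_sval_sub, div_inv_eq_mul] at h2
    convert h2 using 3
    simp only [Fin.val_castLE]
    ring
  · have hn' : (0 : ℝ) < n := Nat.cast_pos.2 hn
    have h5 : 0 < sval A j ^ 2 := by
      by_contra hcon
      have := (div_pos_iff_of_pos_right hn').1 h4
      exact hcon this
    exact lt_of_le_of_ne (sval_nonneg A j) fun e => by rw [← e] at h5; simp at h5

/-! ### The sample of the rows of the sketch -/

/-- The matrix `r rᵀ`. -/
def outer {d : ℕ} (r : Fin d → ℝ) : MatSpace d :=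
  WithLp.toLp 2 fun q => r q.1 * r q.2

/-- The matrices `r rᵀ` for the rows `r` of the rescaled sketch. -/
def rowSample {t p d : ℕ} (n : ℕ) (S : Matrix (Fin t) (Fin p) ℝ) (A : Matrix (Fin p) (Fin d) ℝ) :
    Fin t → MatSpace d :=
  fun i => outer (((√(t : ℝ) / √(n : ℝ)) • (S * A)) i)

lemma normSum_eq {ι : Type*} [Fintype ι] {t : ℕ} [NeZero t] (m : EuclideanSpace ℝ ι)
    (x : Fin t → EuclideanSpace ℝ ι) :
    normSum t m x = √(t : ℝ) • ((t : ℝ)⁻¹ • ∑ i, x i - m) := by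
  have hpos : (0 : ℝ) < t := Nat.cast_pos.2 (Nat.pos_of_ne_zero (NeZero.ne t))
  have hs : 0 < √(t : ℝ) := Real.sqrt_pos.2 hpos
  have h1 : √(t : ℝ) * (t : ℝ)⁻¹ = (√(t : ℝ))⁻¹ := by
    conv_lhs => rw [← Real.sq_sqrt hpos.le, Real.sqrt_sq hs.le]
    field_simp
  have h2 : (√(t : ℝ))⁻¹ * t = √(t : ℝ) := by
    conv_lhs => rw [← Real.sq_sqrt hpos.le, Real.sqrt_sq hs.le]
    field_simp
  rw [normSum, Finset.sum_sub_distrib, smul_sub, smul_sub, smul_smul, h1]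
  simp only [Finset.sum_const, Finset.card_univ, Fintype.card_fin]
  rw [← Nat.cast_smul_eq_nsmul ℝ, smul_smul, h2]

/-- Gram matrices of sketches are sample means of the `r rᵀ`, so that `normSum` is the direction of
perturbation. `K` is a bootstrap draw, or the identity for the sketch itself. -/
lemma mean_rowSample {t p d n : ℕ} [NeZero t] (S : Matrix (Fin t) (Fin p) ℝ)
    (A : Matrix (Fin p) (Fin d) ℝ) (K : Fin t → Fin t) :
    (t : ℝ)⁻¹ • ∑ i, rowSample n S A (K i) = nGram n (resample (S * A) K) := by
  have hpos : (0 : ℝ) < t := Nat.cast_pos.2 (Nat.pos_of_ne_zero (NeZero.ne t))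
  have hc : (√(t : ℝ) / √(n : ℝ)) ^ 2 = t / n := by
    rw [div_pow, Real.sq_sqrt hpos.le, Real.sq_sqrt (Nat.cast_nonneg n)]
  ext q
  simp only [rowSample, outer, nGram, vec, resample, PiLp.smul_apply, WithLp.ofLp_sum,
    Finset.sum_apply, smul_eq_mul, Matrix.smul_apply, Matrix.mul_apply (M := (submatrix _ _ _)ᵀ),
    Matrix.transpose_apply, Matrix.submatrix_apply, id_eq]
  have : ∀ i, √(t : ℝ) / √(n : ℝ) * (S * A) (K i) q.1 * (√(t : ℝ) / √(n : ℝ) * (S * A) (K i) q.2) =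
      t / n * ((S * A) (K i) q.1 * (S * A) (K i) q.2) := fun i => by rw [← hc]; ring
  simp only [this, ← Finset.mul_sum]
  field_simp

lemma mean_rowSample_id {t p d n : ℕ} [NeZero t] (S : Matrix (Fin t) (Fin p) ℝ)
    (A : Matrix (Fin p) (Fin d) ℝ) :
    (t : ℝ)⁻¹ • ∑ i, rowSample n S A i = nGram n (S * A) :=
  mean_rowSample S A id

lemma measurable_rowSample {t p d n : ℕ} (A : Matrix (Fin p) (Fin d) ℝ) :
    Measurable fun s : Fin t → Fin p → ℝ => rowSample n (Matrix.of s) A := by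
  refine measurable_pi_iff.2 fun i => ?_
  refine (WithLp.measurable_toLp 2 _).comp (measurable_pi_iff.2 fun q => ?_)
  simp only [smul_eq_mul, Matrix.mul_apply, Matrix.of_apply, Matrix.smul_apply]
  fun_prop

/-! ### Coverage for sketches whose rows satisfy the moment conditions -/

namespace SampleModel

variable {Ω : ℕ → Type*} [∀ n, MeasurableSpace (Ω n)] {P : ∀ n, Measure (Ω n)}
  [∀ n, IsProbabilityMeasure (P n)] {t : ℕ → ℕ} [∀ n, NeZero (t n)]

lemma tendsto_integral_inner_sub_sq {ι : Type*} [Fintype ι]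
    {Y : ∀ n, Ω n → Fin (t n) → EuclideanSpace ℝ ι} {μ : ℕ → Measure (EuclideanSpace ℝ ι)}
    {m : ι → ℝ} {Q : ι → ι → ℝ} (h : SampleModel P t Y μ m Q) (x : EuclideanSpace ℝ ι) :
    Tendsto (fun n => ∫ y, (inner ℝ (y - meanVec (μ n)) x) ^ 2 ∂(μ n)) atTop
      (𝓝 (x.ofLp ⬝ᵥ (Matrix.of fun a b => Q a b - m a * m b) *ᵥ x.ofLp)) := by
  have e : x.ofLp ⬝ᵥ (Matrix.of fun a b => Q a b - m a * m b) *ᵥ x.ofLp =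
      ∑ a, ∑ b, x a * x b * (Q a b - m a * m b) := by
    simp only [dotProduct, Matrix.mulVec, Finset.mul_sum, Matrix.of_apply]
    exact Finset.sum_congr rfl fun _ _ => Finset.sum_congr rfl fun _ _ => by ring
  rw [e]
  have hlim : Tendsto (fun n => ∑ a, ∑ b, x a * x b *
      (∫ y, y a * y b ∂(μ n) - (∫ y, y a ∂(μ n)) * ∫ y, y b ∂(μ n))) atTop
      (𝓝 (∑ a, ∑ b, x a * x b * (Q a b - m a * m b))) :=
    tendsto_finsetSum _ fun a _ => tendsto_finsetSum _ fun b _ =>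
      ((h.second a b).sub ((h.first a).mul (h.first b))).const_mul _
  refine hlim.congr' ?_
  filter_upwards [h.memLp, h.eventually_prob] with n h1 h2
  exact (integral_inner_sub_sq (h1.mono_exponent (by norm_num)) x).symm

/-- The quadratic form of the limiting covariance is a limit of variances of linear forms. -/
lemma posSemidef {ι : Type*} [Fintype ι]
    {Y : ∀ n, Ω n → Fin (t n) → EuclideanSpace ℝ ι} {μ : ℕ → Measure (EuclideanSpace ℝ ι)}
    {m : ι → ℝ} {Q : ι → ι → ℝ} (h : SampleModel P t Y μ m Q) :
    (Matrix.of fun a b => Q a b - m a * m b).PosSemidef := by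
  refine Matrix.PosSemidef.of_dotProduct_mulVec_nonneg ?_ fun x => ?_
  · ext a b
    have hQ : Q b a = Q a b :=
      tendsto_nhds_unique (h.second b a) (by simpa only [mul_comm] using h.second a b)
    simp [hQ, mul_comm]
  · rw [star_trivial]
    exact ge_of_tendsto' (h.tendsto_integral_inner_sub_sq (WithLp.toLp 2 x)) fun n =>
      integral_nonneg fun y => sq_nonneg _

variable {d k : ℕ} {A : ∀ n : ℕ, Matrix (Fin n) (Fin d) ℝ}
  {S : ∀ n, Ω n → Matrix (Fin (t n)) (Fin n) ℝ}
  {μ : ℕ → Measure (MatSpace d)} {m : MatSpace d} {Q : Fin d × Fin d → Fin d × Fin d → ℝ}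
  {B : ℕ → ℕ} {I : ∀ n, Ω n → Fin (B n) → Fin (t n) → Fin (t n)}

lemma tendsto_measureReal_not_nGram
    (h : SampleModel P t (fun n ω => rowSample n (S n ω) (A n)) μ m.ofLp Q)
    (ht : Tendsto t atTop atTop) {δ : ℝ} (hδ : 0 < δ) :
    Tendsto (fun n => (P n).real {ω | ¬ ‖nGram n (S n ω * A n) - m‖ ≤ δ}) atTop (𝓝 0) := by
  set N : ℝ := ((Fintype.card (Fin d × Fin d) : ℕ) : ℝ) with hN
  have hN0 : 0 ≤ N := Nat.cast_nonneg _
  -- The norm is at most `N` times a bound for the coordinates; `N + 1` keeps the quotient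
  -- meaningful for `N = 0`.
  have hη : 0 < δ / (N + 1) := by positivity
  refine squeeze_zero (fun _ => measureReal_nonneg) (fun n => measureReal_mono fun ω hω => ?_)
    (h.tendsto_measureReal_not_good ht hη)
  intro hgood
  refine hω ?_
  have h1 := norm_le_of_abs_coord_le (nGram n (S n ω * A n) - m) (δ := δ / (N + 1)) fun a => by
    have h2 := hgood.first a
    rwa [← mean_rowSample_id (n := n) (S n ω) (A n), ← meanVec_empLaw]
  refine h1.trans ?_
  rw [← hN, mul_div_assoc', div_le_iff₀ (by positivity)]
  nlinarith

/-- Coverage for maxima of errors whose limits are continuous homogeneous functions. -/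
lemma tendsto_measureReal_le_quantile
    (h : SampleModel P t (fun n ω => rowSample n (S n ω) (A n)) μ m.ofLp Q)
    (hmean : ∀ᶠ n in atTop, meanVec (μ n) = nGram n (A n))
    (ht : Tendsto t atTop atTop) (hB : Tendsto B atTop atTop) {α : ℝ}
    (hα : α ∈ Set.Ioo (0 : ℝ) 1)
    (hI : ∀ n, IsBootstrapSampling (P n) (S n) (I n))
    {J : Finset (Fin k)} (hJ : J.Nonempty) {lim : Fin k → MatSpace d → ℝ}
    (hcont : ∀ j, Continuous (lim j))
    (hhom : ∀ j, ∀ c : ℝ, 0 < c → ∀ z, lim j (c • z) = c * lim j z) (hnn : ∀ j z, 0 ≤ lim j z)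
    {C : MatSpace d}
    (hC : 0 < C.ofLp ⬝ᵥ (Matrix.of fun a b => Q a b - m a * m b) *ᵥ C.ofLp) {j₀ : Fin k}
    (hj₀ : j₀ ∈ J) (hzero : ∀ z, lim j₀ z = 0 → inner ℝ C z = 0)
    {c : ℕ → ℝ} (hc : ∀ᶠ n in atTop, 0 < c n)
    {e : ∀ n, Ω n → Fin k → ℝ} {es : ∀ n, Ω n → Fin (B n) → Fin k → ℝ}
    (he : ∀ ε > 0, ∀ R : ℝ, ∀ᶠ n in atTop, ∀ ω,
      ‖√(t n : ℝ) • (nGram n (S n ω * A n) - nGram n (A n))‖ ≤ R → ∀ j,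
      |c n * e n ω j - lim j (√(t n : ℝ) • (nGram n (S n ω * A n) - nGram n (A n)))| ≤ ε)
    (hes : ∀ ε > 0, ∀ R : ℝ, ∃ δ > 0, ∀ᶠ n in atTop, ∀ ω, ‖nGram n (S n ω * A n) - m‖ ≤ δ → ∀ b,
      ‖√(t n : ℝ) • (nGram n (resample (S n ω * A n) (I n ω b)) - nGram n (S n ω * A n))‖ ≤ R →
      ∀ j, |c n * es n ω b j - lim j (√(t n : ℝ) •
        (nGram n (resample (S n ω * A n) (I n ω b)) - nGram n (S n ω * A n)))| ≤ ε) :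
    Tendsto (fun n => (P n).real {ω | J.sup' hJ (e n ω) ≤
      quantile (fun b => J.sup' hJ (es n ω b)) (1 - α)}) atTop (𝓝 (1 - α)) := by
  have hpsd := h.posSemidef
  refine tendsto_coverage (E := MatSpace d)
    (γ := multivariateGaussian 0 (Matrix.of fun a b => Q a b - m a * m b))
    (g := fun z => J.sup' hJ fun j => lim j z) hB hα
    (Continuous.finset_sup'_apply hJ fun j _ => hcont j)
    (multivariateGaussian_sup'_level_eq_zero hpsd hJ hcont hhom hnn hC hj₀ hzero) hc
    (X := fun n ω => normSum (t n) (meanVec (μ n)) (rowSample n (S n ω) (A n)))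
    (Xs := fun n ω b => normSum (t n) (meanVec (empLaw (rowSample n (S n ω) (A n))))
      fun i => rowSample n (S n ω) (A n) (I n ω b i)) ?_ ?_ ?_ ?_
  · intro ε hε R
    filter_upwards [he ε hε R, hmean, hc] with n h1 h2 h3 ω hω
    rw [normSum_eq, mean_rowSample_id, h2] at hω ⊢
    exact abs_mul_sup'_sub_sup'_le hJ h3.le fun j _ => h1 ω hω j
  · intro ε hε R
    obtain ⟨δ, hδ, h1⟩ := hes ε hε R
    refine ⟨_, h.tendsto_measureReal_not_nGram ht hδ, ?_⟩
    filter_upwards [h1, hc] with n h1 h3 ω hω b hb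
    rw [normSum_eq, mean_rowSample, meanVec_empLaw, mean_rowSample_id] at hb ⊢
    have h4 : ‖nGram n (S n ω * A n) - m‖ ≤ δ := not_not.1 hω
    exact abs_mul_sup'_sub_sup'_le hJ h3.le fun j _ => h1 ω h4 b hb j
  · exact fun D hD ε hε => h.eventually_measureReal_normSum_le ht hpsd hD hε
  · refine fun D hD ε hε => h.tendsto_measureReal_le_freq ht hpsd hB (fun n => (hI n).indep)
      (fun n => (hI n).law) (Eventually.of_forall fun n => ?_) hD hε
    exact (hI n).indep_sketch.comp (measurable_rowSample (n := n) (A n)) measurable_id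

/-- Coverage of the three bootstrap quantiles. -/
theorem tendsto_coverage_errors
    (h : SampleModel P t (fun n ω => rowSample n (S n ω) (A n)) μ m.ofLp Q)
    (hmean : ∀ᶠ n in atTop, meanVec (μ n) = nGram n (A n))
    (hgram : Tendsto (fun n => nGram n (A n)) atTop (𝓝 m))
    (ht : Tendsto t atTop atTop) (hB : Tendsto B atTop atTop) {α : ℝ}
    (hα : α ∈ Set.Ioo (0 : ℝ) 1)
    (hI : ∀ n, IsBootstrapSampling (P n) (S n) (I n)) (hkd : k ≤ d)
    {J : Finset (Fin k)} (hJ : J.Nonempty)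
    {g : Fin d → EuclideanSpace ℝ (Fin d)} {lam : Fin d → ℝ} (hg : SortedEig m g lam)
    (hlam : StrictAnti lam) (hpos : ∀ l, 0 < lam l) {j₀ : Fin k} (hj₀ : j₀ ∈ J) {l : Fin d}
    (hl : l ≠ Fin.castLE hkd j₀)
    (hC₁ : 0 < (rankOne (g (Fin.castLE hkd j₀)) (g (Fin.castLE hkd j₀))).ofLp ⬝ᵥ
      (Matrix.of fun a b => Q a b - m a * m b) *ᵥ
      (rankOne (g (Fin.castLE hkd j₀)) (g (Fin.castLE hkd j₀))).ofLp)
    (hC₂ : 0 < (rankOne (g (Fin.castLE hkd j₀)) (g l)).ofLp ⬝ᵥ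
      (Matrix.of fun a b => Q a b - m a * m b) *ᵥ
      (rankOne (g (Fin.castLE hkd j₀)) (g l)).ofLp)
    {u : ∀ n : ℕ, Fin k → EuclideanSpace ℝ (Fin n)} {v : ℕ → Fin k → EuclideanSpace ℝ (Fin d)}
    (huv : ∀ n, d ≤ n → IsTopSVD (A n) (u n) (v n))
    {vt : ∀ n, Ω n → Fin k → EuclideanSpace ℝ (Fin d)}
    (hvt : ∀ n ω, IsTopRightSingular (S n ω * A n) (vt n ω))
    {vs : ∀ n, Ω n → Fin (B n) → Fin k → EuclideanSpace ℝ (Fin d)}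
    (hvs : ∀ n ω b, IsTopRightSingular (resample (S n ω * A n) (I n ω b)) (vs n ω b)) :
    Tendsto (fun n => (P n).real {ω | errU J hJ (A n) (vt n ω) (u n) ≤
      quantile (fun b => bootErrU J hJ (S n ω * A n) (vs n ω b) (vt n ω)) (1 - α)})
      atTop (𝓝 (1 - α)) ∧
    Tendsto (fun n => (P n).real {ω | errSigma J hJ (S n ω * A n) (A n) ≤
      quantile (fun b => errSigma J hJ (resample (S n ω * A n) (I n ω b)) (S n ω * A n)) (1 - α)})
      atTop (𝓝 (1 - α)) ∧
    Tendsto (fun n => (P n).real {ω | errV J hJ (vt n ω) (v n) ≤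
      quantile (fun b => errV J hJ (vs n ω b) (vt n ω)) (1 - α)})
      atTop (𝓝 (1 - α)) := by
  have hsq : Tendsto (fun n => √(t n : ℝ)) atTop atTop :=
    Real.tendsto_sqrt_atTop.comp (tendsto_natCast_atTop_atTop.comp ht)
  have hne : lam (Fin.castLE hkd j₀) ≠ lam l := fun e => hl (hlam.injective e).symm
  have hc₁ : ∀ᶠ n in atTop, 0 < √(t n : ℝ) := hsq.eventually_gt_atTop 0
  have hc₂ : ∀ᶠ n : ℕ in atTop, 0 < √(t n : ℝ) / √(n : ℝ) := by
    filter_upwards [hc₁, eventually_gt_atTop 0] with n h1 h2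
    have : (0 : ℝ) < n := Nat.cast_pos.2 h2
    positivity
  -- Here the base point is deterministic and converges to `m`, so it is eventually within the
  -- radius for every `ω`. For the replicates in `hboot`, closeness of the sketch to `m` remains a
  -- condition on `ω`.
  have hdata : ∀ ε > 0, ∀ R : ℝ, ∀ᶠ n in atTop, ∀ ω,
      ‖√(t n : ℝ) • (nGram n (S n ω * A n) - nGram n (A n))‖ ≤ R → ∀ j,
      (|√(t n : ℝ) * sinDist (NormedSpace.normalize (act (A n) (vt n ω j))) (u n j) -
        limU g lam (Fin.castLE hkd j)
          (√(t n : ℝ) • (nGram n (S n ω * A n) - nGram n (A n)))| ≤ ε) ∧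
      (|√(t n : ℝ) / √(n : ℝ) * |sval (S n ω * A n) j - sval (A n) j| -
        limSigma g lam (Fin.castLE hkd j)
          (√(t n : ℝ) • (nGram n (S n ω * A n) - nGram n (A n)))| ≤ ε) ∧
      |√(t n : ℝ) * sinDist (vt n ω j) (v n j) -
        limV g lam (Fin.castLE hkd j)
          (√(t n : ℝ) • (nGram n (S n ω * A n) - nGram n (A n)))| ≤ ε := by
    intro ε hε R
    obtain ⟨δ, hδ, hrad⟩ := exists_error_radius hkd hg hlam hpos R hε
    filter_upwards [hsq.eventually_ge_atTop δ⁻¹, eventually_gt_atTop 0, eventually_ge_atTop d,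
      hgram.eventually (Metric.closedBall_mem_nhds m hδ)] with n h1 h2 h3 h4 ω hω j
    obtain ⟨e1, e2, e3, e4⟩ := hrad n (t n) n (t n) (A n) (S n ω * A n) (v n) (vt n ω) h2 h1
      (mem_closedBall_iff_norm.1 h4) hω ⟨(huv n h3).right_orthonormal, (huv n h3).eigen⟩
      (hvt n ω) j
    -- The singular value is positive, so the exact `u_j` is itself a normalized image under `A n`.
    rw [(huv n h3).eq_normalize j e4, sinDist_normalize_act h2]
    exact ⟨e1, e2, e3⟩
  have hboot : ∀ ε > 0, ∀ R : ℝ, ∃ δ > 0, ∀ᶠ n in atTop, ∀ ω,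
      ‖nGram n (S n ω * A n) - m‖ ≤ δ → ∀ b,
      ‖√(t n : ℝ) • (nGram n (resample (S n ω * A n) (I n ω b)) - nGram n (S n ω * A n))‖ ≤ R →
      ∀ j,
      (|√(t n : ℝ) * sinDist (NormedSpace.normalize (act (S n ω * A n) (vs n ω b j)))
          (NormedSpace.normalize (act (S n ω * A n) (vt n ω j))) -
        limU g lam (Fin.castLE hkd j) (√(t n : ℝ) •
          (nGram n (resample (S n ω * A n) (I n ω b)) - nGram n (S n ω * A n)))| ≤ ε) ∧
      (|√(t n : ℝ) / √(n : ℝ) *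
          |sval (resample (S n ω * A n) (I n ω b)) j - sval (S n ω * A n) j| -
        limSigma g lam (Fin.castLE hkd j) (√(t n : ℝ) •
          (nGram n (resample (S n ω * A n) (I n ω b)) - nGram n (S n ω * A n)))| ≤ ε) ∧
      |√(t n : ℝ) * sinDist (vs n ω b j) (vt n ω j) -
        limV g lam (Fin.castLE hkd j) (√(t n : ℝ) •
          (nGram n (resample (S n ω * A n) (I n ω b)) - nGram n (S n ω * A n)))| ≤ ε := by
    intro ε hε R
    obtain ⟨δ, hδ, hrad⟩ := exists_error_radius hkd hg hlam hpos R hε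
    refine ⟨δ, hδ, ?_⟩
    filter_upwards [hsq.eventually_ge_atTop δ⁻¹, eventually_gt_atTop 0] with n h1 h2 ω hω b hb j
    obtain ⟨e1, e2, e3, e4⟩ := hrad n (t n) (t n) (t n) (S n ω * A n)
      (resample (S n ω * A n) (I n ω b)) (vt n ω) (vs n ω b) h2 h1 hω hb (hvt n ω) (hvs n ω b) j
    rw [sinDist_normalize_act h2]
    exact ⟨e1, e2, e3⟩
  refine ⟨?_, ?_, ?_⟩
  -- Singular vectors use the off-diagonal direction `hC₂` against an atom at zero; singular values
  -- use the diagonal one, `hC₁`.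
  · refine h.tendsto_measureReal_le_quantile hmean ht hB hα hI hJ
      (lim := fun j => limU g lam (Fin.castLE hkd j)) (fun j => continuous_limU _ _ _)
      (fun j c hc z => limU_smul hc z) (fun j z => Real.sqrt_nonneg _) hC₂ hj₀
      (fun z hz => ?_) hc₁
      (fun ε hε R => (hdata ε hε R).mono fun n hn ω hω j => (hn ω hω j).1) fun ε hε R => ?_
    · rw [inner_rankOne]
      exact bil_eq_zero_of_limU hpos hl hne hz
    · obtain ⟨δ, hδ, hn⟩ := hboot ε hε R
      exact ⟨δ, hδ, hn.mono fun n hn ω hω b hb j => (hn ω hω b hb j).1⟩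
  · refine h.tendsto_measureReal_le_quantile hmean ht hB hα hI hJ
      (lim := fun j => limSigma g lam (Fin.castLE hkd j)) (fun j => continuous_limSigma _ _ _)
      (fun j c hc z => limSigma_smul hc z) (fun j z => limSigma_nonneg z) hC₁ hj₀
      (fun z hz => ?_) hc₂
      (fun ε hε R => (hdata ε hε R).mono fun n hn ω hω j => (hn ω hω j).2.1) fun ε hε R => ?_
    · rw [inner_rankOne]
      exact bil_eq_zero_of_limSigma (hpos _) hz
    · obtain ⟨δ, hδ, hn⟩ := hboot ε hε R
      exact ⟨δ, hδ, hn.mono fun n hn ω hω b hb j => (hn ω hω b hb j).2.1⟩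
  · refine h.tendsto_measureReal_le_quantile hmean ht hB hα hI hJ
      (lim := fun j => limV g lam (Fin.castLE hkd j)) (fun j => continuous_limV _ _ _)
      (fun j c hc z => limV_smul hc z) (fun j z => Real.sqrt_nonneg _) hC₂ hj₀
      (fun z hz => ?_) hc₁
      (fun ε hε R => (hdata ε hε R).mono fun n hn ω hω j => (hn ω hω j).2.2) fun ε hε R => ?_
    · rw [inner_rankOne]
      exact bil_eq_zero_of_limV hl hne hz
    · obtain ⟨δ, hδ, hn⟩ := hboot ε hε R
      exact ⟨δ, hδ, hn.mono fun n hn ω hω b hb j => (hn ω hω b hb j).2.2⟩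

end SampleModel

/-! ### The eigenvectors of the limit of the Gram matrices -/

section LimitGram

variable {d : ℕ} {A : ∀ n : ℕ, Matrix (Fin n) (Fin d) ℝ} {G : Matrix (Fin d) (Fin d) ℝ}

lemma SortedEig.act_eq {g : Fin d → EuclideanSpace ℝ (Fin d)} {lam : Fin d → ℝ}
    (h : SortedEig (vec G) g lam) (l : Fin d) : act G (g l) = lam l • g l := by
  refine ext_inner_left ℝ fun y => ?_
  rw [← bil_vec, h.eigen, inner_smul_right]

lemma SortedEig.mem_eigenspace {g : Fin d → EuclideanSpace ℝ (Fin d)} {lam : Fin d → ℝ}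
    (h : SortedEig (vec G) g lam) (l : Fin d) :
    (g l).ofLp ∈ Module.End.eigenspace (Matrix.toLin' G) (lam l) := by
  rw [Module.End.mem_eigenspace_iff, Matrix.toLin'_apply]
  exact congrArg WithLp.ofLp (h.act_eq l)

lemma SortedEig.ofLp_ne_zero {g : Fin d → EuclideanSpace ℝ (Fin d)} {lam : Fin d → ℝ}
    (h : SortedEig (vec G) g lam) (l : Fin d) : (g l).ofLp ≠ 0 := fun e => by
  have h1 : g l = 0 := by ext i; exact congrFun e i
  have h2 := h.norm_eq_one l
  rw [h1, norm_zero] at h2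
  exact zero_ne_one h2

lemma SortedEig.hasEigenvalue {g : Fin d → EuclideanSpace ℝ (Fin d)} {lam : Fin d → ℝ}
    (h : SortedEig (vec G) g lam) (l : Fin d) :
    Module.End.HasEigenvalue (Matrix.toLin' G) (lam l) :=
  Module.End.hasEigenvalue_of_hasEigenvector ⟨h.mem_eigenspace l, h.ofLp_ne_zero l⟩

/-- Equal eigenvalues would put two orthonormal vectors into an eigenspace of dimension at most one.
-/
lemma AssumptionRP.strictAnti (hA : AssumptionRP A G) {g : Fin d → EuclideanSpace ℝ (Fin d)}
    {lam : Fin d → ℝ} (h : SortedEig (vec G) g lam) : StrictAnti lam := by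
  refine h.anti.strictAnti_of_injective fun i j hij => ?_
  by_contra hne
  have h1 := finrank_le_one_iff.1 (hA.simple (lam i))
  obtain ⟨w, hw⟩ := h1
  obtain ⟨a, ha⟩ := hw ⟨_, h.mem_eigenspace i⟩
  obtain ⟨b, hb⟩ := hw ⟨_, hij ▸ h.mem_eigenspace j⟩
  have ha' : g i = a • WithLp.toLp 2 (w : Fin d → ℝ) := by
    ext q; exact (congrFun (congrArg Subtype.val ha) q).symm
  have hb' : g j = b • WithLp.toLp 2 (w : Fin d → ℝ) := by
    ext q; exact (congrFun (congrArg Subtype.val hb) q).symm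
  have h2 : inner ℝ (g i) (g j) = 0 := h.orthonormal.2 hne
  have hi := h.norm_eq_one i
  have hj := h.norm_eq_one j
  rw [ha', hb', inner_smul_left, inner_smul_right] at h2
  rw [ha', norm_smul] at hi
  rw [hb', norm_smul] at hj
  rw [real_inner_self_eq_norm_sq] at h2
  simp only [conj_trivial, mul_eq_zero, pow_eq_zero_iff, ne_eq, OfNat.ofNat_ne_zero,
    not_false_eq_true] at h2
  rcases h2 with h2 | h2 | h2 <;> simp [h2] at hi hj

lemma AssumptionRP.pos (hA : AssumptionRP A G) {g : Fin d → EuclideanSpace ℝ (Fin d)}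
    {lam : Fin d → ℝ} (h : SortedEig (vec G) g lam) (l : Fin d) : 0 < lam l := by
  have h1 := hA.posDef.dotProduct_mulVec_pos (h.ofLp_ne_zero l)
  have h2 := h.bil_self l
  rw [bil_vec, act, EuclideanSpace.inner_eq_star_dotProduct, dotProduct_comm] at h2
  rw [← h2]
  exact h1

lemma AssumptionRP.exists_sortedEig (hA : AssumptionRP A G) :
    ∃ g lam, SortedEig (vec G) g lam ∧ StrictAnti lam ∧ ∀ l, 0 < lam l := by
  obtain ⟨g, lam, h⟩ := exists_sortedEig_of_symmetric (M := G) (by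
    have := hA.posDef.1
    rwa [Matrix.IsHermitian, Matrix.conjTranspose_eq_transpose_of_trivial] at this)
  exact ⟨g, lam, h, hA.strictAnti h, hA.pos h⟩

lemma continuous_vec : Continuous (vec (d := d)) :=
  (PiLp.continuous_toLp 2 _).comp
    (continuous_pi fun q => continuous_id.matrix_elem q.1 q.2)

lemma AssumptionRP.tendsto_nGram (hA : AssumptionRP A G) :
    Tendsto (fun n => nGram n (A n)) atTop (𝓝 (vec G)) :=
  (continuous_vec.tendsto G).comp hA.gram_tendsto

/-- The two leading eigenvectors are those of a sorted eigenbasis, up to signs. -/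
lemma IsTopTwoEigenvectors.eq_or_eq_neg {v₁ v₂ : EuclideanSpace ℝ (Fin d)}
    (hv : IsTopTwoEigenvectors G v₁ v₂) {g : Fin d → EuclideanSpace ℝ (Fin d)} {lam : Fin d → ℝ}
    (h : SortedEig (vec G) g lam) (hlam : StrictAnti lam) (hd : 2 ≤ d) :
    (v₁ = g ⟨0, by omega⟩ ∨ v₁ = -g ⟨0, by omega⟩) ∧
      (v₂ = g ⟨1, by omega⟩ ∨ v₂ = -g ⟨1, by omega⟩) := by
  obtain ⟨hn1, hn2, l₁, l₂, hlt, he1, he2, htop⟩ := hv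
  have hb1 : ∀ y, bil (vec G) y v₁ = l₁ * inner ℝ y v₁ := fun y => by
    rw [bil_vec, he1, inner_smul_right]
  have hb2 : ∀ y, bil (vec G) y v₂ = l₂ * inner ℝ y v₂ := fun y => by
    rw [bil_vec, he2, inner_smul_right]
  have hex : ∀ {c : ℝ} {x : EuclideanSpace ℝ (Fin d)}, ‖x‖ = 1 →
      (∀ y, bil (vec G) y x = c * inner ℝ y x) → ∃ i, lam i = c := by
    intro c x hx hc
    by_contra! hne
    have h0 : ∀ l, inner ℝ x (g l) = 0 := by
      intro l
      have h1 := hc (g l)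
      rw [h.eigen'] at h1
      have h2 : (lam l - c) * inner ℝ (g l) x = 0 := by linarith
      rw [real_inner_comm]
      exact (mul_eq_zero.1 h2).resolve_left (sub_ne_zero.2 (hne l))
    have h1 := h.sum_inner_sq x
    simp [h0, hx] at h1
  obtain ⟨i, hi⟩ := hex hn1 hb1
  obtain ⟨j, hj⟩ := hex hn2 hb2
  -- No eigenvalue exceeds `l₁` or lies strictly between `l₂` and `l₁`. Strict monotonicity then
  -- leaves only the indices `0` and `1`.
  have hall : ∀ l, lam l = l₁ ∨ lam l ≤ l₂ := fun l => htop _ (h.hasEigenvalue l)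
  have hij : i < j := hlam.lt_iff_gt.1 (by rw [hi, hj]; exact hlt)
  have hi0 : i = ⟨0, by omega⟩ := by
    by_contra hne
    have hlt' : (⟨0, by omega⟩ : Fin d) < i :=
      lt_of_le_of_ne (Fin.mk_le_of_le_val (Nat.zero_le _)) (Ne.symm hne)
    have := hlam hlt'
    rcases hall ⟨0, by omega⟩ with h1 | h1 <;> linarith
  have hj1 : j = ⟨1, by omega⟩ := by
    by_contra hne
    have h01 : (i : ℕ) < j := hij
    have hlt' : (⟨1, by omega⟩ : Fin d) < j :=
      lt_of_le_of_ne (Fin.mk_le_of_le_val (by omega)) (Ne.symm hne)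
    have h1 := hlam hlt'
    have h2 : lam ⟨1, by omega⟩ < lam i := hlam (by rw [hi0]; exact Fin.mk_lt_mk.2 one_pos)
    rcases hall ⟨1, by omega⟩ with h3 | h3 <;> linarith
  rw [← hi0, ← hj1]
  exact ⟨h.eq_or_eq_neg hn1 hb1 fun l hl e => hl (hlam.injective (by rw [e, hi])),
    h.eq_or_eq_neg hn2 hb2 fun l hl e => hl (hlam.injective (by rw [e, hj]))⟩

end LimitGram

/-! ### The law of the rows of a sketch -/

section RowLaw

variable {t p d n : ℕ}

lemma outer_smul (c : ℝ) (x : Fin d → ℝ) (q : Fin d × Fin d) :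
    outer (c • x) q = c ^ 2 * (x q.1 * x q.2) := by
  simp only [outer, Pi.smul_apply, smul_eq_mul]
  ring

/-- The norm on `MatSpace d` is the Frobenius norm, for which `r rᵀ` has norm `‖r‖ ^ 2`; moments of
the sample have twice that order in the row. -/
lemma norm_outer (x : Fin d → ℝ) : ‖outer x‖ = ∑ a, x a ^ 2 := by
  have h : ∑ q : Fin d × Fin d, (x q.1 * x q.2) ^ 2 = (∑ a, x a ^ 2) ^ 2 := by
    rw [Fintype.sum_prod_type, sq (∑ a, x a ^ 2), Finset.sum_mul_sum]
    exact Finset.sum_congr rfl fun _ _ => Finset.sum_congr rfl fun _ _ => by ring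
  rw [EuclideanSpace.norm_eq]
  simp only [outer, Real.norm_eq_abs, sq_abs]
  rw [h, Real.sqrt_sq (Finset.sum_nonneg fun _ _ => sq_nonneg _)]

lemma inner_outer (x : Fin d → ℝ) (z : MatSpace d) :
    inner ℝ (outer x) z = ∑ q : Fin d × Fin d, z q * (x q.1 * x q.2) := by
  simp [outer, PiLp.inner_apply]

/-- The matrix `r rᵀ` for the row vector `r = c sᵀ A`. -/
def rowOuter (c : ℝ) (A : Matrix (Fin p) (Fin d) ℝ) (s : Fin p → ℝ) : MatSpace d :=
  outer (c • (s ᵥ* A))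

lemma measurable_outer : Measurable (outer (d := d)) := by
  refine (WithLp.measurable_toLp 2 _).comp (measurable_pi_iff.2 fun q => ?_)
  fun_prop

lemma measurable_rowOuter (c : ℝ) (A : Matrix (Fin p) (Fin d) ℝ) : Measurable (rowOuter c A) := by
  refine measurable_outer.comp (measurable_pi_iff.2 fun q => ?_)
  simp only [Pi.smul_apply, smul_eq_mul, Matrix.vecMul, dotProduct]
  fun_prop

lemma rowSample_apply (S : Matrix (Fin t) (Fin p) ℝ) (A : Matrix (Fin p) (Fin d) ℝ) (i : Fin t) :
    rowSample n S A i = rowOuter (√(t : ℝ) / √(n : ℝ)) A (S i) := by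
  rw [rowSample, rowOuter, ← Matrix.mul_apply_eq_vecMul]
  rfl

variable {Ω : Type*} [MeasurableSpace Ω] {P : Measure Ω} {S : Ω → Matrix (Fin t) (Fin p) ℝ}
  {ν : Measure (Fin p → ℝ)}

lemma HasIIDRows.iIndepFun_rowSample (h : HasIIDRows P S ν) (A : Matrix (Fin p) (Fin d) ℝ) :
    iIndepFun (fun i ω => rowSample n (S ω) A i) P := by
  have := h.indep.comp (fun _ => rowOuter (√(t : ℝ) / √(n : ℝ)) A)
    fun _ => measurable_rowOuter _ _
  convert this using 3 with i ω
  exact rowSample_apply _ _ _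

lemma HasIIDRows.hasLaw_rowSample (h : HasIIDRows P S ν) (A : Matrix (Fin p) (Fin d) ℝ)
    (i : Fin t) : HasLaw (fun ω => rowSample n (S ω) A i)
      (ν.map (rowOuter (√(t : ℝ) / √(n : ℝ)) A)) P := by
  simp only [rowSample_apply]
  exact HasLaw.fun_comp (Y := rowOuter (√(t : ℝ) / √(n : ℝ)) A)
    ⟨(measurable_rowOuter _ _).aemeasurable, rfl⟩ (h.law i)

end RowLaw

/-! ### Row sampling -/

section RowSampling

variable {t n d : ℕ} {p : Fin n → ℝ}

lemma integral_samplingRowLaw (hp : ∀ l, 0 < p l) (f : (Fin n → ℝ) → ℝ) :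
    ∫ s, f s ∂(samplingRowLaw t p) = ∑ l, p l * f (Pi.single l (1 / √((t : ℝ) * p l))) := by
  rw [samplingRowLaw, integral_finsetSum_measure]
  · refine Finset.sum_congr rfl fun l _ => ?_
    rw [integral_smul_measure, integral_dirac, ENNReal.toReal_ofReal (hp l).le, smul_eq_mul]
  · exact fun l _ => (integrable_dirac (by simp)).smul_measure ENNReal.ofReal_ne_top

/-- The factors `√t` cancel, so the law of a rescaled row does not depend on the sketch size. -/
lemma rowOuter_single [NeZero t] (A : Matrix (Fin n) (Fin d) ℝ) (l : Fin n) {c : ℝ} (hc : 0 < c) :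
    rowOuter (√(t : ℝ) / √(n : ℝ)) A (Pi.single l (1 / √((t : ℝ) * c))) =
      outer ((1 / √((n : ℝ) * c)) • A l) := by
  have hpos : (0 : ℝ) < t := Nat.cast_pos.2 (Nat.pos_of_ne_zero (NeZero.ne t))
  have hs : 0 < √(t : ℝ) := Real.sqrt_pos.2 hpos
  have hs' : 0 < √c := Real.sqrt_pos.2 hc
  rw [rowOuter]
  congr 1
  ext a
  simp only [Pi.smul_apply, smul_eq_mul, Matrix.single_vecMul, Matrix.row_apply]
  rw [Real.sqrt_mul hpos.le, Real.sqrt_mul (Nat.cast_nonneg n)]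
  field_simp

lemma integral_rowOuter_sampling [NeZero t] (A : Matrix (Fin n) (Fin d) ℝ) (hp : ∀ l, 0 < p l)
    {f : MatSpace d → ℝ} (hf : Measurable f) :
    ∫ y, f y ∂((samplingRowLaw t p).map (rowOuter (√(t : ℝ) / √(n : ℝ)) A)) =
      ∑ l, p l * f (outer ((1 / √((n : ℝ) * p l)) • A l)) := by
  rw [integral_map (measurable_rowOuter _ _).aemeasurable hf.aestronglyMeasurable,
    integral_samplingRowLaw hp]
  exact Finset.sum_congr rfl fun l _ => by rw [rowOuter_single A l (hp l)]

lemma ae_rowOuter_sampling [NeZero t] (A : Matrix (Fin n) (Fin d) ℝ) (hp : ∀ l, 0 < p l)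
    {Z : MatSpace d → Prop} (hZ : MeasurableSet {y | Z y})
    (h : ∀ l, Z (outer ((1 / √((n : ℝ) * p l)) • A l))) :
    ∀ᵐ y ∂((samplingRowLaw t p).map (rowOuter (√(t : ℝ) / √(n : ℝ)) A)), Z y := by
  rw [ae_map_iff (measurable_rowOuter _ _).aemeasurable hZ, samplingRowLaw,
    ae_finsetSum_measure_iff]
  intro l _
  refine Measure.ae_smul_measure ?_ _
  rw [ae_dirac_eq]
  change Z _
  rw [rowOuter_single A l (hp l)]
  exact h l

lemma mul_outer_sampling (A : Matrix (Fin n) (Fin d) ℝ) {l : Fin n} {c : ℝ} (hc : 0 < c)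
    (q : Fin d × Fin d) :
    c * outer ((1 / √((n : ℝ) * c)) • A l) q = 1 / (n : ℝ) * (A l q.1 * A l q.2) := by
  have hn : (0 : ℝ) < n := Nat.cast_pos.2 l.pos
  rw [outer_smul, div_pow, Real.sq_sqrt (by positivity)]
  field_simp

/-- Unbiasedness: the weights `1 / p l` compensate for the sampling probabilities. -/
lemma sum_mul_outer_sampling (A : Matrix (Fin n) (Fin d) ℝ) (hp : ∀ l, 0 < p l)
    (q : Fin d × Fin d) :
    ∑ l, p l * outer ((1 / √((n : ℝ) * p l)) • A l) q = nGram n A q := by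
  simp only [nGram, vec, Matrix.smul_apply, Matrix.mul_apply, Matrix.transpose_apply, smul_eq_mul,
    Finset.mul_sum]
  exact Finset.sum_congr rfl fun l _ => mul_outer_sampling A (hp l) q

lemma sum_mul_norm_outer_sampling (A : Matrix (Fin n) (Fin d) ℝ) (hp : ∀ l, 0 < p l) :
    ∑ l, p l * ‖outer ((1 / √((n : ℝ) * p l)) • A l)‖ = ∑ a, nGram n A (a, a) := by
  simp only [norm_outer, ← fun a => sum_mul_outer_sampling A hp (a, a)]
  rw [Finset.sum_comm]
  refine Finset.sum_congr rfl fun l _ => ?_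
  rw [Finset.mul_sum]
  exact Finset.sum_congr rfl fun a _ => by simp only [outer, sq]

/-- Moments of the norm for row sampling. -/
lemma integral_norm_pow_sampling_le [NeZero t] (A : Matrix (Fin n) (Fin d) ℝ) (hp : ∀ l, 0 < p l)
    (k : ℕ) :
    ∫ y, ‖y‖ ^ (k + 1) ∂((samplingRowLaw t p).map (rowOuter (√(t : ℝ) / √(n : ℝ)) A)) ≤
      (⨆ l : Fin n, ‖(1 / √((n : ℝ) * p l)) •
        (WithLp.toLp 2 (A l) : EuclideanSpace ℝ (Fin d))‖) ^ (2 * k) * ∑ a, nGram n A (a, a) := by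
  rw [integral_rowOuter_sampling A hp (by fun_prop), ← sum_mul_norm_outer_sampling A hp,
    Finset.mul_sum]
  refine Finset.sum_le_sum fun l _ => ?_
  have h1 : ‖outer ((1 / √((n : ℝ) * p l)) • A l)‖ =
      ‖(1 / √((n : ℝ) * p l)) • (WithLp.toLp 2 (A l) : EuclideanSpace ℝ (Fin d))‖ ^ 2 := by
    rw [norm_outer, EuclideanSpace.real_norm_sq_eq]
    rfl
  have h2 : ‖outer ((1 / √((n : ℝ) * p l)) • A l)‖ ≤ (⨆ l : Fin n, ‖(1 / √((n : ℝ) * p l)) •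
        (WithLp.toLp 2 (A l) : EuclideanSpace ℝ (Fin d))‖) ^ 2 := by
    rw [h1]
    exact pow_le_pow_left₀ (norm_nonneg _) (le_ciSup (f := fun l : Fin n =>
      ‖(1 / √((n : ℝ) * p l)) • (WithLp.toLp 2 (A l) : EuclideanSpace ℝ (Fin d))‖)
      (Set.finite_range _).bddAbove l) 2
  have hpl := hp l
  -- All but one of the factors are bounded by the squared supremum. The remaining one has the trace
  -- of the Gram matrix as its mean, which stays bounded under the assumptions.
  calc p l * ‖outer ((1 / √((n : ℝ) * p l)) • A l)‖ ^ (k + 1)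
      = ‖outer ((1 / √((n : ℝ) * p l)) • A l)‖ ^ k *
        (p l * ‖outer ((1 / √((n : ℝ) * p l)) • A l)‖) := by ring
    _ ≤ _ := by
        rw [pow_mul]
        gcongr

end RowSampling

/-- The variance of a quadratic form of the first row of a sketch. -/
lemma variance_firstRow {Ω : Type*} [MeasurableSpace Ω] {P : Measure Ω} {t p d : ℕ} [NeZero t]
    {S : Ω → Matrix (Fin t) (Fin p) ℝ} {A : Matrix (Fin p) (Fin d) ℝ}
    {μ : Measure (MatSpace d)} [IsProbabilityMeasure μ]
    (hlaw : HasLaw (fun ω => rowSample p (S ω) A 0) μ P)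
    (hmem : MemLp (fun y : MatSpace d => y) 3 μ) (C : Matrix (Fin d) (Fin d) ℝ) :
    variance (fun ω => firstRow (S ω) A ⬝ᵥ (C *ᵥ firstRow (S ω) A)) P =
      ∫ y, (inner ℝ (y - meanVec μ) (vec C)) ^ 2 ∂μ := by
  have h1 : (fun ω => firstRow (S ω) A ⬝ᵥ (C *ᵥ firstRow (S ω) A)) =
      (fun y : MatSpace d => inner ℝ y (vec C)) ∘ fun ω => rowSample p (S ω) A 0 := by
    funext ω
    simp only [Function.comp_apply]
    rw [rowSample, inner_outer]
    change firstRow (S ω) A ⬝ᵥ (C *ᵥ firstRow (S ω) A) =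
      ∑ q : Fin d × Fin d, C q.1 q.2 * (firstRow (S ω) A q.1 * firstRow (S ω) A q.2)
    rw [Fintype.sum_prod_type]
    simp only [dotProduct, Matrix.mulVec, Finset.mul_sum]
    exact Finset.sum_congr rfl fun _ _ => Finset.sum_congr rfl fun _ _ => by ring
  rw [h1, ← variance_map (by rw [hlaw.map_eq]; fun_prop) hlaw.aemeasurable, hlaw.map_eq,
    variance_eq_integral (by fun_prop), integral_inner_eq hmem]
  simp only [inner_sub_left]

/-! ### Moment conditions for row sampling -/

section RowSamplingModel

variable {Ω : ℕ → Type*} [∀ n, MeasurableSpace (Ω n)] {P : ∀ n, Measure (Ω n)}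
  [∀ n, IsProbabilityMeasure (P n)] {d : ℕ} {t : ℕ → ℕ} [∀ n, NeZero (t n)]
  {A : ∀ n : ℕ, Matrix (Fin n) (Fin d) ℝ} {S : ∀ n, Ω n → Matrix (Fin (t n)) (Fin n) ℝ}
  {p : ∀ n : ℕ, Fin n → ℝ} {G : Matrix (Fin d) (Fin d) ℝ}

/-- The limit of the covariances of products of entries, from the limits of the variances. -/
def limSecond (G : Matrix (Fin d) (Fin d) ℝ) (ℓ : Matrix (Fin d) (Fin d) ℝ → ℝ)
    (a b : Fin d × Fin d) : ℝ :=
  (ℓ (Matrix.single a.1 a.2 1 + Matrix.single b.1 b.2 1) -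
    ℓ (Matrix.single a.1 a.2 1 - Matrix.single b.1 b.2 1)) / 4 + vec G a * vec G b

/-- The origin of the exponent `1/8`: the third moment of `r rᵀ` is bounded by `f ^ 4` times a trace
and has to be `o(√t)`. The fourth moment, with `f ^ 6`, has room to spare. -/
lemma growth_pow {f : ℕ → ℝ} (hf : f =o[atTop] fun n => (t n : ℝ) ^ (1 / 8 : ℝ)) :
    Tendsto (fun n => f n ^ 4 / √(t n)) atTop (𝓝 0) ∧
      Tendsto (fun n => f n ^ 6 / t n) atTop (𝓝 0) := by
  have h0 := hf.tendsto_div_nhds_zero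
  have hpos : ∀ n, (1 : ℝ) ≤ t n := fun n => Nat.one_le_cast.2 (Nat.pos_of_ne_zero (NeZero.ne _))
  constructor
  · have h1 := h0.pow 4
    rw [zero_pow (by norm_num)] at h1
    refine h1.congr fun n => ?_
    rw [div_pow, ← Real.rpow_natCast ((t n : ℝ) ^ (1 / 8 : ℝ)), ← Real.rpow_mul (by positivity),
      Real.sqrt_eq_rpow]
    norm_num
  · have h1 := h0.pow 6
    rw [zero_pow (by norm_num)] at h1
    refine squeeze_zero (fun n => by positivity) (fun n => ?_) h1
    rw [div_pow]
    have h2 := hpos n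
    have h3 : ((t n : ℝ) ^ (1 / 8 : ℝ)) ^ 6 ≤ t n := by
      rw [← Real.rpow_natCast ((t n : ℝ) ^ (1 / 8 : ℝ)), ← Real.rpow_mul (by positivity)]
      calc (t n : ℝ) ^ (1 / 8 * ((6 : ℕ) : ℝ)) ≤ (t n : ℝ) ^ (1 : ℝ) :=
            Real.rpow_le_rpow_of_exponent_le h2 (by norm_num)
        _ = t n := Real.rpow_one _
    gcongr

theorem AssumptionRS.exists_sampleModel (h : AssumptionRS P t A S p G)
    (hS : ∀ n, 0 < n → IsRowSampling (P n) (S n) (p n)) :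
    ∃ (μ : ℕ → Measure (MatSpace d)) (Q : Fin d × Fin d → Fin d × Fin d → ℝ),
      SampleModel P t (fun n ω => rowSample n (S n ω) (A n)) μ (vec G).ofLp Q ∧
      (∀ᶠ n in atTop, meanVec (μ n) = nGram n (A n)) ∧
      ∃ v₁ v₂, IsTopTwoEigenvectors G v₁ v₂ ∧
        0 < (rankOne v₁ v₁).ofLp ⬝ᵥ (Matrix.of fun a b => Q a b - vec G a * vec G b) *ᵥ
          (rankOne v₁ v₁).ofLp ∧
        0 < (rankOne v₁ v₂).ofLp ⬝ᵥ (Matrix.of fun a b => Q a b - vec G a * vec G b) *ᵥ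
          (rankOne v₁ v₂).ofLp := by
  obtain ⟨ℓ, hℓ, v₁, v₂, hv, hpos₁, hpos₂⟩ := h.var_tendsto
  set μ : ℕ → Measure (MatSpace d) := fun n =>
    (samplingRowLaw (t n) (p n)).map (rowOuter (√(t n : ℝ) / √(n : ℝ)) (A n)) with hμ
  have hG := h.toAssumptionRP.tendsto_nGram
  have hlaw : ∀ n, 0 < n → ∀ i, HasLaw (fun ω => rowSample n (S n ω) (A n) i) (μ n) (P n) :=
    fun n hn i => (hS n hn).rows.hasLaw_rowSample (A n) i
  have hprob : ∀ n, 0 < n → IsProbabilityMeasure (μ n) := fun n hn =>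
    (hlaw n hn 0).isProbabilityMeasure_iff.1 inferInstance
  have hmem : ∀ n, 0 < n → MemLp (fun y : MatSpace d => y) 4 (μ n) := by
    intro n hn
    have := hprob n hn
    refine MemLp.of_bound (by fun_prop)
      (∑ l, ‖outer ((1 / √((n : ℝ) * p n l)) • A n l)‖) ?_
    refine ae_rowOuter_sampling (A n) (hS n hn).prob_pos
      (measurableSet_le measurable_norm measurable_const) fun l => ?_
    exact Finset.single_le_sum (f := fun l => ‖outer ((1 / √((n : ℝ) * p n l)) • A n l)‖)
      (fun _ _ => norm_nonneg _) (Finset.mem_univ l)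
  have hfirst : ∀ n, 0 < n → ∀ a, ∫ y, y a ∂(μ n) = nGram n (A n) a := by
    intro n hn a
    rw [hμ, integral_rowOuter_sampling (f := fun y => y a) (A n) (hS n hn).prob_pos (by fun_prop)]
    exact sum_mul_outer_sampling (A n) (hS n hn).prob_pos a
  have hcoord : ∀ a, Tendsto (fun n => nGram n (A n) a) atTop (𝓝 (vec G a)) := fun a =>
    ((EuclideanSpace.proj (𝕜 := ℝ) a).continuous.tendsto (vec G)).comp hG
  have hm : ∀ a, Tendsto (fun n => ∫ y, y a ∂(μ n)) atTop (𝓝 (vec G a)) := by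
    intro a
    refine (hcoord a).congr' ?_
    filter_upwards [eventually_gt_atTop 0] with n hn
    exact (hfirst n hn a).symm
  have hvar : ∀ C : Matrix (Fin d) (Fin d) ℝ, Tendsto
      (fun n => ∫ y, (inner ℝ (y - meanVec (μ n)) (vec C)) ^ 2 ∂(μ n)) atTop (𝓝 (ℓ C)) := by
    intro C
    refine (hℓ C).congr' ?_
    filter_upwards [eventually_gt_atTop 0] with n hn
    have := hprob n hn
    exact variance_firstRow (hlaw n hn 0) ((hmem n hn).mono_exponent (by norm_num)) C
  have hsingle : ∀ a b : Fin d × Fin d, vec (Matrix.single a.1 a.2 (1 : ℝ)) b =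
      if b = a then 1 else 0 := by
    intro a b
    simp only [vec, Matrix.single_apply, Prod.ext_iff]
    simp only [eq_comm]
  -- Only variances of quadratic forms are assumed to converge; polarization yields the convergence
  -- of all covariances.
  have hcov : ∀ n, 0 < n → ∀ a b : Fin d × Fin d,
      ∫ y, y a * y b ∂(μ n) - (∫ y, y a ∂(μ n)) * ∫ y, y b ∂(μ n) =
      (∫ y, (inner ℝ (y - meanVec (μ n))
          (vec (Matrix.single a.1 a.2 1 + Matrix.single b.1 b.2 1))) ^ 2 ∂(μ n) -
        ∫ y, (inner ℝ (y - meanVec (μ n))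
          (vec (Matrix.single a.1 a.2 1 - Matrix.single b.1 b.2 1))) ^ 2 ∂(μ n)) / 4 := by
    intro n hn a b
    have := hprob n hn
    have e1 : ∀ c, vec (Matrix.single a.1 a.2 1 + Matrix.single b.1 b.2 (1 : ℝ)) c =
        (if c = a then 1 else 0) + if c = b then 1 else 0 := fun c => by
      rw [← hsingle, ← hsingle]; rfl
    have e2 : ∀ c, vec (Matrix.single a.1 a.2 1 - Matrix.single b.1 b.2 (1 : ℝ)) c =
        (if c = a then 1 else 0) - if c = b then 1 else 0 := fun c => by
      rw [← hsingle, ← hsingle]; rfl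
    have hm3 := (hmem n hn).mono_exponent (by norm_num : (3 : ENNReal) ≤ 4)
    rw [integral_inner_sub_sq hm3, integral_inner_sub_sq hm3]
    simp only [e1, e2, add_mul, mul_add, sub_mul, mul_sub, Finset.sum_add_distrib,
      Finset.sum_sub_distrib, ite_mul, mul_ite, one_mul, mul_one, zero_mul, mul_zero,
      Finset.sum_ite_eq', Finset.mem_univ, if_true]
    simp only [mul_comm]
    ring
  have hsecond : ∀ a b, Tendsto (fun n => ∫ y, y a * y b ∂(μ n)) atTop
      (𝓝 (limSecond G ℓ a b)) := by
    intro a b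
    have hlim := (((hvar (Matrix.single a.1 a.2 1 + Matrix.single b.1 b.2 1)).sub
      (hvar (Matrix.single a.1 a.2 1 - Matrix.single b.1 b.2 1))).div_const 4).add
      ((hm a).mul (hm b))
    refine hlim.congr' ?_
    filter_upwards [eventually_gt_atTop 0] with n hn
    rw [← hcov n hn]
    ring
  have htr : Tendsto (fun n => ∑ a, nGram n (A n) (a, a)) atTop (𝓝 (∑ a, vec G (a, a))) :=
    tendsto_finsetSum _ fun a _ => hcoord (a, a)
  obtain ⟨hg4, hg6⟩ := growth_pow h.growth
  have hmodel : SampleModel P t (fun n ω => rowSample n (S n ω) (A n)) μ (vec G).ofLp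
      (limSecond G ℓ) := by
    refine ⟨?_, ?_, ?_, hm, hsecond, ?_, ?_⟩
    · filter_upwards [eventually_gt_atTop 0] with n hn
      exact (hS n hn).rows.iIndepFun_rowSample (A n)
    · filter_upwards [eventually_gt_atTop 0] with n hn using hlaw n hn
    · filter_upwards [eventually_gt_atTop 0] with n hn using hmem n hn
    · have hlim := hg4.mul htr
      rw [zero_mul] at hlim
      refine squeeze_zero' (Eventually.of_forall fun n => by positivity) ?_ hlim
      filter_upwards [eventually_gt_atTop 0] with n hn
      rw [div_mul_eq_mul_div]
      gcongr
      exact integral_norm_pow_sampling_le (A n) (hS n hn).prob_pos 2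
    · have hlim := hg6.mul htr
      rw [zero_mul] at hlim
      refine squeeze_zero' (Eventually.of_forall fun n => by positivity) ?_ hlim
      filter_upwards [eventually_gt_atTop 0] with n hn
      rw [div_mul_eq_mul_div]
      gcongr
      exact integral_norm_pow_sampling_le (A n) (hS n hn).prob_pos 3
  refine ⟨μ, limSecond G ℓ, hmodel, ?_, v₁, v₂, hv, ?_, ?_⟩
  · filter_upwards [eventually_gt_atTop 0] with n hn
    ext a
    exact hfirst n hn a
  -- The same variances converge to the quadratic form of the limiting covariance and to `ℓ`, so the
  -- positivity of `ℓ` carries over.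
  · have h1 := tendsto_nhds_unique (hmodel.tendsto_integral_inner_sub_sq (rankOne v₁ v₁))
      (hvar (Matrix.vecMulVec v₁.ofLp v₁.ofLp))
    exact h1 ▸ hpos₁
  · have h1 := tendsto_nhds_unique (hmodel.tendsto_integral_inner_sub_sq (rankOne v₁ v₂))
      (hvar (Matrix.vecMulVec v₁.ofLp v₂.ofLp))
    exact h1 ▸ hpos₂

end RowSamplingModel

/-! ### Gaussian random projections -/

section GaussianMoments

/-- The moments of the standard normal distribution. -/
def stdMoment (k : ℕ) : ℝ := ∫ x, x ^ k ∂(gaussianReal 0 1)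

lemma integral_pow_gaussianReal {v : ℝ} (hv : 0 ≤ v) (k : ℕ) :
    ∫ x, x ^ (2 * k) ∂(gaussianReal 0 v.toNNReal) = v ^ k * stdMoment (2 * k) := by
  have h : gaussianReal 0 v.toNNReal = (gaussianReal 0 1).map (√v * ·) := by
    rw [gaussianReal_map_const_mul]
    congr 1
    · simp
    · ext
      simp [Real.sq_sqrt hv, hv]
  rw [h, integral_map (by fun_prop) (by fun_prop), stdMoment, ← integral_const_mul]
  refine integral_congr_ae (ae_of_all _ fun x => ?_)
  simp only [mul_pow, pow_mul, Real.sq_sqrt hv]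

lemma integrable_pow_gaussianReal (v : NNReal) (k : ℕ) :
    Integrable (fun x : ℝ => x ^ k) (gaussianReal 0 v) := by
  rcases Nat.eq_zero_or_pos k with rfl | hk
  · simp
  · refine ((memLp_id_gaussianReal' (μ := 0) (v := v) k (by simp)).integrable_norm_pow
      hk.ne').mono' (by fun_prop) (ae_of_all _ fun x => ?_)
    simp

lemma stdMoment_two : stdMoment 2 = 1 := by
  have h := variance_id_gaussianReal (μ := 0) (v := 1)
  rw [variance_eq_integral (by fun_prop)] at h
  simpa [stdMoment] using h

/-- The difference is the variance of `x ^ 2`, which cannot vanish because the law has no atoms at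
`±1`. This inequality suffices below; the value `3` is not needed. -/
lemma one_lt_stdMoment_four : 1 < stdMoment 4 := by
  have hi4 := integrable_pow_gaussianReal 1 4
  have hi2 := integrable_pow_gaussianReal 1 2
  have hexp : ∀ x : ℝ, (x ^ 2 - 1) ^ 2 = x ^ 4 - 2 * x ^ 2 + 1 := fun x => by ring
  have hi : Integrable (fun x : ℝ => (x ^ 2 - 1) ^ 2) (gaussianReal 0 1) := by
    simp only [hexp]
    exact (hi4.sub (hi2.const_mul 2)).add (integrable_const 1)
  have hval : ∫ x, (x ^ 2 - 1) ^ 2 ∂(gaussianReal 0 1) = stdMoment 4 - 1 := by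
    have hi3 : Integrable (fun x : ℝ => x ^ 4 - 2 * x ^ 2) (gaussianReal 0 1) :=
      hi4.sub (hi2.const_mul 2)
    simp only [hexp]
    rw [integral_add hi3 (integrable_const 1), integral_sub hi4 (hi2.const_mul 2),
      integral_const_mul]
    change stdMoment 4 - 2 * stdMoment 2 + _ = _
    rw [stdMoment_two]
    simp
    ring
  have hnn : 0 ≤ ∫ x, (x ^ 2 - 1) ^ 2 ∂(gaussianReal 0 1) :=
    integral_nonneg fun x => sq_nonneg _
  refine lt_of_le_of_ne (by linarith) fun h1 => ?_
  have h0 : ∫ x : ℝ, (x ^ 2 - 1) ^ 2 ∂(gaussianReal 0 1) = 0 := by rw [hval, ← h1, sub_self]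
  rw [integral_eq_zero_iff_of_nonneg (fun x => sq_nonneg _) hi] at h0
  have := nullSingletonClass_gaussianReal (μ := 0) (v := 1) one_ne_zero
  have hne : ∀ c : ℝ, ∀ᵐ x ∂(gaussianReal 0 1), x ≠ c := fun c => by
    rw [ae_iff]; simp
  have hfalse : ∀ᵐ _x ∂(gaussianReal 0 1), False := by
    filter_upwards [h0, hne 1, hne (-1)] with x hx h1 h2
    have h3 : (x - 1) * (x + 1) = 0 := by
      have : x ^ 2 - 1 = 0 := by simpa using hx
      linarith
    rcases mul_eq_zero.1 h3 with h4 | h4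
    · exact h1 (by linarith)
    · exact h2 (by linarith)
  exact (IsProbabilityMeasure.ne_zero (gaussianReal 0 1)) (by simpa using hfalse)

lemma map_sum_gaussianReal {n : ℕ} (v : NNReal) (w : Fin n → ℝ) :
    (Measure.pi fun _ : Fin n => gaussianReal 0 v).map (fun x => ∑ i, w i * x i) =
      gaussianReal 0 (v * ∑ i, w i ^ 2).toNNReal := by
  have hm : Measurable fun x : Fin n → ℝ => ∑ i, w i * x i := by fun_prop
  have hprob : IsProbabilityMeasure
      ((Measure.pi fun _ : Fin n => gaussianReal 0 v).map fun x => ∑ i, w i * x i) :=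
    Measure.isProbabilityMeasure_map hm.aemeasurable
  refine Measure.ext_of_charFun ?_
  funext s
  rw [charFun_apply_real, integral_map hm.aemeasurable (by fun_prop), charFun_gaussianReal]
  have h1 : ∀ x : Fin n → ℝ, Complex.exp (s * ((∑ i, w i * x i : ℝ) : ℂ) * Complex.I) =
      ∏ i, Complex.exp (((s * w i : ℝ) : ℂ) * (x i : ℂ) * Complex.I) := by
    intro x
    rw [← Complex.exp_sum]
    congr 1
    push_cast
    rw [Finset.mul_sum, Finset.sum_mul]
    exact Finset.sum_congr rfl fun _ _ => by ring
  simp_rw [h1]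
  rw [integral_fintype_prod_eq_prod (𝕜 := ℂ)
    (f := fun i (y : ℝ) => Complex.exp (((s * w i : ℝ) : ℂ) * (y : ℂ) * Complex.I))]
  simp_rw [← charFun_apply_real, charFun_gaussianReal]
  rw [← Complex.exp_sum]
  congr 1
  have hnn : 0 ≤ (v : ℝ) * ∑ i, w i ^ 2 :=
    mul_nonneg v.2 (Finset.sum_nonneg fun _ _ => sq_nonneg _)
  have hc : (((v : ℝ) * ∑ i, w i ^ 2).toNNReal : ℂ) = (v : ℂ) * ∑ i, (w i : ℂ) ^ 2 := by
    have : ((((v : ℝ) * ∑ i, w i ^ 2).toNNReal : ℝ) : ℂ) = (v : ℂ) * ∑ i, (w i : ℂ) ^ 2 := by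
      rw [Real.coe_toNNReal _ hnn]
      push_cast
      rfl
    exact this
  rw [hc]
  push_cast
  simp only [mul_zero, zero_mul, zero_sub, Finset.sum_neg_distrib, Finset.mul_sum,
    Finset.sum_mul, Finset.sum_div]
  congr 1
  exact Finset.sum_congr rfl fun _ _ => by ring

end GaussianMoments

/-! ### Moments of linear forms of Gaussian rows -/

section GaussianRows

variable {t n d : ℕ} (A : Matrix (Fin n) (Fin d) ℝ)

/-- The linear form `⟨w, r⟩` of the row `r = √t / √n sᵀ A`. -/
def rowForm (t : ℕ) {n d : ℕ} (A : Matrix (Fin n) (Fin d) ℝ) (w : EuclideanSpace ℝ (Fin d))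
    (s : Fin n → ℝ) : ℝ :=
  ∑ a, w a * ((√(t : ℝ) / √(n : ℝ)) • (s ᵥ* A)) a

lemma rowForm_eq (w : EuclideanSpace ℝ (Fin d)) (s : Fin n → ℝ) :
    rowForm t A w s = ∑ i, (√(t : ℝ) / √(n : ℝ) * act A w i) * s i := by
  simp only [rowForm, Pi.smul_apply, smul_eq_mul, Matrix.vecMul, Matrix.mulVec, dotProduct,
    Finset.mul_sum, Finset.sum_mul]
  rw [Finset.sum_comm]
  exact Finset.sum_congr rfl fun _ _ => Finset.sum_congr rfl fun _ _ => by ring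

lemma measurable_rowForm (w : EuclideanSpace ℝ (Fin d)) : Measurable (rowForm t A w) := by
  simp only [funext fun s => rowForm_eq (t := t) A w s]
  fun_prop

lemma bil_nGram_self_nonneg (w : EuclideanSpace ℝ (Fin d)) : 0 ≤ bil (nGram n A) w w := by
  rw [bil_nGram]
  exact mul_nonneg (by positivity) real_inner_self_nonneg

lemma rowForm_add (w w' : EuclideanSpace ℝ (Fin d)) (s : Fin n → ℝ) :
    rowForm t A (w + w') s = rowForm t A w s + rowForm t A w' s := by
  simp [rowForm, add_mul, Finset.sum_add_distrib]

lemma rowForm_smul (c : ℝ) (w : EuclideanSpace ℝ (Fin d)) (s : Fin n → ℝ) :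
    rowForm t A (c • w) s = c * rowForm t A w s := by
  simp [rowForm, Finset.mul_sum, mul_assoc]

lemma rowOuter_apply (s : Fin n → ℝ) (q : Fin d × Fin d) :
    rowOuter (√(t : ℝ) / √(n : ℝ)) A s q =
      rowForm t A (EuclideanSpace.single q.1 1) s * rowForm t A (EuclideanSpace.single q.2 1) s := by
  simp [rowOuter, outer, rowForm]

/-- The power mean inequality for `d` squares reduces fourth moments of the matrix to eighth moments
of single coordinates. -/
lemma norm_rowOuter_pow_le (s : Fin n → ℝ) (hd : 0 < d) :
    ‖rowOuter (√(t : ℝ) / √(n : ℝ)) A s‖ ^ 4 ≤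
      (d : ℝ) ^ 3 * ∑ a, rowForm t A (EuclideanSpace.single a 1) s ^ 8 := by
  have h := pow_sum_div_card_le_sum_pow (s := (Finset.univ : Finset (Fin d)))
    (f := fun a => rowForm t A (EuclideanSpace.single a 1) s ^ 2) (fun _ _ => sq_nonneg _) 3
  have h2 : ‖rowOuter (√(t : ℝ) / √(n : ℝ)) A s‖ =
      ∑ a, rowForm t A (EuclideanSpace.single a 1) s ^ 2 := by
    rw [rowOuter, norm_outer]
    simp [rowForm]
  have hd' : (0 : ℝ) < d := Nat.cast_pos.2 hd
  simp only [Finset.card_univ, Fintype.card_fin, ← pow_mul] at h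
  rw [div_le_iff₀ (by positivity)] at h
  rw [h2, mul_comm]
  exact h

variable [NeZero t]

/-- The variance is `(t / n) (1 / t) ‖A w‖ ^ 2`, so the law depends on `A` only through its Gram
matrix. The moments needed below are therefore continuous functions of `nGram n A`. -/
lemma map_rowForm (w : EuclideanSpace ℝ (Fin d)) :
    (gaussianRowLaw t n).map (rowForm t A w) = gaussianReal 0 (bil (nGram n A) w w).toNNReal := by
  have hpos : (0 : ℝ) < t := Nat.cast_pos.2 (Nat.pos_of_ne_zero (NeZero.ne t))
  have h1 : rowForm t A w = fun s => ∑ i, (√(t : ℝ) / √(n : ℝ) * act A w i) * s i :=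
    funext fun s => rowForm_eq A w s
  rw [gaussianRowLaw, h1, map_sum_gaussianReal]
  congr 2
  have hn : (√(t : ℝ) / √(n : ℝ)) ^ 2 = t / n := by
    rw [div_pow, Real.sq_sqrt hpos.le, Real.sq_sqrt (Nat.cast_nonneg n)]
  simp only [mul_pow, hn, ← Finset.mul_sum]
  rw [bil_nGram, real_inner_self_eq_norm_sq, EuclideanSpace.real_norm_sq_eq]
  push_cast
  field_simp

lemma integral_rowForm_pow (w : EuclideanSpace ℝ (Fin d)) (k : ℕ) :
    ∫ s, rowForm t A w s ^ (2 * k) ∂(gaussianRowLaw t n) =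
      (bil (nGram n A) w w) ^ k * stdMoment (2 * k) := by
  rw [← integral_pow_gaussianReal (bil_nGram_self_nonneg A w), ← map_rowForm (t := t),
    integral_map (measurable_rowForm A w).aemeasurable (by fun_prop)]

lemma integrable_rowForm_pow (w : EuclideanSpace ℝ (Fin d)) (k : ℕ) :
    Integrable (fun s => rowForm t A w s ^ k) (gaussianRowLaw t n) := by
  have h := integrable_pow_gaussianReal (bil (nGram n A) w w).toNNReal k
  rw [← map_rowForm (t := t)] at h
  exact h.comp_measurable (measurable_rowForm A w)

/-- The signed sums in the polarization of quartic forms. -/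
def signs : Finset (ℝ × ℝ × ℝ) := {1, -1} ×ˢ {1, -1} ×ˢ {1, -1}

/-- The signs cancel every monomial but `a b c e`, which occurs `4! = 24` times for each of the `8`
sign patterns; `192 = 8 * 24`. Mixed fourth moments thus reduce to those of a single Gaussian
variable. -/
lemma polarization (a b c e : ℝ) :
    a * b * (c * e) = ∑ q ∈ signs, q.1 * q.2.1 * q.2.2 / 192 *
      (a + q.1 * b + q.2.1 * c + q.2.2 * e) ^ 4 := by
  have h : (1 : ℝ) ≠ -1 := by norm_num
  simp only [signs, Finset.sum_product, Finset.sum_pair h]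
  ring

/-- The fourth moments of Gaussian rows as a function of the covariance matrix. -/
def gaussianFourth {d : ℕ} (M : MatSpace d) (x y z w : EuclideanSpace ℝ (Fin d)) : ℝ :=
  ∑ q ∈ signs, q.1 * q.2.1 * q.2.2 / 192 *
    (bil M (x + q.1 • y + q.2.1 • z + q.2.2 • w) (x + q.1 • y + q.2.1 • z + q.2.2 • w) ^ 2 *
      stdMoment 4)

lemma continuous_gaussianFourth (x y z w : EuclideanSpace ℝ (Fin d)) :
    Continuous fun M => gaussianFourth M x y z w := by
  unfold gaussianFourth
  exact continuous_finsetSum _ fun q _ =>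
    (((continuous_bil_left _ _).pow 2).mul_const _).const_mul _

lemma integral_rowForm_four (x y z w : EuclideanSpace ℝ (Fin d)) :
    ∫ s, rowForm t A x s * rowForm t A y s * (rowForm t A z s * rowForm t A w s)
      ∂(gaussianRowLaw t n) = gaussianFourth (nGram n A) x y z w := by
  have h : ∀ s, rowForm t A x s * rowForm t A y s * (rowForm t A z s * rowForm t A w s) =
      ∑ q ∈ signs, q.1 * q.2.1 * q.2.2 / 192 *
        rowForm t A (x + q.1 • y + q.2.1 • z + q.2.2 • w) s ^ 4 := by
    intro s
    rw [polarization]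
    simp only [rowForm_add, rowForm_smul]
  simp only [h]
  rw [integral_finsetSum _ fun q _ => (integrable_rowForm_pow A _ 4).const_mul _]
  refine Finset.sum_congr rfl fun q _ => ?_
  rw [integral_const_mul, show 4 = 2 * 2 from rfl, integral_rowForm_pow]

lemma gaussianFourth_self (M : MatSpace d) (x : EuclideanSpace ℝ (Fin d)) :
    gaussianFourth M x x x x = bil M x x ^ 2 * stdMoment 4 := by
  have h : ∀ a b c : ℝ, x + a • x + b • x + c • x = (1 + a + b + c) • x := fun a b c => by
    simp only [add_smul, one_smul]
  have h1 : (1 : ℝ) ≠ -1 := by norm_num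
  simp only [gaussianFourth, h, bil_smul_left, bil_smul_right, signs, Finset.sum_product,
    Finset.sum_pair h1]
  ring

/-- Orthogonality for `M` removes the cross terms, and in the signed sum the squares of `bil M x x`
and `bil M y y` cancel, leaving their product. -/
lemma gaussianFourth_orthogonal (M : MatSpace d) {x y : EuclideanSpace ℝ (Fin d)}
    (hxy : bil M x y = 0) (hyx : bil M y x = 0) :
    gaussianFourth M x y x y = bil M x x * bil M y y / 3 * stdMoment 4 := by
  have h : ∀ a b c : ℝ, x + a • y + b • x + c • y = (1 + b) • x + (a + c) • y := fun a b c => by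
    simp only [add_smul, one_smul]
    abel
  have hb : ∀ a b : ℝ, bil M (a • x + b • y) (a • x + b • y) =
      a ^ 2 * bil M x x + b ^ 2 * bil M y y := by
    intro a b
    have hl : ∀ u v w : EuclideanSpace ℝ (Fin d), bil M (u + v) w = bil M u w + bil M v w :=
      fun u v w => by simp [bil, add_mul, mul_add, Finset.sum_add_distrib]
    have hr : ∀ u v w : EuclideanSpace ℝ (Fin d), bil M u (v + w) = bil M u v + bil M u w :=
      fun u v w => by simp [bil, mul_add, Finset.sum_add_distrib]
    rw [hl, hr, hr]
    simp only [bil_smul_left, bil_smul_right, hxy, hyx]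
    ring
  have h1 : (1 : ℝ) ≠ -1 := by norm_num
  simp only [gaussianFourth, h, hb, signs, Finset.sum_product, Finset.sum_pair h1]
  ring

lemma bil_single (M : MatSpace d) (a b : Fin d) :
    bil M (EuclideanSpace.single a 1) (EuclideanSpace.single b 1) = M (a, b) := by
  rw [bil, Finset.sum_eq_single (a, b)]
  · simp
  · rintro ⟨a', b'⟩ _ hne
    rw [ne_eq, Prod.mk.injEq, not_and_or] at hne
    rcases hne with h | h <;> simp [h]
  · simp

lemma integral_rowForm_mul (x y : EuclideanSpace ℝ (Fin d)) :
    ∫ s, rowForm t A x s * rowForm t A y s ∂(gaussianRowLaw t n) = bil (nGram n A) x y := by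
  have h : ∀ s, rowForm t A x s * rowForm t A y s =
      1 / 4 * rowForm t A (x + y) s ^ 2 - 1 / 4 * rowForm t A (x + (-1 : ℝ) • y) s ^ 2 := by
    intro s
    simp only [rowForm_add, rowForm_smul]
    ring
  have h2 : ∀ w, ∫ s, rowForm t A w s ^ 2 ∂(gaussianRowLaw t n) = bil (nGram n A) w w := fun w => by
    simpa [stdMoment_two] using integral_rowForm_pow (t := t) A w 1
  simp only [h]
  rw [integral_sub ((integrable_rowForm_pow A _ 2).const_mul _)
    ((integrable_rowForm_pow A _ 2).const_mul _), integral_const_mul, integral_const_mul, h2, h2]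
  simp only [bil_nGram, act, Matrix.mulVec_add, Matrix.mulVec_smul, WithLp.ofLp_add,
    WithLp.ofLp_smul, WithLp.toLp_add, WithLp.toLp_smul, inner_add_left, inner_add_right,
    real_inner_smul_left, real_inner_smul_right]
  rw [real_inner_comm (WithLp.toLp 2 (A *ᵥ x.ofLp)) (WithLp.toLp 2 (A *ᵥ y.ofLp))]
  ring

end GaussianRows

/-! ### Moment conditions for Gaussian projections -/

section GaussianModel

variable {Ω : ℕ → Type*} [∀ n, MeasurableSpace (Ω n)] {P : ∀ n, Measure (Ω n)}
  [∀ n, IsProbabilityMeasure (P n)] {d : ℕ} {t : ℕ → ℕ} [∀ n, NeZero (t n)]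
  {A : ∀ n : ℕ, Matrix (Fin n) (Fin d) ℝ} {S : ∀ n, Ω n → Matrix (Fin (t n)) (Fin n) ℝ}
  {G : Matrix (Fin d) (Fin d) ℝ}

theorem AssumptionRP.exists_sampleModel (h : AssumptionRP A G) (ht : Tendsto t atTop atTop)
    (hS : ∀ n, 0 < n → IsGaussianProjection (P n) (S n)) (hd : 0 < d) :
    ∃ (μ : ℕ → Measure (MatSpace d)) (Q : Fin d × Fin d → Fin d × Fin d → ℝ),
      SampleModel P t (fun n ω => rowSample n (S n ω) (A n)) μ (vec G).ofLp Q ∧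
      (∀ᶠ n in atTop, meanVec (μ n) = nGram n (A n)) ∧
      ∀ x y, bil (vec G) x y = bil (vec G) y x →
        (rankOne x y).ofLp ⬝ᵥ (Matrix.of fun a b => Q a b - vec G a * vec G b) *ᵥ
          (rankOne x y).ofLp = gaussianFourth (vec G) x y x y - bil (vec G) x y ^ 2 := by
  set μ : ℕ → Measure (MatSpace d) := fun n =>
    (gaussianRowLaw (t n) n).map (rowOuter (√(t n : ℝ) / √(n : ℝ)) (A n)) with hμ
  have hmeas : ∀ n, Measurable (rowOuter (√(t n : ℝ) / √(n : ℝ)) (A n)) := fun n =>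
    measurable_rowOuter _ _
  have hprobν : ∀ n, IsProbabilityMeasure (gaussianRowLaw (t n) n) := fun n => by
    unfold gaussianRowLaw; infer_instance
  have hprob : ∀ n, IsProbabilityMeasure (μ n) := fun n =>
    Measure.isProbabilityMeasure_map (hmeas n).aemeasurable
  have hG := h.tendsto_nGram
  have hcoord : ∀ a, Tendsto (fun n => nGram n (A n) a) atTop (𝓝 (vec G a)) := fun a =>
    ((EuclideanSpace.proj (𝕜 := ℝ) a).continuous.tendsto (vec G)).comp hG
  have hfirst : ∀ n a, ∫ y, y a ∂(μ n) = nGram n (A n) a := by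
    intro n a
    rw [hμ, integral_map (hmeas n).aemeasurable (by fun_prop)]
    simp only [rowOuter_apply]
    rw [integral_rowForm_mul, bil_single]
  have hsecond : ∀ n a b, ∫ y, y a * y b ∂(μ n) = gaussianFourth (nGram n (A n))
      (EuclideanSpace.single a.1 1) (EuclideanSpace.single a.2 1)
      (EuclideanSpace.single b.1 1) (EuclideanSpace.single b.2 1) := by
    intro n a b
    rw [hμ, integral_map (hmeas n).aemeasurable (by fun_prop)]
    simp only [rowOuter_apply]
    rw [integral_rowForm_four]
  have hint8 : ∀ n, Integrable (fun s => (d : ℝ) ^ 3 *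
      ∑ a, rowForm (t n) (A n) (EuclideanSpace.single a 1) s ^ 8) (gaussianRowLaw (t n) n) :=
    fun n => (integrable_finsetSum _ fun a _ => integrable_rowForm_pow (A n) _ 8).const_mul _
  have hint4 : ∀ n, Integrable (fun s => ‖rowOuter (√(t n : ℝ) / √(n : ℝ)) (A n) s‖ ^ 4)
      (gaussianRowLaw (t n) n) := fun n =>
    (hint8 n).mono' ((hmeas n).norm.pow_const 4).aestronglyMeasurable
      (ae_of_all _ fun s => by
        rw [Real.norm_of_nonneg (by positivity)]
        exact norm_rowOuter_pow_le (A n) s hd)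
  have hint : ∀ n, Integrable (fun y : MatSpace d => ‖y‖ ^ 4) (μ n) := fun n =>
    (integrable_map_measure (by fun_prop) (hmeas n).aemeasurable).2 (hint4 n)
  have hmem : ∀ n, MemLp (fun y : MatSpace d => y) 4 (μ n) := fun n => by
    have h4 := (integrable_norm_rpow_iff (μ := μ n) (f := fun y : MatSpace d => y) (p := 4)
      (by fun_prop) (by norm_num) (by norm_num)).1
    refine h4 ?_
    simpa using hint n
  -- The fourth moments are bounded by a convergent function of the Gram matrices, so the growth
  -- conditions on third and fourth moments follow from `t → ∞`.
  have hbound : ∀ n, ∫ y, ‖y‖ ^ 4 ∂(μ n) ≤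
      (d : ℝ) ^ 3 * ∑ a, nGram n (A n) (a, a) ^ 4 * stdMoment 8 := by
    intro n
    rw [hμ, integral_map (hmeas n).aemeasurable (by fun_prop)]
    refine (integral_mono (hint4 n) (hint8 n) fun s => norm_rowOuter_pow_le (A n) s hd).trans ?_
    rw [integral_const_mul, integral_finsetSum _ fun a _ => integrable_rowForm_pow (A n) _ 8]
    refine le_of_eq ?_
    congr 1
    refine Finset.sum_congr rfl fun a _ => ?_
    rw [show 8 = 2 * 4 from rfl, integral_rowForm_pow, bil_single]
  have hblim : Tendsto (fun n => (d : ℝ) ^ 3 * ∑ a, nGram n (A n) (a, a) ^ 4 * stdMoment 8) atTop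
      (𝓝 ((d : ℝ) ^ 3 * ∑ a, vec G (a, a) ^ 4 * stdMoment 8)) :=
    (tendsto_finsetSum _ fun a _ => ((hcoord (a, a)).pow 4).mul_const _).const_mul _
  have htR : Tendsto (fun n => (t n : ℝ)) atTop atTop := tendsto_natCast_atTop_atTop.comp ht
  set Q : Fin d × Fin d → Fin d × Fin d → ℝ := fun a b => gaussianFourth (vec G)
    (EuclideanSpace.single a.1 1) (EuclideanSpace.single a.2 1)
    (EuclideanSpace.single b.1 1) (EuclideanSpace.single b.2 1) with hQ
  have hmodel : SampleModel P t (fun n ω => rowSample n (S n ω) (A n)) μ (vec G).ofLp Q := by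
    refine ⟨?_, ?_, Eventually.of_forall hmem, fun a => ?_, fun a b => ?_, ?_, ?_⟩
    · filter_upwards [eventually_gt_atTop 0] with n hn
      exact HasIIDRows.iIndepFun_rowSample (hS n hn) (A n)
    · filter_upwards [eventually_gt_atTop 0] with n hn i
      exact HasIIDRows.hasLaw_rowSample (hS n hn) (A n) i
    · simp only [hfirst]
      exact hcoord a
    · simp only [hsecond]
      exact ((continuous_gaussianFourth _ _ _ _).tendsto _).comp hG
    · refine squeeze_zero (fun n => by positivity) (fun n => ?_)
        ((hblim.const_add 1).div_atTop (Real.tendsto_sqrt_atTop.comp htR))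
      change _ / _ ≤ _ / √(t n : ℝ)
      gcongr
      have hle : ∀ y : MatSpace d, ‖y‖ ^ 3 ≤ 1 + ‖y‖ ^ 4 := fun y => by
        nlinarith [sq_nonneg (‖y‖ ^ 2 - ‖y‖), sq_nonneg (‖y‖ - 1), sq_nonneg (‖y‖ ^ 2 - 1),
          norm_nonneg y]
      have hint3 : Integrable (fun y : MatSpace d => ‖y‖ ^ 3) (μ n) :=
        ((integrable_const 1).add (hint n)).mono' (by fun_prop) (ae_of_all _ fun y => by
          rw [Real.norm_of_nonneg (by positivity)]
          exact hle y)
      refine (integral_mono hint3 ((integrable_const 1).add (hint n)) hle).trans ?_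
      have hadd : ∫ y : MatSpace d, (1 + ‖y‖ ^ 4) ∂(μ n) = 1 + ∫ y, ‖y‖ ^ 4 ∂(μ n) := by
        rw [integral_add (integrable_const 1) (hint n)]
        simp
      refine hadd.le.trans ?_
      linarith [hbound n]
    · refine squeeze_zero (fun n => by positivity) (fun n => ?_) (hblim.div_atTop htR)
      gcongr
      exact hbound n
  refine ⟨μ, Q, hmodel, Eventually.of_forall fun n => ?_, fun x y hxy => ?_⟩
  · ext a
    exact hfirst n a
  -- Before the limit, the quadratic form at `rankOne x y` is the variance of a product of two
  -- Gaussian linear forms, which has a closed expression in the Gram matrix.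
  · refine tendsto_nhds_unique (hmodel.tendsto_integral_inner_sub_sq (rankOne x y)) ?_
    have hlim : Tendsto (fun n => gaussianFourth (nGram n (A n)) x y x y -
        bil (nGram n (A n)) x y ^ 2) atTop
        (𝓝 (gaussianFourth (vec G) x y x y - bil (vec G) x y ^ 2)) :=
      (((continuous_gaussianFourth x y x y).tendsto _).comp hG).sub
        ((tendsto_bil hG tendsto_const_nhds tendsto_const_nhds).pow 2)
    refine hlim.congr fun n => ?_
    have hmean : meanVec (μ n) = nGram n (A n) := by
      ext a
      exact hfirst n a
    rw [hmean, hμ, integral_map (hmeas n).aemeasurable (by fun_prop)]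
    have hin : ∀ s, inner ℝ (rowOuter (√(t n : ℝ) / √(n : ℝ)) (A n) s - nGram n (A n))
        (rankOne x y) = rowForm (t n) (A n) x s * rowForm (t n) (A n) y s -
          bil (nGram n (A n)) x y := by
      intro s
      rw [real_inner_comm, inner_sub_right, inner_rankOne, inner_rankOne]
      congr 1
      simp only [bil, rowOuter, outer, rowForm, Fintype.sum_prod_type, Finset.sum_mul_sum]
      exact Finset.sum_congr rfl fun _ _ => Finset.sum_congr rfl fun _ _ => by ring
    have hexp : ∀ s, inner ℝ (rowOuter (√(t n : ℝ) / √(n : ℝ)) (A n) s - nGram n (A n))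
        (rankOne x y) ^ 2 = rowForm (t n) (A n) x s * rowForm (t n) (A n) y s *
          (rowForm (t n) (A n) x s * rowForm (t n) (A n) y s) -
          2 * bil (nGram n (A n)) x y * (rowForm (t n) (A n) x s * rowForm (t n) (A n) y s) +
          bil (nGram n (A n)) x y ^ 2 := by
      intro s
      rw [hin]
      ring
    have hi2 : Integrable (fun s => rowForm (t n) (A n) x s * rowForm (t n) (A n) y s)
        (gaussianRowLaw (t n) n) := by
      refine ((integrable_rowForm_pow (A n) x 2).add (integrable_rowForm_pow (A n) y 2)).mono'
        ((measurable_rowForm _ _).mul (measurable_rowForm _ _)).aestronglyMeasurable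
        (ae_of_all _ fun s => ?_)
      rw [Real.norm_eq_abs, Pi.add_apply, abs_le]
      constructor <;> nlinarith [sq_nonneg (rowForm (t n) (A n) x s + rowForm (t n) (A n) y s),
        sq_nonneg (rowForm (t n) (A n) x s - rowForm (t n) (A n) y s)]
    have hi4 : Integrable (fun s => rowForm (t n) (A n) x s * rowForm (t n) (A n) y s *
          (rowForm (t n) (A n) x s * rowForm (t n) (A n) y s)) (gaussianRowLaw (t n) n) := by
      refine ((integrable_rowForm_pow (A n) x 4).add (integrable_rowForm_pow (A n) y 4)).mono'
        (((measurable_rowForm _ _).mul (measurable_rowForm _ _)).mul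
          ((measurable_rowForm _ _).mul (measurable_rowForm _ _))).aestronglyMeasurable
        (ae_of_all _ fun s => ?_)
      rw [Real.norm_eq_abs, Pi.add_apply, abs_le]
      constructor <;> nlinarith [sq_nonneg (rowForm (t n) (A n) x s ^ 2 -
        rowForm (t n) (A n) y s ^ 2), sq_nonneg (rowForm (t n) (A n) x s *
        rowForm (t n) (A n) y s), sq_nonneg (rowForm (t n) (A n) x s ^ 2),
        sq_nonneg (rowForm (t n) (A n) y s ^ 2)]
    simp only [hexp]
    have hi3 : Integrable (fun s => rowForm (t n) (A n) x s * rowForm (t n) (A n) y s *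
          (rowForm (t n) (A n) x s * rowForm (t n) (A n) y s) -
          2 * bil (nGram n (A n)) x y * (rowForm (t n) (A n) x s * rowForm (t n) (A n) y s))
          (gaussianRowLaw (t n) n) := hi4.sub (hi2.const_mul _)
    rw [integral_add hi3 (integrable_const _), integral_sub hi4 (hi2.const_mul _),
      integral_const_mul, integral_rowForm_four, integral_rowForm_mul]
    simp
    ring

end GaussianModel

lemma quadForm_rankOne_of_sign {d : ℕ} (M : Matrix (Fin d × Fin d) (Fin d × Fin d) ℝ)
    {x x' y y' : EuclideanSpace ℝ (Fin d)} (hx : x' = x ∨ x' = -x) (hy : y' = y ∨ y' = -y) :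
    (rankOne x' y').ofLp ⬝ᵥ M *ᵥ (rankOne x' y').ofLp =
      (rankOne x y).ofLp ⬝ᵥ M *ᵥ (rankOne x y).ofLp := by
  have hneg : ∀ z : MatSpace d, (-z).ofLp ⬝ᵥ M *ᵥ (-z).ofLp = z.ofLp ⬝ᵥ M *ᵥ z.ofLp := fun z => by
    rw [WithLp.ofLp_neg, Matrix.mulVec_neg, neg_dotProduct_neg]
  have hl : ∀ z w : EuclideanSpace ℝ (Fin d), rankOne (-z) w = -rankOne z w := fun z w => by
    ext; simp [rankOne]
  have hr : ∀ z w : EuclideanSpace ℝ (Fin d), rankOne z (-w) = -rankOne z w := fun z w => by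
    ext; simp [rankOne]
  rcases hx with rfl | rfl <;> rcases hy with rfl | rfl <;> simp only [hl, hr, hneg]

/-- Under either set of assumptions, the rows of the sketch satisfy the moment conditions, with
non-degenerate limits in the directions of the leading eigenvectors. -/
lemma exists_sampleModel {Ω : ℕ → Type*} [∀ n, MeasurableSpace (Ω n)] {P : ∀ n, Measure (Ω n)}
    [∀ n, IsProbabilityMeasure (P n)] {d : ℕ} (hd : 2 ≤ d) {t : ℕ → ℕ} [∀ n, NeZero (t n)]
    (ht : Tendsto t atTop atTop) {A : ∀ n : ℕ, Matrix (Fin n) (Fin d) ℝ}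
    {G : Matrix (Fin d) (Fin d) ℝ} {S : ∀ n, Ω n → Matrix (Fin (t n)) (Fin n) ℝ}
    (hS : ((∀ n, 0 < n → IsGaussianProjection (P n) (S n)) ∧ AssumptionRP A G) ∨
      ∃ p : ∀ n : ℕ, Fin n → ℝ, (∀ n, 0 < n → IsRowSampling (P n) (S n) (p n)) ∧
        AssumptionRS P t A S p G)
    {g : Fin d → EuclideanSpace ℝ (Fin d)} {lam : Fin d → ℝ} (hg : SortedEig (vec G) g lam)
    (hlam : StrictAnti lam) (hpos : ∀ l, 0 < lam l) :
    ∃ (μ : ℕ → Measure (MatSpace d)) (Q : Fin d × Fin d → Fin d × Fin d → ℝ),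
      SampleModel P t (fun n ω => rowSample n (S n ω) (A n)) μ (vec G).ofLp Q ∧
      (∀ᶠ n in atTop, meanVec (μ n) = nGram n (A n)) ∧
      0 < (rankOne (g ⟨0, by omega⟩) (g ⟨0, by omega⟩)).ofLp ⬝ᵥ
        (Matrix.of fun a b => Q a b - vec G a * vec G b) *ᵥ
        (rankOne (g ⟨0, by omega⟩) (g ⟨0, by omega⟩)).ofLp ∧
      0 < (rankOne (g ⟨0, by omega⟩) (g ⟨1, by omega⟩)).ofLp ⬝ᵥ
        (Matrix.of fun a b => Q a b - vec G a * vec G b) *ᵥ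
        (rankOne (g ⟨0, by omega⟩) (g ⟨1, by omega⟩)).ofLp := by
  rcases hS with ⟨hS, hA⟩ | ⟨p, hS, hA⟩
  · obtain ⟨μ, Q, hmodel, hmean, hcov⟩ := hA.exists_sampleModel ht hS (by omega)
    have hκ := one_lt_stdMoment_four
    have h0 := hpos ⟨0, by omega⟩
    have h1 := hpos ⟨1, by omega⟩
    have horth : bil (vec G) (g ⟨0, by omega⟩) (g ⟨1, by omega⟩) = 0 := by
      have hin : inner ℝ (g ⟨0, by omega⟩) (g ⟨1, by omega⟩) = 0 :=
        hg.orthonormal.2 (by simp)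
      rw [hg.eigen, hin, mul_zero]
    refine ⟨μ, Q, hmodel, hmean, ?_, ?_⟩
    · rw [hcov _ _ rfl, gaussianFourth_self, hg.bil_self]
      -- The variance along `g₀ g₀ᵀ` is `lam 0 ^ 2 * (stdMoment 4 - 1)`.
      nlinarith [mul_pos (pow_pos h0 2) (sub_pos.2 hκ)]
    · rw [hcov _ _ (hg.symm _ _), gaussianFourth_orthogonal _ horth (by rw [hg.symm, horth]),
        horth, hg.bil_self, hg.bil_self]
      -- The variance along `g₀ g₁ᵀ` is `lam 0 * lam 1 / 3 * stdMoment 4`.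
      have : 0 < stdMoment 4 := one_pos.trans hκ
      rw [sq, mul_zero, sub_zero]
      positivity
  · obtain ⟨μ, Q, hmodel, hmean, v₁, v₂, hv, hC₁, hC₂⟩ := hA.exists_sampleModel hS
    obtain ⟨e1, e2⟩ := hv.eq_or_eq_neg hg hlam hd
    rw [quadForm_rankOne_of_sign _ e1 e1] at hC₁
    rw [quadForm_rankOne_of_sign _ e1 e2] at hC₂
    exact ⟨μ, Q, hmodel, hmean, hC₁, hC₂⟩

end SketchedSVD

end

/-! ### The coverage theorem for both kinds of sketches -/

theorem theorem1
    {Ω : ℕ → Type*} [∀ n, MeasurableSpace (Ω n)]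
    (P : ∀ n, Measure (Ω n)) [∀ n, IsProbabilityMeasure (P n)]
    -- the fixed dimension, the number of singular triples, and the index set
    {d k : ℕ} (hd : 2 ≤ d) (hk : 0 < k) (hkd : k ≤ d)
    (J : Finset (Fin k)) (hJ : (⟨0, hk⟩ : Fin k) ∈ J)
    (α : ℝ) (hα : α ∈ Set.Ioo (0 : ℝ) 1)
    -- sketch sizes and numbers of bootstrap samples
    (t B : ℕ → ℕ) [∀ n, NeZero (t n)] (ht : Tendsto t atTop atTop) (hB : Tendsto B atTop atTop)
    -- the data matrices with their exact singular vectors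
    (A : ∀ n : ℕ, Matrix (Fin n) (Fin d) ℝ) (G : Matrix (Fin d) (Fin d) ℝ)
    (u : ∀ n : ℕ, Fin k → EuclideanSpace ℝ (Fin n))
    (v : ℕ → Fin k → EuclideanSpace ℝ (Fin d))
    (huv : ∀ n, d ≤ n → SketchedSVD.IsTopSVD (A n) (u n) (v n))
    -- the random sketching matrices
    (S : ∀ n, Ω n → Matrix (Fin (t n)) (Fin n) ℝ)
    (hS : ((∀ n, 0 < n → SketchedSVD.IsGaussianProjection (P n) (S n)) ∧
            SketchedSVD.AssumptionRP A G) ∨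
          (∃ p : ∀ n : ℕ, Fin n → ℝ,
            (∀ n, 0 < n → SketchedSVD.IsRowSampling (P n) (S n) (p n)) ∧
            SketchedSVD.AssumptionRS P t A S p G))
    -- any choice of right singular vectors of the sketches
    (vt : ∀ n, Ω n → Fin k → EuclideanSpace ℝ (Fin d))
    (hvt : ∀ n ω, SketchedSVD.IsTopRightSingular (S n ω * A n) (vt n ω))
    -- the bootstrap row indices, and any choice of right singular vectors of the resampled sketches
    (I : ∀ n, Ω n → Fin (B n) → Fin (t n) → Fin (t n))
    (hI : ∀ n, SketchedSVD.IsBootstrapSampling (P n) (S n) (I n))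
    (vs : ∀ n, Ω n → Fin (B n) → Fin k → EuclideanSpace ℝ (Fin d))
    (hvs : ∀ n ω b, SketchedSVD.IsTopRightSingular
      (SketchedSVD.resample (S n ω * A n) (I n ω b)) (vs n ω b)) :
    Tendsto (fun n => (P n).real {ω |
        SketchedSVD.errU J ⟨_, hJ⟩ (A n) (vt n ω) (u n) ≤
          SketchedSVD.quantile
            (fun b => SketchedSVD.bootErrU J ⟨_, hJ⟩ (S n ω * A n) (vs n ω b) (vt n ω)) (1 - α)})
      atTop (𝓝 (1 - α)) ∧
    Tendsto (fun n => (P n).real {ω |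
        SketchedSVD.errSigma J ⟨_, hJ⟩ (S n ω * A n) (A n) ≤
          SketchedSVD.quantile
            (fun b => SketchedSVD.errSigma J ⟨_, hJ⟩
              (SketchedSVD.resample (S n ω * A n) (I n ω b)) (S n ω * A n)) (1 - α)})
      atTop (𝓝 (1 - α)) ∧
    Tendsto (fun n => (P n).real {ω |
        SketchedSVD.errV J ⟨_, hJ⟩ (vt n ω) (v n) ≤
          SketchedSVD.quantile
            (fun b => SketchedSVD.errV J ⟨_, hJ⟩ (vs n ω b) (vt n ω)) (1 - α)})
      atTop (𝓝 (1 - α)) := by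
  have hA : SketchedSVD.AssumptionRP A G := by
    rcases hS with ⟨_, hA⟩ | ⟨_, _, hA⟩
    · exact hA
    · exact hA.toAssumptionRP
  obtain ⟨g, lam, hg, hlam, hpos⟩ := hA.exists_sortedEig
  obtain ⟨μ, Q, hmodel, hmean, hC₁, hC₂⟩ :=
    SketchedSVD.exists_sampleModel hd ht hS hg hlam hpos
  -- The leading index belongs to `J`, and `d ≥ 2` provides a second eigenvector with index `1`;
  -- their directions are those in which the limiting covariance is known to be nondegenerate.
  exact hmodel.tendsto_coverage_errors hmean hA.tendsto_nGram ht hB hα hI hkd ⟨_, hJ⟩ hg hlam hpos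
    hJ (l := ⟨1, by omega⟩) (by simp [Fin.ext_iff]) hC₁ hC₂ huv hvt hvs
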